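/- **Setting.** Let $a<b$. Consider either of two cases. *Closed case:* $\gamma:\mathbb R\to\mathbb R^2$ is $(b-a)$-periodic, injective on $[a,b)$, and $\Gamma=\gamma([a,b])$. *Open case:* $\gamma:[a,b]\to\mathbb R^2$ is injective and $\Gamma=\gamma([a,b])$. In both cases $\gamma$ is continuous and piecewise $C^2$ on $[a,b]$ (i.e. $C^2$ on each closed interval of some finite partition). Its one-sided derivatives satisfy $\gamma^{\prime_\ell}(t)\ne0$ on $(a,b]$ and $\gamma^{\prime_r}(t)\neq 0$ on $[a,b)$, and $\gamma^{\prime_\ell}(t)+c\,\gamma^{\prime_r}(t)\ne 0$ for all $c>0$ and all $t\in[a,b]$ (closed), resp. $t\in(a,b)$ (open). $\Gamma$ carries the arclength measure $|\cdot|$. *Mesh.* A partition $a=\check z_0<\dots<\check z_n=b$ gives parameter elements $\check T_j=[\check z_{j-1},\check z_j]$, elements $T_j=\gamma(\check T_j)$ forming $\mathcal T_h$, and the nodes $\mathcal N_h=\{\gamma(\check z_j)\}$ with $j=1,\dots,n$ (closed), resp. $j=0,\dots,n$ (open). Put $\kappa(\check{\mathcal T}_h)=\max\{|\check T_j|/|\check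 T_k| : T_j\cap T_k\ne\emptyset\}$, $\omega_h^0(T)=T$, $\omega_h^{m+1}(T)=\bigcup\{T'\in\mathcal T_h: T'\cap\omega_h^m(T)\ne\emptyset\}$, and $\omega_h(z)=\bigcup\{T\in\mathcal T_h: z\in T\}$. *NURBS.* Let $p\in\mathbb N_0$ and $m=\lceil p/2\rceil$. For nondecreasing knots $(t_i)_{i\in\mathbb Z}$ with $t_i\to\pm\infty$ as $i\to\pm\infty$ put $B_{i,0}=\chi_{[t_{i-1},t_i)}$ and $B_{i,p}=\beta_{i-1,p}B_{i,p-1}+(1-\beta_{i,p})B_{i+1,p-1}$, where $\beta_{i,p}(t)=\frac{t-t_i}{t_{i+p}-t_i}$ if $t_i\ne t_{i+p}$ and $\beta_{i,p}=0$ otherwise. For positive weights $(w_i)_{i\in\mathbb Z}$ put $R_{i,p}=w_iB_{i,p}/\sum_\ell w_\ell B_{\ell,p}$. On a mesh, each node $\check z_j$ is given a multiplicity $\le p+1$. Closed case: the resulting knots $t_1\le\dots\le t_N$ in $(a,b]$ (repetitions of $\check z_1,\dots,\check z_n$) and the weights $\mathcal W_h=(w_1,\dots,w_N)$ are extended by $t_{i+N}=t_i+(b-a)$,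 $w_{i+N}=w_i$. Open case: the multiplicities of $\check z_0$ and $\check z_n$ are $p+1$, and the knots $t_0\le\dots\le t_N$ in $[a,b]$ (repetitions of $\check z_0,\dots,\check z_n$) and the weights $\mathcal W_h=(w_1,\dots,w_{N-p})$ are extended arbitrarily, with $t_i<a$ for $i<0$, $t_i>b$ for $i>N$ and $w_i>0$. Let $\mathcal X_h$ be the space of all functions $\big(\sum_{i\in\mathbb Z}a_iR_{i,p}\big)\circ(\gamma|_D)^{-1}$ on $\Gamma$ with $a_i\in\mathbb R$, where $D=[a,b)$ (closed), resp. $D=[a,b]$ (open). *Sobolev spaces.* $H^{1/2}(\Gamma)$ carries the norm $\|u\|_{H^{1/2}(\Gamma)}^2=\|u\|_{L^2(\Gamma)}^2+|u|_{H^{1/2}(\Gamma)}^2$, where $|u|_{H^{1/2}(\omega)}^2=\int_\omega\int_\omega\frac{|u(x)-u(y)|^2}{|x-y|^2}\,dy\,dx$. $\widetilde H^{-1/2}(\Gamma)$ is its dual space with the dual norm, and $L^2(\Gamma)$ is mapped into it by $\phi\mapsto\int_\Gamma(\cdot)\phi$. **Theorem 4.4.** (i) For all $p$, $\kappa_{\max}$,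 $0<w_{\min}\le w_{\max}$ and every function $\varphi$ on $[a,b)$ there is $q\in(0,1]$, depending only on the case (closed or open), $a$, $b$, $\kappa_{\max}$, $w_{\min}$, $w_{\max}$, $p$ and $\varphi$, such that the following holds for all $\gamma$ as above with $|\gamma^{\prime_r}|=\varphi$ on $[a,b)$ and all meshes, knots and weights as above with $\kappa(\check{\mathcal T}_h)\le\kappa_{\max}$ and $w_{\min}\le\min\mathcal W_h$, $\max\mathcal W_h\le w_{\max}$: $\mathcal X_h$ is a subspace of $L^2(\Gamma)$, and - (A1) for each $T\in\mathcal T_h$ there is $\psi_T\in\mathcal X_h$ with connected support and $T\subseteq\operatorname{supp}\psi_T\subseteq\omega_h^m(T)$; - (A2) $\|1-\psi_T\|_{L^2(\operatorname{supp}\psi_T)}^2\le(1-q)\,|\operatorname{supp}\psi_T|$ for all $T\in\mathcal T_h$. (ii) Consequently the two-sided a posteriori estimate holds. Let $V:\widetilde H^{-1/2}(\Gamma)\to H^{1/2}(\Gamma)$ be an elliptic isomorphism. There is $C_{\rm eff}>0$, depending only on $\Gamma$, $\gamma$ and $V$, and for all $p,\kappa_{\max},w_{\min},w_{\max}$ as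 in (i) there is $C_{\rm rel}>0$, depending only on these numbers and on $\Gamma$, $\gamma$, $V$, such that for all meshes, knots and weights as in (i), where in the closed case also $\max_{T}|T|\le|\Gamma|/4$, for every $f\in H^{1/2}(\Gamma)$, for the solution $\phi\in\widetilde H^{-1/2}(\Gamma)$ of $\int_\Gamma V\phi\,\psi=\int_\Gamma f\psi$ for all $\psi\in\widetilde H^{-1/2}(\Gamma)$, and for the Galerkin solution $\phi_h\in\mathcal X_h$ of $\int_\Gamma V\phi_h\,\psi_h=\int_\Gamma f\psi_h$ for all $\psi_h\in\mathcal X_h$, the residual $r_h=f-V\phi_h$ satisfies $$C_{\rm rel}^{-1}\|\phi-\phi_h\|_{\widetilde H^{-1/2}(\Gamma)}\le\Big(\sum_{z\in\mathcal N_h}|r_h|_{H^{1/2}(\omega_h(z))}^2\Big)^{1/2}\le C_{\rm eff}\|\phi-\phi_h\|_{\widetilde H^{-1/2}(\Gamma)}.$$ -/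

import Mathlib

open Set Filter MeasureTheory
open scoped ENNReal

noncomputable section

namespace IGABEM

/-- The Euclidean plane. -/
abbrev Plane : Type := EuclideanSpace ℝ (Fin 2)

/-- The two geometric situations: a closed boundary curve, or an open arc. -/
inductive BdryType : Type
  | closedCurve : BdryType
  | openArc : BdryType

/-! ### Meshes of the parameter interval -/

/-- A partition `a = z 0 < z 1 < ⋯ < z n = b` of `[a, b]`. -/
structure Mesh (a b : ℝ) where
  n : ℕ
  z : Fin (n + 1) → ℝ
  strictMono : StrictMono z
  z_first : z 0 = a
  z_last : z (Fin.last n) = b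

namespace Mesh

variable {a b : ℝ}

/-- The `j`-th parameter element, a compact interval. -/
def cell (M : Mesh a b) (j : Fin M.n) : Set ℝ := Icc (M.z j.castSucc) (M.z j.succ)

/-- The length of the `j`-th parameter element. -/
def cellLength (M : Mesh a b) (j : Fin M.n) : ℝ := M.z j.succ - M.z j.castSucc

/-- The `j`-th boundary element `T`, the image of the parameter element. -/
def element (M : Mesh a b) (γ : ℝ → Plane) (j : Fin M.n) : Set Plane := γ '' M.cell j

/-- The shape regularity constant of the parameter mesh: the maximal quotient of the lengths of
two parameter elements whose images on the curve meet. -/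
def kappa (M : Mesh a b) (γ : ℝ → Plane) : ℝ :=
  sSup {r : ℝ | ∃ j k : Fin M.n, (M.element γ j ∩ M.element γ k).Nonempty ∧
    r = M.cellLength j / M.cellLength k}

/-- The patch of order `m` of the `j`-th element. -/
def patch (M : Mesh a b) (γ : ℝ → Plane) (j : Fin M.n) : ℕ → Set Plane
  | 0 => M.element γ j
  | m + 1 => ⋃ k ∈ {k : Fin M.n | (M.element γ k ∩ M.patch γ j m).Nonempty}, M.element γ k

/-- Indices of the nodes. On a closed curve `z 0` and `z n` give the same point, so that only
`z 1, …, z n` are used. -/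
def nodeIdx (k : BdryType) (M : Mesh a b) : Finset (Fin (M.n + 1)) :=
  match k with
  | .closedCurve => Finset.univ.erase 0
  | .openArc => Finset.univ

/-- The node patch: the union of all elements that contain the node `γ (z i)`. -/
def nodePatch (M : Mesh a b) (γ : ℝ → Plane) (i : Fin (M.n + 1)) : Set Plane :=
  ⋃ j ∈ {j : Fin M.n | γ (M.z i) ∈ M.element γ j}, M.element γ j

end Mesh

/-! ### Parametrized curves -/

/-- The left derivative. -/
def leftDeriv (γ : ℝ → Plane) (t : ℝ) : Plane := derivWithin γ (Iic t) t

/-- The right derivative. -/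
def rightDeriv (γ : ℝ → Plane) (t : ℝ) : Plane := derivWithin γ (Ici t) t

/-- The part of the parameter interval on which the parametrization is bijective onto the curve:
`[a, b)` for a closed curve, `[a, b]` for an open arc. -/
def paramDomain (k : BdryType) (a b : ℝ) : Set ℝ :=
  match k with
  | .closedCurve => Ico a b
  | .openArc => Icc a b

/-- `γ` parametrizes, over `[a, b]`, a closed curve (and then `γ` is the periodic extension of the
parametrization) or an open arc: it is continuous, piecewise twice continuously differentiable
up to the break points, injective, has nonvanishing one-sided derivatives, and has no cusps. For
an open arc, values of `γ` outside `[a, b]` play no role. -/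
structure IsParam (k : BdryType) (γ : ℝ → Plane) (a b : ℝ) : Prop where
  lt : a < b
  continuousOn : ContinuousOn γ (Icc a b)
  piecewise_C2 : ∃ S : Mesh a b, ∀ j, ContDiffOn ℝ 2 γ (S.cell j)
  injOn : InjOn γ (paramDomain k a b)
  periodic : match k with
    | .closedCurve => Function.Periodic γ (b - a)
    | .openArc => True
  left_ne : ∀ t ∈ Ioc a b, leftDeriv γ t ≠ 0
  right_ne : ∀ t ∈ Ico a b, rightDeriv γ t ≠ 0
  no_cusp : ∀ t ∈ (match k with
      | .closedCurve => Icc a b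
      | .openArc => Ioo a b),
    ∀ c : ℝ, 0 < c → leftDeriv γ t + c • rightDeriv γ t ≠ 0

/-- The arclength measure on the curve `γ([a, b])`, i.e. `∫ f = ∫ t in a..b, f (γ t) |γ' t|`; as a
measure on the plane it is concentrated on the curve. (At the finitely many break points `γ'`
stands for the right derivative.) -/
def arcMeasure (γ : ℝ → Plane) (a b : ℝ) : Measure Plane :=
  ((volume.restrict (Icc a b)).withDensity fun t => ‖rightDeriv γ t‖ₑ).map γ

instance (γ : ℝ → Plane) (a b : ℝ) : SFinite (arcMeasure γ a b) := by
  unfold arcMeasure; infer_instance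

/-- For closed curves, every element has at most a quarter of the total arclength. -/
def FineMesh (k : BdryType) (γ : ℝ → Plane) {a b : ℝ} (M : Mesh a b) : Prop :=
  match k with
  | .closedCurve => ∀ j, (arcMeasure γ a b).real (M.element γ j) ≤
      (arcMeasure γ a b).real (γ '' Icc a b) / 4
  | .openArc => True

/-! ### B-splines and NURBS -/

/-- Bi-infinite nondecreasing knot sequences without finite accumulation point. -/
structure KnotSeq where
  t : ℤ → ℝ
  mono : Monotone t
  tendsto_top : Tendsto t atTop atTop
  tendsto_bot : Tendsto t atBot atBot

/-- The multiplicity of `x` in a knot sequence. -/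
def KnotSeq.mult (K : KnotSeq) (x : ℝ) : ℕ := {i : ℤ | K.t i = x}.ncard

/-- The coefficient functions of the B-spline recursion. -/
def beta (t : ℤ → ℝ) (i : ℤ) (p : ℕ) (x : ℝ) : ℝ :=
  if t i = t (i + p) then 0 else (x - t i) / (t (i + p) - t i)

/-- `bspline t p i` is the `i`-th B-spline of degree `p`. -/
def bspline (t : ℤ → ℝ) : ℕ → ℤ → ℝ → ℝ
  | 0, i, x => (Ico (t (i - 1)) (t i)).indicator (fun _ => 1) x
  | p + 1, i, x => beta t (i - 1) (p + 1) x * bspline t p i x +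
      (1 - beta t i (p + 1) x) * bspline t p (i + 1) x

/-- `nurbs t w p i` is the `i`-th NURBS of degree `p` with weights `w`; the sum in the denominator
is locally finite. -/
def nurbs (t w : ℤ → ℝ) (p : ℕ) (i : ℤ) (x : ℝ) : ℝ :=
  w i * bspline t p i x / ∑ᶠ l : ℤ, w l * bspline t p l x

theorem bspline_support {t : ℤ → ℝ} (ht : Monotone t) (p : ℕ) :
    ∀ (i : ℤ) (x : ℝ), bspline t p i x ≠ 0 → t (i - 1) ≤ x ∧ x < t (i + p) := by
  induction p with
  | zero =>
    intro i x hx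
    by_contra hcon
    apply hx
    simp only [bspline]
    apply indicator_of_notMem
    simpa using hcon
  | succ p ih =>
    intro i x hx
    rw [bspline] at hx
    by_cases h : bspline t p i x = 0
    · have h2 : bspline t p (i + 1) x ≠ 0 := by
        intro h2; simp [h, h2] at hx
      obtain ⟨h3, h4⟩ := ih _ _ h2
      refine ⟨(ht (by omega)).trans h3, h4.trans_le (ht ?_)⟩
      push_cast; omega
    · obtain ⟨h3, h4⟩ := ih _ _ h
      refine ⟨h3, h4.trans_le (ht ?_)⟩
      push_cast; omega

theorem finite_bspline_support (K : KnotSeq) (p : ℕ) (x : ℝ) :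
    {i : ℤ | bspline K.t p i x ≠ 0}.Finite := by
  obtain ⟨u, hu⟩ := (K.tendsto_top.eventually_gt_atTop x).exists
  obtain ⟨l, hl⟩ := (K.tendsto_bot.eventually_le_atBot x).exists
  obtain ⟨l', hl'⟩ := (K.tendsto_bot.eventually_lt_atBot x).exists
  refine (Set.finite_Icc (l' - p) (u + 1)).subset fun i hi => ?_
  obtain ⟨h1, h2⟩ := bspline_support K.mono p i x hi
  constructor
  · by_contra hcon
    have := K.mono (show i + (p : ℤ) ≤ l' by omega)
    linarith
  · by_contra hcon
    have := K.mono (show u ≤ i - 1 by omega)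
    linarith

theorem finite_nurbs_support (K : KnotSeq) (w c : ℤ → ℝ) (p : ℕ) (x : ℝ) :
    (Function.support fun i : ℤ => c i * nurbs K.t w p i x).Finite := by
  refine (finite_bspline_support K p x).subset fun i hi h => hi ?_
  have h' : bspline K.t p i x = 0 := h
  simp [nurbs, h']

/-- The space of all (locally finite) linear combinations of NURBS of degree `p`, as functions on
the real line. -/
def nurbsSpace (K : KnotSeq) (w : ℤ → ℝ) (p : ℕ) : Submodule ℝ (ℝ → ℝ) where
  carrier := {g | ∃ c : ℤ → ℝ, g = fun x => ∑ᶠ i : ℤ, c i * nurbs K.t w p i x}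
  zero_mem' := ⟨0, by ext x; simp⟩
  add_mem' := by
    rintro _ _ ⟨c, rfl⟩ ⟨d, rfl⟩
    refine ⟨c + d, ?_⟩
    ext x
    simp only [Pi.add_apply, add_mul]
    exact (finsum_add_distrib (finite_nurbs_support K w c p x)
      (finite_nurbs_support K w d p x)).symm
  smul_mem' := by
    rintro r _ ⟨c, rfl⟩
    refine ⟨r • c, ?_⟩
    ext x
    simp only [Pi.smul_apply, smul_eq_mul, mul_assoc]
    exact mul_finsum' _ _ (finite_nurbs_support K w c p x)

/-- Composition with the inverse of `γ|_D`, giving functions on `γ(D)`, extended by zero. -/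
def transport (γ : ℝ → Plane) (D : Set ℝ) : (ℝ → ℝ) →ₗ[ℝ] (Plane → ℝ) where
  toFun g := (γ '' D).indicator (g ∘ Function.invFunOn γ D)
  map_add' f g := by
    ext x; by_cases h : x ∈ γ '' D <;> simp [Set.indicator, h]
  map_smul' r g := by
    ext x; by_cases h : x ∈ γ '' D <;> simp [Set.indicator, h]

/-- Knots and weights of degree `p` on a mesh. Every node carries a multiplicity `≤ p + 1`.
* Closed curve: the knots `t 1 ≤ ⋯ ≤ t N` in `(a, b]` run through the nodes `z 1, …, z n`; knots
  and weights are extended periodically.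
* Open arc: the knots `t 0 ≤ ⋯ ≤ t N` in `[a, b]` run through the nodes `z 0, …, z n`, where
  `a` and `b` have multiplicity `p + 1`; knots and weights are extended arbitrarily. -/
structure NurbsData (k : BdryType) (p : ℕ) {a b : ℝ} (M : Mesh a b) where
  N : ℕ
  knots : KnotSeq
  w : ℤ → ℝ
  w_pos : ∀ i, 0 < w i
  mult_le : ∀ i : Fin (M.n + 1), knots.mult (M.z i) ≤ p + 1
  compat : match k with
    | .closedCurve =>
        knots.t '' Icc 1 (N : ℤ) = M.z '' Ioi 0 ∧
        (∀ i, knots.t (i + N) = knots.t i + (b - a)) ∧ ∀ i, w (i + N) = w i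
    | .openArc =>
        knots.t '' Icc 0 (N : ℤ) = range M.z ∧
        (∀ i < 0, knots.t i < a) ∧ (∀ i > (N : ℤ), b < knots.t i) ∧
        knots.mult a = p + 1 ∧ knots.mult b = p + 1

namespace NurbsData

variable {k : BdryType} {p : ℕ} {a b : ℝ} {M : Mesh a b}

/-- The indices of the given (not extended) weights. -/
def weightIdx (D : NurbsData k p M) : Set ℤ :=
  match k with
  | .closedCurve => Icc 1 (D.N : ℤ)
  | .openArc => Icc 1 ((D.N : ℤ) - p)

/-- The given weights lie in `[wmin, wmax]`. -/
def WeightsIn (D : NurbsData k p M) (wmin wmax : ℝ) : Prop :=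
  ∀ i ∈ D.weightIdx, wmin ≤ D.w i ∧ D.w i ≤ wmax

/-- The transported NURBS space on the curve (functions on the plane vanishing off the curve). -/
def space (D : NurbsData k p M) (γ : ℝ → Plane) : Submodule ℝ (Plane → ℝ) :=
  (nurbsSpace D.knots D.w p).map (transport γ (paramDomain k a b))

/-- The transported NURBS space as a subspace of `L²`. -/
def spaceL2 (D : NurbsData k p M) (γ : ℝ → Plane) :
    Submodule ℝ (Lp ℝ 2 (arcMeasure γ a b)) where
  carrier := {u | ∃ ψ ∈ D.space γ, u =ᵐ[arcMeasure γ a b] ψ}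
  zero_mem' := ⟨0, Submodule.zero_mem _, Lp.coeFn_zero _ _ _⟩
  add_mem' := by
    rintro u v ⟨ψ, hψ, hu⟩ ⟨χ, hχ, hv⟩
    exact ⟨ψ + χ, Submodule.add_mem _ hψ hχ, (Lp.coeFn_add u v).trans (hu.add hv)⟩
  smul_mem' := by
    rintro c u ⟨ψ, hψ, hu⟩
    exact ⟨c • ψ, Submodule.smul_mem _ c hψ, (Lp.coeFn_smul c u).trans (hu.const_smul c)⟩

end NurbsData

/-- Assumptions (A1) and (A2) with patch order `m` and constant `q`: for every element `T` there is
`ψ_T` in the space with connected support, `T ⊆ supp ψ_T ⊆ ω^m(T)`, and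
`‖1 - ψ_T‖² ≤ (1 - q) |supp ψ_T|` in `L²(supp ψ_T)`. -/
def SatisfiesA1A2 {a b : ℝ} (M : Mesh a b) (γ : ℝ → Plane) (X : Submodule ℝ (Plane → ℝ))
    (m : ℕ) (q : ℝ) : Prop :=
  ∃ ψ : Fin M.n → Plane → ℝ, ∀ j,
    ψ j ∈ X ∧ IsConnected (tsupport (ψ j)) ∧
    M.element γ j ⊆ tsupport (ψ j) ∧ tsupport (ψ j) ⊆ M.patch γ j m ∧
    ∫ x in tsupport (ψ j), (1 - ψ j x) ^ 2 ∂(arcMeasure γ a b) ≤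
      (1 - q) * (arcMeasure γ a b).real (tsupport (ψ j))

/-! ### The spaces `H^{1/2}` and its dual -/

/-- `H^{1/2}` with the Sobolev-Slobodeckij norm: the pairs `(u, g)` with `u ∈ L²(μ)`,
`g ∈ L²(μ × μ)` and `g(x, y) = (u(x) - u(y)) / |x - y|`. Thus `u` determines the pair, and the
norm is `‖(u, g)‖² = ‖u‖² + ‖g‖² = ‖u‖² + |u|²_{1/2}`. -/
def HHalf (μ : Measure Plane) [SFinite μ] :
    Submodule ℝ (WithLp 2 (Lp ℝ 2 μ × Lp ℝ 2 (μ.prod μ))) where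
  carrier := {U | U.snd =ᵐ[μ.prod μ] fun P => (U.fst P.1 - U.fst P.2) / ‖P.1 - P.2‖}
  zero_mem' := by
    have h := Lp.coeFn_zero ℝ 2 μ
    have h1 := Measure.quasiMeasurePreserving_fst (μ := μ) (ν := μ) |>.ae h
    have h2 := Measure.quasiMeasurePreserving_snd (μ := μ) (ν := μ) |>.ae h
    filter_upwards [Lp.coeFn_zero ℝ 2 (μ.prod μ), h1, h2] with P h0 h1 h2
    simp only [WithLp.zero_fst, WithLp.zero_snd, h0, h1, h2]
    simp
  add_mem' := by
    intro U V hU hV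
    change _ =ᵐ[μ.prod μ] _ at hU hV ⊢
    have h := Lp.coeFn_add U.fst V.fst
    have h1 := Measure.quasiMeasurePreserving_fst (μ := μ) (ν := μ) |>.ae h
    have h2 := Measure.quasiMeasurePreserving_snd (μ := μ) (ν := μ) |>.ae h
    filter_upwards [Lp.coeFn_add U.snd V.snd, h1, h2, hU, hV] with P h0 h1 h2 hU hV
    simp only [WithLp.add_fst, WithLp.add_snd, h0, h1, h2, Pi.add_apply, hU, hV]
    ring
  smul_mem' := by
    intro c U hU
    change _ =ᵐ[μ.prod μ] _ at hU ⊢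
    have h := Lp.coeFn_smul c U.fst
    have h1 := Measure.quasiMeasurePreserving_fst (μ := μ) (ν := μ) |>.ae h
    have h2 := Measure.quasiMeasurePreserving_snd (μ := μ) (ν := μ) |>.ae h
    filter_upwards [Lp.coeFn_smul c U.snd, h1, h2, hU] with P h0 h1 h2 hU
    simp only [WithLp.smul_fst, WithLp.smul_snd, h0, h1, h2, Pi.smul_apply, hU, smul_eq_mul]
    ring

/-- The inclusion of `H^{1/2}` into `L²`. -/
def HHalf.toL2 (μ : Measure Plane) [SFinite μ] : HHalf μ →L[ℝ] Lp ℝ 2 μ :=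
  (WithLp.fstL 2 ℝ (Lp ℝ 2 μ) (Lp ℝ 2 (μ.prod μ))).comp (HHalf μ).subtypeL

/-- The dual space of `H^{1/2}`, with the dual norm. -/
abbrev HMinusHalf (μ : Measure Plane) [SFinite μ] : Type := StrongDual ℝ (HHalf μ)

/-- The embedding of `L²` into the dual of `H^{1/2}`: `φ ↦ (u ↦ ∫ φ u)`. -/
def embedL2 (μ : Measure Plane) [SFinite μ] (φ : Lp ℝ 2 μ) : HMinusHalf μ :=
  (innerSL ℝ φ).comp (HHalf.toL2 μ)

/-- Elliptic (coercive) operators. -/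
def IsElliptic {μ : Measure Plane} [SFinite μ] (V : HMinusHalf μ ≃L[ℝ] HHalf μ) : Prop :=
  ∃ c : ℝ, 0 < c ∧ ∀ ψ : HMinusHalf μ, c * ‖ψ‖ ^ 2 ≤ ψ (V ψ)

/-- The square of the Sobolev-Slobodeckij seminorm of `u` on `ω`. -/
def seminormSq (μ : Measure Plane) (ω : Set Plane) (u : Plane → ℝ) : ℝ :=
  ∫ P in ω ×ˢ ω, (u P.1 - u P.2) ^ 2 / ‖P.1 - P.2‖ ^ 2 ∂(μ.prod μ)

/-- The error estimator `η` for the residual `r`: the root of the sum over all nodes of the squared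
seminorms on the node patches. -/
def estimator (k : BdryType) (γ : ℝ → Plane) {a b : ℝ} (M : Mesh a b)
    (r : HHalf (arcMeasure γ a b)) : ℝ :=
  √(∑ i ∈ M.nodeIdx k,
    seminormSq (arcMeasure γ a b) (M.nodePatch γ i) (HHalf.toL2 (arcMeasure γ a b) r))

/-- `φ` solves `∫ Vφ ψ = ∫ f ψ` for all `ψ` in the dual of `H^{1/2}`. -/
def IsWeakSolution {μ : Measure Plane} [SFinite μ] (V : HMinusHalf μ ≃L[ℝ] HHalf μ)
    (f : HHalf μ) (φ : HMinusHalf μ) : Prop :=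
  ∀ ψ : HMinusHalf μ, ψ (V φ) = ψ f

/-- `φ` is the Galerkin solution in the subspace `X` of `L²`. -/
def IsGalerkinSolution {μ : Measure Plane} [SFinite μ] (V : HMinusHalf μ ≃L[ℝ] HHalf μ)
    (f : HHalf μ) (X : Submodule ℝ (Lp ℝ 2 μ)) (φ : Lp ℝ 2 μ) : Prop :=
  φ ∈ X ∧ ∀ ψ ∈ X, embedL2 μ ψ (V (embedL2 μ φ)) = embedL2 μ ψ f

end IGABEM

end

open IGABEM

/-!
Both parts are proved in the parameter interval. The arclength measure is the image under `γ` of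
`paramMeasure`, which is comparable to Lebesgue measure on `[a, b]` because the speed is bounded
from both sides; a function `r` of `H^{1/2}` becomes a function `u` on `[a, b]` (`pullback`), and
the integrand of its seminorm becomes a function on `[a, b]²` (`energy`).

*Part (i).* To the `j`-th cell, which is the knot span `(t (l - 1), t l)`, belongs the NURBS `R`
whose support extends `p / 2` knots to the left and `(p + 1) / 2` knots to the right of this span.
Moving by one knot moves by at most one node, so that the support lies in the patch of order
`⌈p / 2⌉`, and the ratio bound makes its length comparable to that of the cell
(`knot_sub_le_of_chain`). In the middle third of the cell, the B-spline recursion bounds `R` below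
(`pow_le_bspline`), with a constant that depends on `p`, the ratio bound and the weights only. As
`(1 - R)² ≤ 1 - R`, the integral of `R` over the middle third gives the required gain `q`. The speed
is prescribed, and with it the constants of comparison with Lebesgue measure, so that `q` does not
depend on `γ` otherwise.

*Efficiency.* The residual is the image of the error under `V`, and the estimator is at most
`√2` times its `H^{1/2}`-norm: in the sum of the seminorms over the node patches, each pair of cells
is counted at most twice, since an element contains at most two nodes (`sum_seminormSq_le_norm`).

*Reliability.* The residual `r` is orthogonal to the NURBS space, and this alone implies that
`‖r‖²` is bounded by the sum of the squared seminorms on the node patches (`exists_localization`).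
* Pairs of cells whose elements meet share a node, so that their energy occurs in the sum.
* For the other pairs, `|u s - u t|² ≤ 2 u s² + 2 u t²`. There the parameters have at least the
  distance `len / κ` (modulo the period), and `|γ s - γ t|` is bounded below by this distance
  (`chord_arc_open`, `chord_arc_closed`). Integration of the inverse square over the far field gives
  `∑ ∫ u² / len`, the sum of the weighted `L²`-norms over the cells (`exists_energy_bound`). The
  inverse square is replaced by a Cauchy kernel, whose integral over the real line is known.
* The weighted norms are bounded by the seminorms on the patches with the help of orthogonality to
  the test function of each cell (`exists_local_estimate`, `exists_weighted_estimate`).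

The chord-arc inequality holds locally because the one-sided derivatives are strict derivatives from
either side and no positive combination of them vanishes
(`StrictDerivAlong.lower_bound_two_sided`); injectivity and compactness make it global.
-/

namespace IGABEM

/-! ### Geometry of the curve -/

namespace Mesh

variable {a b : ℝ}

theorem exists_mem_Ico (M : Mesh a b) {t : ℝ} (ht : t ∈ Ico a b) :
    ∃ j : Fin M.n, t ∈ Ico (M.z j.castSucc) (M.z j.succ) := by
  by_contra! hcon
  have key : ∀ i, M.z i ≤ t := by
    intro i
    induction i using Fin.induction with
    | zero => rw [M.z_first]; exact ht.1
    | succ j ih =>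
      by_contra! hlt
      exact hcon j ⟨ih, hlt⟩
  have := key (Fin.last _)
  rw [M.z_last] at this
  exact absurd ht.2 (not_lt.2 this)

theorem exists_mem_Ioc (M : Mesh a b) {t : ℝ} (ht : t ∈ Ioc a b) :
    ∃ j : Fin M.n, t ∈ Ioc (M.z j.castSucc) (M.z j.succ) := by
  by_contra! hcon
  have key : ∀ i, M.z i < t := by
    intro i
    induction i using Fin.induction with
    | zero => rw [M.z_first]; exact ht.1
    | succ j ih =>
      by_contra! hlt
      exact hcon j ⟨ih, hlt⟩
  have := key (Fin.last _)
  rw [M.z_last] at this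
  exact absurd ht.2 (not_le.2 this)

theorem z_castSucc_lt_succ (M : Mesh a b) (j : Fin M.n) : M.z j.castSucc < M.z j.succ :=
  M.strictMono j.castSucc_lt_succ

theorem le_z (M : Mesh a b) (i : Fin (M.n + 1)) : a ≤ M.z i := by
  exact M.z_first.ge.trans (M.strictMono.monotone (Fin.zero_le i))

theorem z_le (M : Mesh a b) (i : Fin (M.n + 1)) : M.z i ≤ b := by
  exact (M.strictMono.monotone (Fin.le_last i)).trans M.z_last.le

theorem cell_subset (M : Mesh a b) (j : Fin M.n) : M.cell j ⊆ Icc a b :=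
  Icc_subset_Icc (M.le_z _) (M.z_le _)

theorem cellLength_pos (M : Mesh a b) (j : Fin M.n) : 0 < M.cellLength j :=
  sub_pos.2 (M.z_castSucc_lt_succ j)

end Mesh

section Derivatives

variable {γ : ℝ → Plane} {c d : ℝ}

theorem hasDerivWithinAt_of_contDiffOn (h : ContDiffOn ℝ 2 γ (Icc c d)) {t : ℝ}
    (ht : t ∈ Icc c d) :
    HasDerivWithinAt γ (derivWithin γ (Icc c d) t) (Icc c d) t :=
  ((h.differentiableOn (by norm_num)) t ht).hasDerivWithinAt

theorem continuousOn_derivWithin_of_contDiffOn (hcd : c < d) (h : ContDiffOn ℝ 2 γ (Icc c d)) :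
    ContinuousOn (derivWithin γ (Icc c d)) (Icc c d) :=
  h.continuousOn_derivWithin (uniqueDiffOn_Icc hcd) (by norm_num)

theorem rightDeriv_eq_derivWithin (h : ContDiffOn ℝ 2 γ (Icc c d)) {t : ℝ} (ht : t ∈ Ico c d) :
    rightDeriv γ t = derivWithin γ (Icc c d) t := by
  have h1 := hasDerivWithinAt_of_contDiffOn h (Ico_subset_Icc_self ht)
  have h2 : HasDerivWithinAt γ (derivWithin γ (Icc c d) t) (Ici t) t := by
    refine (h1.mono (Icc_subset_Icc_left ht.1)).mono_of_mem_nhdsWithin ?_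
    exact Icc_mem_nhdsGE ht.2
  exact h2.derivWithin (uniqueDiffOn_Ici t t self_mem_Ici)

theorem leftDeriv_eq_derivWithin (h : ContDiffOn ℝ 2 γ (Icc c d)) {t : ℝ} (ht : t ∈ Ioc c d) :
    leftDeriv γ t = derivWithin γ (Icc c d) t := by
  have h1 := hasDerivWithinAt_of_contDiffOn h (Ioc_subset_Icc_self ht)
  have h2 : HasDerivWithinAt γ (derivWithin γ (Icc c d) t) (Iic t) t := by
    refine (h1.mono (Icc_subset_Icc_right ht.2)).mono_of_mem_nhdsWithin ?_
    exact Icc_mem_nhdsLE ht.1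
  exact h2.derivWithin (uniqueDiffOn_Iic t t self_mem_Iic)

end Derivatives

/-- `v` is the strict derivative of `f` at `τ` along `S`: difference quotients over pairs of points
of `S` near `τ` converge to `v`. -/
def StrictDerivAlong (f : ℝ → Plane) (v : Plane) (S : Set ℝ) (τ : ℝ) : Prop :=
  ∀ ε > 0, ∃ δ > 0, ∀ s ∈ S, ∀ t ∈ S, |s - τ| < δ → |t - τ| < δ →
    ‖f t - f s - (t - s) • v‖ ≤ ε * |t - s|

namespace StrictDerivAlong

variable {f : ℝ → Plane} {v vl vr : Plane} {S T : Set ℝ} {τ : ℝ}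

theorem of_contDiffOn {c d : ℝ} (hcd : c < d) (h : ContDiffOn ℝ 2 f (Icc c d))
    (hτ : τ ∈ Icc c d) :
    StrictDerivAlong f (derivWithin f (Icc c d) τ) (Icc c d) τ := by
  intro ε hε
  have hc := continuousOn_derivWithin_of_contDiffOn hcd h τ hτ
  rw [Metric.continuousWithinAt_iff] at hc
  obtain ⟨δ, hδ, H⟩ := hc ε hε
  refine ⟨δ, hδ, fun s hs t ht hsτ htτ => ?_⟩
  have hconv : Convex ℝ (Icc c d ∩ Metric.ball τ δ) := (convex_Icc c d).inter (convex_ball τ δ)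
  have := hconv.norm_image_sub_le_of_norm_hasDerivWithin_le
    (f := fun x => f x - x • derivWithin f (Icc c d) τ)
    (f' := fun x => derivWithin f (Icc c d) x - derivWithin f (Icc c d) τ)
    (C := ε) (x := s) (y := t)
    (fun x hx => ?_) (fun x hx => ?_) ⟨hs, by simpa [Real.dist_eq] using hsτ⟩
    ⟨ht, by simpa [Real.dist_eq] using htτ⟩
  · rw [Real.norm_eq_abs] at this
    refine le_trans (le_of_eq ?_) this
    congr 1
    simp only [sub_smul]
    abel
  · have h1 := (hasDerivWithinAt_of_contDiffOn h hx.1).sub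
      ((hasDerivWithinAt_id x (Icc c d)).smul_const (derivWithin f (Icc c d) τ))
    simp only [one_smul] at h1
    exact h1.mono inter_subset_left
  · have := H hx.1 hx.2
    rw [dist_eq_norm] at this
    exact this.le

theorem mono (h : StrictDerivAlong f v S τ) {r : ℝ} (hr : 0 < r)
    (hST : ∀ s ∈ T, |s - τ| < r → s ∈ S) : StrictDerivAlong f v T τ := by
  intro ε hε
  obtain ⟨δ, hδ, H⟩ := h ε hε
  refine ⟨min δ r, lt_min hδ hr, fun s hs t ht h1 h2 => ?_⟩
  exact H s (hST s hs (h1.trans_le (min_le_right _ _)))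
    t (hST t ht (h2.trans_le (min_le_right _ _)))
    (h1.trans_le (min_le_left _ _)) (h2.trans_le (min_le_left _ _))

/-- A nonzero strict derivative makes `f` expanding near `τ`. -/
theorem lower_bound (h : StrictDerivAlong f v S τ) (hv : v ≠ 0) :
    ∃ c > 0, ∃ δ > 0, ∀ s ∈ S, ∀ t ∈ S, |s - τ| < δ → |t - τ| < δ →
      c * |s - t| ≤ ‖f s - f t‖ := by
  have hv' : 0 < ‖v‖ := norm_pos_iff.2 hv
  obtain ⟨δ, hδ, H⟩ := h (‖v‖ / 2) (by positivity)
  refine ⟨‖v‖ / 2, by positivity, δ, hδ, fun s hs t ht h1 h2 => ?_⟩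
  have h3 := H t ht s hs h2 h1
  have h4 : ‖(s - t) • v‖ ≤ ‖f s - f t‖ + ‖f s - f t - (s - t) • v‖ := by
    have := norm_sub_le (f s - f t) (f s - f t - (s - t) • v)
    simpa using this
  rw [norm_smul, Real.norm_eq_abs] at h4
  linarith

/-- The absence of cusps gives a uniform lower bound for positive combinations of the one-sided
derivatives. -/
theorem exists_norm_combination_ge (hl : vl ≠ 0) (hr : vr ≠ 0)
    (hc : ∀ c : ℝ, 0 < c → vl + c • vr ≠ 0) :
    ∃ m > 0, ∀ α β : ℝ, 0 ≤ α → 0 ≤ β → m * (α + β) ≤ ‖α • vl + β • vr‖ := by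
  have hcont : ContinuousOn (fun x : ℝ => ‖x • vl + (1 - x) • vr‖) (Icc 0 1) := by fun_prop
  obtain ⟨x, hx, hmin⟩ := isCompact_Icc.exists_isMinOn (nonempty_Icc.2 zero_le_one) hcont
  have hpos : 0 < ‖x • vl + (1 - x) • vr‖ := by
    rw [norm_pos_iff]
    intro h0
    rcases eq_or_lt_of_le hx.1 with h | h
    · subst h; simp at h0; exact hr h0
    · rcases eq_or_lt_of_le hx.2 with h' | h'
      · subst h'; simp at h0; exact hl h0
      · refine hc ((1 - x) / x) (div_pos (by linarith) h) ?_
        have : x • (vl + ((1 - x) / x) • vr) = 0 := by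
          rw [smul_add, smul_smul, mul_div_cancel₀ _ h.ne']
          exact h0
        exact (smul_eq_zero.1 this).resolve_left h.ne'
  refine ⟨_, hpos, fun α β hα hβ => ?_⟩
  rcases eq_or_lt_of_le (add_nonneg hα hβ) with h | h
  · rw [← h]; simp
  · have h1 := hmin (show α / (α + β) ∈ Icc (0 : ℝ) 1 from
      ⟨by positivity, (div_le_one h).2 (by linarith)⟩)
    have h2 : α • vl + β • vr =
        (α + β) • ((α / (α + β)) • vl + (1 - α / (α + β)) • vr) := by
      rw [smul_add, smul_smul, smul_smul]
      congr 2 <;> field_simp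
      ring
    rw [h2, norm_smul, Real.norm_eq_abs, abs_of_pos h, mul_comm]
    exact mul_le_mul_of_nonneg_left h1 h.le

/-- Two nonzero strict derivatives from either side that do not point in opposite directions make
`f` expanding near `τ`. -/
theorem lower_bound_two_sided (hl : StrictDerivAlong f vl (S ∩ Iic τ) τ)
    (hr : StrictDerivAlong f vr (S ∩ Ici τ) τ) (hτ : τ ∈ S) (hvl : vl ≠ 0) (hvr : vr ≠ 0)
    (hc : ∀ c : ℝ, 0 < c → vl + c • vr ≠ 0) :
    ∃ c > 0, ∃ δ > 0, ∀ s ∈ S, ∀ t ∈ S, |s - τ| < δ → |t - τ| < δ →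
      c * |s - t| ≤ ‖f s - f t‖ := by
  obtain ⟨m, hm, Hm⟩ := exists_norm_combination_ge hvl hvr hc
  obtain ⟨c1, hc1, δ1, hδ1, H1⟩ := hl.lower_bound hvl
  obtain ⟨c2, hc2, δ2, hδ2, H2⟩ := hr.lower_bound hvr
  obtain ⟨δ3, hδ3, H3⟩ := hl (m / 2) (by positivity)
  obtain ⟨δ4, hδ4, H4⟩ := hr (m / 2) (by positivity)
  have cross : ∀ s ∈ S, ∀ t ∈ S, |s - τ| < δ3 → |t - τ| < δ4 → s ≤ τ → τ ≤ t →
      m / 2 * |s - t| ≤ ‖f s - f t‖ := by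
    intro s hs t ht h1 h2 hsτ htτ
    have e1 := H3 s ⟨hs, hsτ⟩ τ ⟨hτ, self_mem_Iic⟩ h1 (by simpa using hδ3)
    have e2 := H4 τ ⟨hτ, self_mem_Ici⟩ t ⟨ht, htτ⟩ (by simpa using hδ4) h2
    have e3 := Hm (τ - s) (t - τ) (by linarith) (by linarith)
    rw [abs_of_nonneg (by linarith)] at e1 e2
    rw [abs_of_nonpos (by linarith)]
    have e4 : (τ - s) • vl + (t - τ) • vr = (f t - f s) -
        ((f τ - f s - (τ - s) • vl) + (f t - f τ - (t - τ) • vr)) := by abel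
    rw [e4] at e3
    have e5 := norm_sub_le (f t - f s)
      ((f τ - f s - (τ - s) • vl) + (f t - f τ - (t - τ) • vr))
    have e6 := norm_add_le (f τ - f s - (τ - s) • vl) (f t - f τ - (t - τ) • vr)
    rw [norm_sub_rev]
    nlinarith
  refine ⟨min (m / 2) (min c1 c2), by positivity, min (min δ1 δ2) (min δ3 δ4), by positivity,
    fun s hs t ht h1 h2 => ?_⟩
  simp only [lt_min_iff] at h1 h2
  have key : ∀ e, min (m / 2) (min c1 c2) ≤ e → e * |s - t| ≤ ‖f s - f t‖ →
      min (m / 2) (min c1 c2) * |s - t| ≤ ‖f s - f t‖ := fun e he h =>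
    (mul_le_mul_of_nonneg_right he (abs_nonneg _)).trans h
  rcases le_total s τ with hs' | hs' <;> rcases le_total t τ with ht' | ht'
  · exact key c1 ((min_le_right _ _).trans (min_le_left _ _))
      (H1 s ⟨hs, hs'⟩ t ⟨ht, ht'⟩ h1.1.1 h2.1.1)
  · exact key _ (min_le_left _ _) (cross s hs t ht h1.2.1 h2.2.2 hs' ht')
  · refine key _ (min_le_left _ _) ?_
    rw [abs_sub_comm, norm_sub_rev]
    exact cross t ht s hs h2.2.1 h1.2.2 ht' hs'
  · exact key c2 ((min_le_right _ _).trans (min_le_right _ _))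
      (H2 s ⟨hs, hs'⟩ t ⟨ht, ht'⟩ h1.1.2 h2.1.2)

end StrictDerivAlong

namespace IsParam

variable {k : BdryType} {γ : ℝ → Plane} {a b : ℝ}

theorem strictDerivAlong_right (h : IsParam k γ a b) {τ : ℝ} (hτ : τ ∈ Ico a b) :
    StrictDerivAlong γ (rightDeriv γ τ) (Ici τ) τ := by
  obtain ⟨S, hS⟩ := h.piecewise_C2
  obtain ⟨j, hj⟩ := S.exists_mem_Ico hτ
  rw [rightDeriv_eq_derivWithin (hS j) hj]
  refine (StrictDerivAlong.of_contDiffOn (S.z_castSucc_lt_succ j) (hS j)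
    (Ico_subset_Icc_self hj)).mono (sub_pos.2 hj.2) fun s hs hs' => ?_
  rw [abs_lt] at hs'
  exact ⟨hj.1.trans hs, by linarith⟩

theorem strictDerivAlong_left (h : IsParam k γ a b) {τ : ℝ} (hτ : τ ∈ Ioc a b) :
    StrictDerivAlong γ (leftDeriv γ τ) (Iic τ) τ := by
  obtain ⟨S, hS⟩ := h.piecewise_C2
  obtain ⟨j, hj⟩ := S.exists_mem_Ioc hτ
  rw [leftDeriv_eq_derivWithin (hS j) hj]
  refine (StrictDerivAlong.of_contDiffOn (S.z_castSucc_lt_succ j) (hS j)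
    (Ioc_subset_Icc_self hj)).mono (sub_pos.2 hj.1) fun s hs hs' => ?_
  rw [abs_lt] at hs'
  exact ⟨by linarith, le_trans hs hj.2⟩

/-- The speed is bounded away from `0` and `∞`. -/
theorem exists_speed_bounds (h : IsParam k γ a b) :
    ∃ c C : ℝ, 0 < c ∧ 0 < C ∧ ∀ t ∈ Ico a b, c ≤ ‖rightDeriv γ t‖ ∧ ‖rightDeriv γ t‖ ≤ C := by
  obtain ⟨S, hS⟩ := h.piecewise_C2
  have key : ∀ j : Fin S.n, ∃ c C : ℝ, 0 < c ∧ 0 < C ∧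
      ∀ t ∈ Ico (S.z j.castSucc) (S.z j.succ), c ≤ ‖rightDeriv γ t‖ ∧ ‖rightDeriv γ t‖ ≤ C := by
    intro j
    have hlt := S.z_castSucc_lt_succ j
    have hcont := (continuousOn_derivWithin_of_contDiffOn hlt (hS j)).norm
    obtain ⟨x, hx, hmin⟩ := isCompact_Icc.exists_isMinOn (nonempty_Icc.2 hlt.le) hcont
    obtain ⟨y, hy, hmax⟩ := isCompact_Icc.exists_isMaxOn (nonempty_Icc.2 hlt.le) hcont
    have hxpos : 0 < ‖derivWithin γ (Icc (S.z j.castSucc) (S.z j.succ)) x‖ := by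
      rw [norm_pos_iff]
      rcases eq_or_lt_of_le hx.2 with h' | h'
      · rw [← leftDeriv_eq_derivWithin (hS j) ⟨h' ▸ hlt, hx.2⟩]
        exact h.left_ne x ⟨(S.le_z _).trans_lt (h' ▸ hlt), hx.2.trans (S.z_le _)⟩
      · rw [← rightDeriv_eq_derivWithin (hS j) ⟨hx.1, h'⟩]
        exact h.right_ne x ⟨(S.le_z _).trans hx.1, h'.trans_le (S.z_le _)⟩
    refine ⟨_, _, hxpos, hxpos.trans_le (hmax hx), fun t ht => ?_⟩
    rw [rightDeriv_eq_derivWithin (hS j) ht]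
    exact ⟨hmin (Ico_subset_Icc_self ht), hmax (Ico_subset_Icc_self ht)⟩
  choose c C hc hC H using key
  obtain ⟨j0, _⟩ := S.exists_mem_Ico (left_mem_Ico.2 h.lt)
  have hne : (Finset.univ : Finset (Fin S.n)).Nonempty := ⟨j0, Finset.mem_univ _⟩
  refine ⟨Finset.univ.inf' hne c, Finset.univ.sup' hne C, ?_, ?_, fun t ht => ?_⟩
  · rw [Finset.lt_inf'_iff]; exact fun j _ => hc j
  · rw [Finset.lt_sup'_iff]; exact ⟨j0, Finset.mem_univ _, hC j0⟩
  · obtain ⟨j, hj⟩ := S.exists_mem_Ico ht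
    exact ⟨(Finset.inf'_le _ (Finset.mem_univ j)).trans (H j t hj).1,
      (H j t hj).2.trans (Finset.le_sup' _ (Finset.mem_univ j))⟩

theorem lipschitz (h : IsParam k γ a b) {C : ℝ}
    (hC : ∀ t ∈ Ico a b, ‖rightDeriv γ t‖ ≤ C) :
    ∀ s ∈ Icc a b, ∀ t ∈ Icc a b, ‖γ s - γ t‖ ≤ C * |s - t| := by
  have key : ∀ s ∈ Icc a b, ∀ t ∈ Icc s b, ‖γ t - γ s‖ ≤ C * (t - s) := by
    intro s hs
    refine norm_image_sub_le_of_norm_deriv_right_le_segment (f' := rightDeriv γ)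
      (h.continuousOn.mono (Icc_subset_Icc_left hs.1)) (fun x hx => ?_) fun x hx => hC x
        ⟨hs.1.trans hx.1, hx.2⟩
    obtain ⟨S, hS⟩ := h.piecewise_C2
    obtain ⟨j, hj⟩ := S.exists_mem_Ico (t := x) ⟨hs.1.trans hx.1, hx.2⟩
    rw [rightDeriv_eq_derivWithin (hS j) hj]
    exact ((hasDerivWithinAt_of_contDiffOn (hS j) (Ico_subset_Icc_self hj)).mono
      (Icc_subset_Icc_left hj.1)).mono_of_mem_nhdsWithin (Icc_mem_nhdsGE hj.2)
  intro s hs t ht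
  rcases le_total s t with h' | h'
  · rw [norm_sub_rev, abs_sub_comm, abs_of_nonneg (by linarith)]
    exact key s hs t ⟨h', ht.2⟩
  · rw [abs_of_nonneg (by linarith)]
    exact key t ht s ⟨h', hs.2⟩

/-- A lower bound of `‖γ s - γ t‖` by a multiple of a bounded function `D` holds on `[a, b]²` as
soon as it holds near every pair of parameters with the same image. -/
theorem exists_chord_bound (h : IsParam k γ a b) (D : ℝ → ℝ → ℝ) {B : ℝ}
    (hD : ∀ s ∈ Icc a b, ∀ t ∈ Icc a b, D s t ≤ B) (hB : 0 < B)
    (hD0 : ∀ s ∈ Icc a b, ∀ t ∈ Icc a b, 0 ≤ D s t)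
    (hloc : ∀ s ∈ Icc a b, ∀ t ∈ Icc a b, γ s = γ t → ∃ c > 0, ∃ δ > 0,
      ∀ s' ∈ Icc a b, ∀ t' ∈ Icc a b, |s' - s| < δ → |t' - t| < δ →
        c * D s' t' ≤ ‖γ s' - γ t'‖) :
    ∃ c > 0, ∀ s ∈ Icc a b, ∀ t ∈ Icc a b, c * D s t ≤ ‖γ s - γ t‖ := by
  have hK : IsCompact (Icc a b ×ˢ Icc a b) := isCompact_Icc.prod isCompact_Icc
  have main : ∃ c > 0, ∀ P ∈ Icc a b ×ˢ Icc a b, c * D P.1 P.2 ≤ ‖γ P.1 - γ P.2‖ := by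
    refine hK.induction_on (p := fun U => ∃ c > 0, ∀ P ∈ U, P ∈ Icc a b ×ˢ Icc a b →
      c * D P.1 P.2 ≤ ‖γ P.1 - γ P.2‖) ⟨1, one_pos, by simp⟩ ?_ ?_ ?_ |>.imp ?_
    · rintro U U' hU ⟨c, hc, H⟩
      exact ⟨c, hc, fun P hP => H P (hU hP)⟩
    · rintro U U' ⟨c, hc, H⟩ ⟨c', hc', H'⟩
      refine ⟨min c c', lt_min hc hc', fun P hP hPK => ?_⟩
      have h0 := hD0 _ hPK.1 _ hPK.2
      rcases hP with hP | hP
      · exact (mul_le_mul_of_nonneg_right (min_le_left _ _) h0).trans (H P hP hPK)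
      · exact (mul_le_mul_of_nonneg_right (min_le_right _ _) h0).trans (H' P hP hPK)
    · rintro ⟨s, t⟩ ⟨hs, ht⟩
      by_cases heq : γ s = γ t
      · obtain ⟨c, hc, δ, hδ, H⟩ := hloc s hs t ht heq
        refine ⟨Metric.ball s δ ×ˢ Metric.ball t δ, mem_nhdsWithin_of_mem_nhds
          (prod_mem_nhds (Metric.ball_mem_nhds _ hδ) (Metric.ball_mem_nhds _ hδ)), c, hc, ?_⟩
        rintro ⟨s', t'⟩ ⟨h1, h2⟩ ⟨h3, h4⟩
        exact H s' h3 t' h4 (by simpa [Real.dist_eq] using h1) (by simpa [Real.dist_eq] using h2)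
      · have hpos : 0 < ‖γ s - γ t‖ := norm_pos_iff.2 (sub_ne_zero.2 heq)
        have hcont : ContinuousOn (fun P : ℝ × ℝ => ‖γ P.1 - γ P.2‖) (Icc a b ×ˢ Icc a b) :=
          ((h.continuousOn.comp continuousOn_fst fun P hP => hP.1).sub
            (h.continuousOn.comp continuousOn_snd fun P hP => hP.2)).norm
        have hev := (hcont (s, t) ⟨hs, ht⟩).eventually (lt_mem_nhds (half_lt_self hpos))
        refine ⟨_, hev, ‖γ s - γ t‖ / 2 / B, by positivity, ?_⟩
        intro P hP hPK
        have h1 := hD _ hPK.1 _ hPK.2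
        have h2 : ‖γ s - γ t‖ / 2 < ‖γ P.1 - γ P.2‖ := hP
        calc ‖γ s - γ t‖ / 2 / B * D P.1 P.2 ≤ ‖γ s - γ t‖ / 2 / B * B := by gcongr
          _ = ‖γ s - γ t‖ / 2 := by field_simp
          _ ≤ _ := h2.le
    · rintro c ⟨hc, H⟩
      exact ⟨hc, fun P hP => H P hP hP⟩
  obtain ⟨c, hc, H⟩ := main
  exact ⟨c, hc, fun s hs t ht => H (s, t) ⟨hs, ht⟩⟩

/-- The chord-arc inequality for open arcs. -/
theorem chord_arc_open (h : IsParam .openArc γ a b) :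
    ∃ c > 0, ∀ s ∈ Icc a b, ∀ t ∈ Icc a b, c * |s - t| ≤ ‖γ s - γ t‖ := by
  have hlt := h.lt
  refine h.exists_chord_bound (fun s t => |s - t|) (B := b - a) (fun s hs t ht => ?_)
    (sub_pos.2 h.lt) (fun s _ t _ => abs_nonneg _) fun s hs t ht heq => ?_
  · rw [abs_le]; constructor <;> linarith [hs.1, hs.2, ht.1, ht.2]
  · obtain rfl : s = t := h.injOn hs ht heq
    rcases eq_or_lt_of_le hs.1 with h1 | h1
    · subst h1
      obtain ⟨c, hc, δ, hδ, H⟩ := (h.strictDerivAlong_right (left_mem_Ico.2 hlt)).lower_bound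
        (h.right_ne _ (left_mem_Ico.2 hlt))
      exact ⟨c, hc, δ, hδ, fun s' hs' t' ht' => H s' hs'.1 t' ht'.1⟩
    · rcases eq_or_lt_of_le hs.2 with h2 | h2
      · subst h2
        obtain ⟨c, hc, δ, hδ, H⟩ := (h.strictDerivAlong_left (right_mem_Ioc.2 hlt)).lower_bound
          (h.left_ne _ (right_mem_Ioc.2 hlt))
        exact ⟨c, hc, δ, hδ, fun s' hs' t' ht' => H s' hs'.2 t' ht'.2⟩
      · obtain ⟨c, hc, δ, hδ, H⟩ := StrictDerivAlong.lower_bound_two_sided (S := univ)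
          ((h.strictDerivAlong_left ⟨h1, hs.2⟩).mono one_pos fun _ h _ => h.2)
          ((h.strictDerivAlong_right ⟨hs.1, h2⟩).mono one_pos fun _ h _ => h.2)
          (mem_univ _) (h.left_ne s ⟨h1, hs.2⟩) (h.right_ne s ⟨hs.1, h2⟩) (h.no_cusp s ⟨h1, h2⟩)
        exact ⟨c, hc, δ, hδ, fun s' _ t' _ => H s' trivial t' trivial⟩

theorem leftDeriv_left_endpoint (h : IsParam .closedCurve γ a b) :
    leftDeriv γ a = leftDeriv γ b := by
  have hper : Function.Periodic γ (b - a) := h.periodic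
  have : γ = fun x => γ ((b - a) + x) := by
    funext x; rw [add_comm, hper x]
  unfold leftDeriv
  conv_lhs => rw [this]
  rw [derivWithin_comp_const_add]
  simp [← Set.image_vadd]

theorem rightDeriv_right_endpoint (h : IsParam .closedCurve γ a b) :
    rightDeriv γ b = rightDeriv γ a := by
  have hper : Function.Periodic γ (b - a) := h.periodic
  have : γ = fun x => γ ((b - a) + x) := by
    funext x; rw [add_comm, hper x]
  unfold rightDeriv
  conv_rhs => rw [this]
  rw [derivWithin_comp_const_add]
  simp [← Set.image_vadd]

/-- By periodicity, the end points of the parameter interval of a closed curve are on the same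
footing as the interior points. -/
theorem exists_local_bound_closed (h : IsParam .closedCurve γ a b) {τ : ℝ} (hτ : τ ∈ Icc a b) :
    ∃ c > 0, ∃ δ > 0, ∀ s t : ℝ, |s - τ| < δ → |t - τ| < δ → c * |s - t| ≤ ‖γ s - γ t‖ := by
  have hlt := h.lt
  have hper : Function.Periodic γ (b - a) := h.periodic
  have hl : StrictDerivAlong γ (leftDeriv γ τ) (Iic τ) τ ∧ leftDeriv γ τ ≠ 0 := by
    rcases eq_or_lt_of_le hτ.1 with h1 | h1
    · subst h1
      rw [h.leftDeriv_left_endpoint]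
      refine ⟨fun ε hε => ?_, h.left_ne _ (right_mem_Ioc.2 hlt)⟩
      obtain ⟨δ, hδ, H⟩ := h.strictDerivAlong_left (right_mem_Ioc.2 hlt) ε hε
      refine ⟨δ, hδ, fun s hs t ht h1 h2 => ?_⟩
      have := H (s + (b - a)) (by simp only [mem_Iic] at hs ⊢; linarith) (t + (b - a))
        (by simp only [mem_Iic] at ht ⊢; linarith)
        (by convert h1 using 2; ring) (by convert h2 using 2; ring)
      rwa [hper, hper, show t + (b - a) - (s + (b - a)) = t - s by ring] at this
    · exact ⟨h.strictDerivAlong_left ⟨h1, hτ.2⟩, h.left_ne _ ⟨h1, hτ.2⟩⟩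
  have hr : StrictDerivAlong γ (rightDeriv γ τ) (Ici τ) τ ∧ rightDeriv γ τ ≠ 0 := by
    rcases eq_or_lt_of_le hτ.2 with h1 | h1
    · subst h1
      rw [h.rightDeriv_right_endpoint]
      refine ⟨fun ε hε => ?_, h.right_ne _ (left_mem_Ico.2 hlt)⟩
      obtain ⟨δ, hδ, H⟩ := h.strictDerivAlong_right (left_mem_Ico.2 hlt) ε hε
      refine ⟨δ, hδ, fun s hs t ht h1 h2 => ?_⟩
      have := H (s - (τ - a)) (by simp only [mem_Ici] at hs ⊢; linarith) (t - (τ - a))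
        (by simp only [mem_Ici] at ht ⊢; linarith)
        (by convert h1 using 2; ring) (by convert h2 using 2; ring)
      rwa [hper.sub_eq, hper.sub_eq, show t - (τ - a) - (s - (τ - a)) = t - s by ring] at this
    · exact ⟨h.strictDerivAlong_right ⟨hτ.1, h1⟩, h.right_ne _ ⟨hτ.1, h1⟩⟩
  obtain ⟨c, hc, δ, hδ, H⟩ := StrictDerivAlong.lower_bound_two_sided (S := univ)
    (hl.1.mono one_pos fun _ h _ => h.2) (hr.1.mono one_pos fun _ h _ => h.2)
    (mem_univ _) hl.2 hr.2 (h.no_cusp τ hτ)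
  exact ⟨c, hc, δ, hδ, fun s t => H s trivial t trivial⟩

theorem eq_or_of_image_eq_closed (h : IsParam .closedCurve γ a b) {s t : ℝ} (hs : s ∈ Icc a b)
    (ht : t ∈ Icc a b) (heq : γ s = γ t) : s = t ∨ (s = a ∧ t = b) ∨ (s = b ∧ t = a) := by
  have hper : Function.Periodic γ (b - a) := h.periodic
  have hab : γ b = γ a := by simpa using hper a
  have hlt := h.lt
  rcases eq_or_lt_of_le hs.2 with h1 | h1 <;> rcases eq_or_lt_of_le ht.2 with h2 | h2
  · left; rw [h1, h2]
  · subst h1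
    right; right
    exact ⟨rfl, (h.injOn ⟨ht.1, h2⟩ (left_mem_Ico.2 hlt) (heq.symm.trans hab))⟩
  · subst h2
    right; left
    exact ⟨(h.injOn ⟨hs.1, h1⟩ (left_mem_Ico.2 hlt) (heq.trans hab)), rfl⟩
  · left; exact h.injOn ⟨hs.1, h1⟩ ⟨ht.1, h2⟩ heq

/-- The chord-arc inequality for closed curves, with the distance modulo the period. -/
theorem chord_arc_closed (h : IsParam .closedCurve γ a b) :
    ∃ c > 0, ∀ s ∈ Icc a b, ∀ t ∈ Icc a b,
      c * min |s - t| (b - a - |s - t|) ≤ ‖γ s - γ t‖ := by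
  have hlt := h.lt
  have hper : Function.Periodic γ (b - a) := h.periodic
  have hbd : ∀ s ∈ Icc a b, ∀ t ∈ Icc a b, |s - t| ≤ b - a := fun s hs t ht => by
    rw [abs_le]; constructor <;> linarith [hs.1, hs.2, ht.1, ht.2]
  refine h.exists_chord_bound (fun s t => min |s - t| (b - a - |s - t|)) (B := b - a)
    (fun s hs t ht => (min_le_left _ _).trans (hbd s hs t ht))
    (sub_pos.2 h.lt) (fun s hs t ht => le_min (abs_nonneg _) (sub_nonneg.2 (hbd s hs t ht)))
    fun s hs t ht heq => ?_
  rcases h.eq_or_of_image_eq_closed hs ht heq with h1 | ⟨h1, h2⟩ | ⟨h1, h2⟩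
  · subst h1
    obtain ⟨c, hc, δ, hδ, H⟩ := h.exists_local_bound_closed hs
    exact ⟨c, hc, δ, hδ, fun s' _ t' _ h1 h2 =>
      (mul_le_mul_of_nonneg_left (min_le_left _ _) hc.le).trans (H s' t' h1 h2)⟩
  · subst h1 h2
    obtain ⟨c, hc, δ, hδ, H⟩ := h.exists_local_bound_closed ht
    refine ⟨c, hc, δ, hδ, fun s' hs' t' ht' h1 h2 => ?_⟩
    have h3 := H (s' + (t - s)) t' (by convert h1 using 2; ring) h2
    rw [hper s'] at h3
    refine le_trans (mul_le_mul_of_nonneg_left (min_le_right _ _) hc.le) ?_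
    refine le_trans (mul_le_mul_of_nonneg_left ?_ hc.le) h3
    have h4 := neg_le_abs (s' - t')
    have h5 := le_abs_self (s' + (t - s) - t')
    linarith
  · subst h1 h2
    obtain ⟨c, hc, δ, hδ, H⟩ := h.exists_local_bound_closed hs
    refine ⟨c, hc, δ, hδ, fun s' hs' t' ht' h1 h2 => ?_⟩
    have h3 := H s' (t' + (s - t)) h1 (by convert h2 using 2; ring)
    rw [hper t'] at h3
    refine le_trans (mul_le_mul_of_nonneg_left (min_le_right _ _) hc.le) ?_
    refine le_trans (mul_le_mul_of_nonneg_left ?_ hc.le) h3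
    have h4 := le_abs_self (s' - t')
    have h5 := neg_le_abs (s' - (t' + (s - t)))
    linarith

end IsParam

/-! ### B-splines and NURBS -/

section BSpline

variable {t : ℤ → ℝ}

theorem beta_mem_Icc {i : ℤ} {p : ℕ} {x : ℝ} (h1 : t i ≤ x) (h2 : x ≤ t (i + p)) :
    beta t i p x ∈ Icc (0 : ℝ) 1 := by
  unfold beta
  split_ifs with h
  · simp
  · have h3 : 0 < t (i + p) - t i := sub_pos.2 (lt_of_le_of_ne (h1.trans h2) h)
    exact ⟨div_nonneg (by linarith) h3.le, (div_le_one h3).2 (by linarith)⟩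

theorem beta_left_mem_Icc (ht : Monotone t) {i : ℤ} {p : ℕ} {x : ℝ} (h : bspline t p i x ≠ 0) :
    beta t (i - 1) (p + 1) x ∈ Icc (0 : ℝ) 1 := by
  obtain ⟨h1, h2⟩ := bspline_support ht p i x h
  refine beta_mem_Icc h1 (h2.le.trans (le_of_eq ?_))
  congr 1; push_cast; ring

theorem beta_right_mem_Icc (ht : Monotone t) {i : ℤ} {p : ℕ} {x : ℝ}
    (h : bspline t p (i + 1) x ≠ 0) : beta t i (p + 1) x ∈ Icc (0 : ℝ) 1 := by
  obtain ⟨h1, h2⟩ := bspline_support ht p (i + 1) x h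
  refine beta_mem_Icc (by simpa using h1) (h2.le.trans (le_of_eq ?_))
  congr 1; push_cast; ring

theorem bspline_nonneg (ht : Monotone t) (p : ℕ) : ∀ (i : ℤ) (x : ℝ), 0 ≤ bspline t p i x := by
  induction p with
  | zero =>
    intro i x
    exact indicator_nonneg (fun _ _ => zero_le_one) x
  | succ p ih =>
    intro i x
    rw [bspline]
    refine add_nonneg ?_ ?_
    · by_cases h : bspline t p i x = 0
      · simp [h]
      · exact mul_nonneg (beta_left_mem_Icc ht h).1 (ih _ _)
    · by_cases h : bspline t p (i + 1) x = 0
      · simp [h]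
      · exact mul_nonneg (by linarith [(beta_right_mem_Icc ht h).2]) (ih _ _)

/-- A crude bound that is enough here (in fact B-splines are bounded by `1`). -/
theorem bspline_le_two_pow (ht : Monotone t) (p : ℕ) :
    ∀ (i : ℤ) (x : ℝ), bspline t p i x ≤ 2 ^ p := by
  induction p with
  | zero =>
    intro i x
    simpa [bspline] using indicator_le_self' (s := Ico (t (i - 1)) (t i))
      (f := fun _ => (1 : ℝ)) (fun _ _ => zero_le_one) x
  | succ p ih =>
    intro i x
    rw [bspline, pow_succ, mul_two]
    refine add_le_add ?_ ?_
    · by_cases h : bspline t p i x = 0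
      · simp [h]
      · have := beta_left_mem_Icc ht h
        exact (mul_le_of_le_one_left (bspline_nonneg ht _ _ _) this.2).trans (ih _ _)
    · by_cases h : bspline t p (i + 1) x = 0
      · simp [h]
      · have := beta_right_mem_Icc ht h
        exact (mul_le_of_le_one_left (bspline_nonneg ht _ _ _) (by linarith [this.1])).trans
          (ih _ _)

/-- In the knot span `(t (l - 1), t l)`, a B-spline that is active there is bounded below by a
power of the distance to the knots relative to the length of its support: each step of the
recursion has a summand with an active B-spline, whose coefficient is bounded below. -/
theorem pow_le_bspline (ht : Monotone t) {l : ℤ} {x Θ : ℝ} (hΘ : 0 ≤ Θ) (p : ℕ) :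
    ∀ i : ℤ, i ≤ l → l ≤ i + p → t (l - 1) < x → x < t l →
      Θ * (t (i + p) - t (i - 1)) ≤ x - t (l - 1) → Θ * (t (i + p) - t (i - 1)) ≤ t l - x →
      Θ ^ p ≤ bspline t p i x := by
  induction p with
  | zero =>
    intro i h1 h2 h3 h4 _ _
    obtain rfl : i = l := by simp at h2; omega
    simp [bspline, h3.le, h4]
  | succ p ih =>
    intro i h1 h2 h3 h4 h5 h6
    have n1 : 0 ≤ beta t (i - 1) (p + 1) x * bspline t p i x := by
      by_cases h : bspline t p i x = 0
      · simp [h]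
      · exact mul_nonneg (beta_left_mem_Icc ht h).1 (bspline_nonneg ht _ _ _)
    have n2 : 0 ≤ (1 - beta t i (p + 1) x) * bspline t p (i + 1) x := by
      by_cases h : bspline t p (i + 1) x = 0
      · simp [h]
      · exact mul_nonneg (by linarith [(beta_right_mem_Icc ht h).2]) (bspline_nonneg ht _ _ _)
    rw [bspline, pow_succ]
    by_cases hl : l ≤ i + p
    · have e1 : t (i - 1) ≤ t (l - 1) := ht (by omega)
      have e2 : t l ≤ t (i + p) := ht hl
      have e3 : t (i + p) ≤ t (i + (p + 1 : ℕ)) := ht (by push_cast; omega)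
      have e4 : Θ * (t (i + p) - t (i - 1)) ≤ Θ * (t (i + (p + 1 : ℕ)) - t (i - 1)) := by gcongr
      have hB := ih i h1 hl h3 h4 (e4.trans h5) (e4.trans h6)
      have hβ : Θ ≤ beta t (i - 1) (p + 1) x := by
        have e5 : i - 1 + ((p + 1 : ℕ) : ℤ) = i + p := by push_cast; ring
        unfold beta
        rw [e5, if_neg (by linarith), le_div_iff₀ (by linarith)]
        linarith
      have : Θ ^ p * Θ ≤ beta t (i - 1) (p + 1) x * bspline t p i x := by
        rw [mul_comm]
        exact mul_le_mul hβ hB (by positivity) (hΘ.trans hβ)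
      linarith
    · have hl' : l = i + 1 + p := by push_cast at h2; omega
      have e1 : t i ≤ t (l - 1) := ht (by omega)
      have e6 : t (i - 1) ≤ t i := ht (by omega)
      have e3 : i + 1 + (p : ℤ) = i + (p + 1 : ℕ) := by push_cast; ring
      have e4 : Θ * (t (i + 1 + p) - t (i + 1 - 1)) ≤
          Θ * (t (i + (p + 1 : ℕ)) - t (i - 1)) := by
        rw [e3, add_sub_cancel_right]; gcongr
      have e5 : t (i + (p + 1 : ℕ)) = t l := by rw [hl', e3]
      have hB := ih (i + 1) (by omega) hl'.le h3 h4 (e4.trans h5) (e4.trans h6)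
      have hβ : Θ ≤ 1 - beta t i (p + 1) x := by
        have e7 : 0 < t l - t i := by linarith
        unfold beta
        rw [e5, if_neg (by linarith), one_sub_div e7.ne', le_div_iff₀ e7]
        rw [e5] at h6
        have : Θ * (t l - t i) ≤ Θ * (t l - t (i - 1)) := by gcongr
        linarith
      have : Θ ^ p * Θ ≤ (1 - beta t i (p + 1) x) * bspline t p (i + 1) x := by
        rw [mul_comm]
        exact mul_le_mul hβ hB (by positivity) (hΘ.trans hβ)
      linarith

theorem measurable_bspline (t : ℤ → ℝ) (p : ℕ) : ∀ i : ℤ, Measurable (bspline t p i) := by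
  induction p with
  | zero => exact fun i => measurable_const.indicator measurableSet_Ico
  | succ p ih =>
    intro i
    have hβ : ∀ j q, Measurable (beta t j q) := by
      intro j q
      unfold beta
      split_ifs <;> fun_prop
    exact ((hβ _ _).mul (ih _)).add ((measurable_const.sub (hβ _ _)).mul (ih _))

end BSpline

namespace KnotSeq

variable (K : KnotSeq)

theorem exists_span (x : ℝ) : ∃ l : ℤ, K.t (l - 1) ≤ x ∧ x < K.t l := by
  obtain ⟨u, hu⟩ := (K.tendsto_top.eventually_gt_atTop x).exists
  obtain ⟨v, hv⟩ := (K.tendsto_bot.eventually_le_atBot x).exists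
  obtain ⟨m, hm, hmax⟩ := Int.exists_greatest_of_bdd (P := fun i => K.t i ≤ x)
    ⟨u, fun i hi => by
      by_contra! hlt
      exact absurd (K.mono hlt.le) (not_le.2 (lt_of_le_of_lt hi hu))⟩ ⟨v, hv⟩
  refine ⟨m + 1, by simpa using hm, ?_⟩
  by_contra! h
  have := hmax _ h
  omega

theorem lt_of_t_lt {i j : ℤ} (h : K.t i < K.t j) : i < j := by
  by_contra! hle
  exact absurd (K.mono hle) (not_le.2 h)

end KnotSeq

section Nurbs

variable (K : KnotSeq) {w : ℤ → ℝ} {p : ℕ}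

theorem finite_weighted_bspline (w : ℤ → ℝ) (p : ℕ) (x : ℝ) :
    (Function.support fun i : ℤ => w i * bspline K.t p i x).Finite :=
  (finite_bspline_support K p x).subset fun i hi h =>
    hi (by simp [show bspline K.t p i x = 0 from h])

theorem weighted_bspline_le_finsum (hw : ∀ i, 0 < w i) (i : ℤ) (x : ℝ) :
    w i * bspline K.t p i x ≤ ∑ᶠ l : ℤ, w l * bspline K.t p l x :=
  single_le_finsum i (finite_weighted_bspline K w p x) fun j =>
    mul_nonneg (hw j).le (bspline_nonneg K.mono _ _ _)

theorem finsum_weighted_bspline_nonneg (hw : ∀ i, 0 < w i) (x : ℝ) :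
    0 ≤ ∑ᶠ l : ℤ, w l * bspline K.t p l x :=
  finsum_nonneg fun j => mul_nonneg (hw j).le (bspline_nonneg K.mono _ _ _)

theorem nurbs_nonneg (hw : ∀ i, 0 < w i) (i : ℤ) (x : ℝ) : 0 ≤ nurbs K.t w p i x :=
  div_nonneg (mul_nonneg (hw i).le (bspline_nonneg K.mono _ _ _))
    (finsum_weighted_bspline_nonneg K hw x)

theorem nurbs_le_one (hw : ∀ i, 0 < w i) (i : ℤ) (x : ℝ) : nurbs K.t w p i x ≤ 1 :=
  div_le_one_of_le₀ (weighted_bspline_le_finsum K hw i x) (finsum_weighted_bspline_nonneg K hw x)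

theorem nurbs_pos (hw : ∀ i, 0 < w i) {i : ℤ} {x : ℝ} (h : 0 < bspline K.t p i x) :
    0 < nurbs K.t w p i x :=
  div_pos (mul_pos (hw i) h)
    ((mul_pos (hw i) h).trans_le (weighted_bspline_le_finsum K hw i x))

theorem bspline_ne_zero_of_nurbs {i : ℤ} {x : ℝ} (h : nurbs K.t w p i x ≠ 0) :
    bspline K.t p i x ≠ 0 := by
  intro h0
  simp [nurbs, h0] at h

theorem finsum_weighted_bspline_le {x W : ℝ}
    (hW : ∀ l, bspline K.t p l x ≠ 0 → w l ≤ W) (hW0 : 0 ≤ W) :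
    ∑ᶠ l : ℤ, w l * bspline K.t p l x ≤ (p + 1) * 2 ^ p * W := by
  obtain ⟨m, hm1, hm2⟩ := K.exists_span x
  rw [finsum_eq_sum_of_support_subset (s := Finset.Icc (m - p) m)]
  · calc ∑ l ∈ Finset.Icc (m - (p : ℤ)) m, w l * bspline K.t p l x
        ≤ ∑ l ∈ Finset.Icc (m - (p : ℤ)) m, 2 ^ p * W := by
          refine Finset.sum_le_sum fun l _ => ?_
          by_cases h : bspline K.t p l x = 0
          · rw [h, mul_zero]; positivity
          · calc w l * bspline K.t p l x ≤ W * bspline K.t p l x :=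
                  mul_le_mul_of_nonneg_right (hW l h) (bspline_nonneg K.mono _ _ _)
              _ ≤ W * 2 ^ p := mul_le_mul_of_nonneg_left (bspline_le_two_pow K.mono _ _ _) hW0
              _ = _ := mul_comm _ _
      _ = (p + 1) * 2 ^ p * W := by
          rw [Finset.sum_const, Int.card_Icc, nsmul_eq_mul,
            show (m + 1 - (m - (p : ℤ))).toNat = p + 1 by omega]
          push_cast; ring
  · intro l hl
    have h0 : bspline K.t p l x ≠ 0 := fun h => hl (by simp [h])
    obtain ⟨h1, h2⟩ := bspline_support K.mono p l x h0
    have h3 := K.lt_of_t_lt (h1.trans_lt hm2)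
    have h4 := K.lt_of_t_lt (hm1.trans_lt h2)
    simp only [Finset.coe_Icc, mem_Icc]
    omega

theorem le_nurbs {x W c : ℝ} {i : ℤ} (hw : ∀ i, 0 < w i)
    (hW : ∀ l, bspline K.t p l x ≠ 0 → w l ≤ W) (hW0 : 0 < W) {w0 : ℝ}
    (hwi : w0 ≤ w i) (hc : 0 < c) (hB : c ≤ bspline K.t p i x) :
    w0 * c / ((p + 1) * 2 ^ p * W) ≤ nurbs K.t w p i x := by
  have hpos : 0 < w i * bspline K.t p i x := mul_pos (hw i) (hc.trans_le hB)
  refine div_le_div₀ hpos.le ?_ (hpos.trans_le (weighted_bspline_le_finsum K hw i x))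
    (finsum_weighted_bspline_le K hW hW0.le)
  exact mul_le_mul hwi hB hc.le (hw i).le

/-- Only finitely many B-splines do not vanish on a bounded interval. -/
theorem exists_finset_bspline_active (K : KnotSeq) (p : ℕ) (a b : ℝ) :
    ∃ F : Finset ℤ, ∀ x ∈ Icc a b, ∀ i, bspline K.t p i x ≠ 0 → i ∈ F := by
  obtain ⟨u, hu1, hu2⟩ := K.exists_span b
  obtain ⟨v, hv1, hv2⟩ := K.exists_span a
  refine ⟨Finset.Icc (v - p) u, fun x hx i hi => ?_⟩
  obtain ⟨h1, h2⟩ := bspline_support K.mono p i x hi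
  have h3 := K.lt_of_t_lt ((h1.trans hx.2).trans_lt hu2)
  have h4 := K.lt_of_t_lt ((hv1.trans hx.1).trans_lt h2)
  simp only [Finset.mem_Icc]
  omega

/-- On a bounded interval every element of the NURBS space coincides with a bounded measurable
function. -/
theorem exists_bounded_measurable_of_mem_nurbsSpace (hw : ∀ i, 0 < w i) {g : ℝ → ℝ}
    (hg : g ∈ nurbsSpace K w p) (a b : ℝ) :
    ∃ (f : ℝ → ℝ) (C : ℝ), Measurable f ∧ ∀ x ∈ Icc a b, g x = f x ∧ |f x| ≤ C := by
  obtain ⟨c, rfl⟩ := hg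
  obtain ⟨F, hF⟩ := exists_finset_bspline_active K p a b
  have hden : ∀ x ∈ Icc a b, ∑ᶠ l : ℤ, w l * bspline K.t p l x =
      ∑ l ∈ F, w l * bspline K.t p l x := by
    intro x hx
    refine finsum_eq_sum_of_support_subset _ fun l hl => hF x hx l fun h => hl (by simp [h])
  have hnum : ∀ x ∈ Icc a b, ∑ᶠ i : ℤ, c i * nurbs K.t w p i x =
      ∑ i ∈ F, c i * nurbs K.t w p i x := by
    intro x hx
    refine finsum_eq_sum_of_support_subset _ fun l hl => hF x hx l fun h => hl ?_
    simp [nurbs, h]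
  refine ⟨fun x => ∑ i ∈ F, c i * (w i * bspline K.t p i x / ∑ l ∈ F, w l * bspline K.t p l x),
    ∑ i ∈ F, |c i|, ?_, fun x hx => ?_⟩
  · have := measurable_bspline K.t p
    fun_prop
  · have e : ∑ᶠ i : ℤ, c i * nurbs K.t w p i x =
        ∑ i ∈ F, c i * (w i * bspline K.t p i x / ∑ l ∈ F, w l * bspline K.t p l x) := by
      rw [hnum x hx]
      exact Finset.sum_congr rfl fun i _ => by rw [nurbs, hden x hx]
    refine ⟨e, ?_⟩
    dsimp only
    rw [← e, hnum x hx]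
    refine (Finset.abs_sum_le_sum_abs _ _).trans (Finset.sum_le_sum fun i _ => ?_)
    rw [abs_mul, abs_of_nonneg (nurbs_nonneg K hw i x)]
    exact mul_le_of_le_one_right (abs_nonneg _) (nurbs_le_one K hw i x)

theorem nurbs_mem_nurbsSpace (i : ℤ) : nurbs K.t w p i ∈ nurbsSpace K w p := by
  refine ⟨Pi.single i 1, ?_⟩
  ext x
  rw [finsum_eq_single _ i fun j hj => by simp [hj]]
  simp

end Nurbs

/-! ### Knots and mesh -/

namespace Mesh

variable {k : BdryType} {γ : ℝ → Plane} {a b : ℝ}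

theorem cellLength_le_of_kappa (M : Mesh a b) {κ : ℝ} (hκ : M.kappa γ ≤ κ) {i j : Fin M.n}
    (h : (M.element γ i ∩ M.element γ j).Nonempty) :
    M.cellLength i ≤ κ * M.cellLength j := by
  rw [← div_le_iff₀ (M.cellLength_pos j)]
  refine le_trans ?_ hκ
  unfold kappa
  refine le_csSup ?_ ⟨i, j, h, rfl⟩
  refine ((Set.finite_range fun P : Fin M.n × Fin M.n =>
    M.cellLength P.1 / M.cellLength P.2).subset ?_).bddAbove
  rintro _ ⟨i, j, _, rfl⟩
  exact ⟨(i, j), rfl⟩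

theorem left_mem_element (M : Mesh a b) (γ : ℝ → Plane) (j : Fin M.n) :
    γ (M.z j.castSucc) ∈ M.element γ j :=
  ⟨_, left_mem_Icc.2 (M.z_castSucc_lt_succ j).le, rfl⟩

theorem right_mem_element (M : Mesh a b) (γ : ℝ → Plane) (j : Fin M.n) :
    γ (M.z j.succ) ∈ M.element γ j :=
  ⟨_, right_mem_Icc.2 (M.z_castSucc_lt_succ j).le, rfl⟩

/-- The bound `κ` on the mesh ratio, in the form in which it is used: it bounds the quotients of
the lengths of consecutive cells, cyclically for closed curves. -/
structure RatioBound (k : BdryType) (M : Mesh a b) (κ : ℝ) : Prop where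
  one_le : 1 ≤ κ
  next_le : ∀ i j : Fin M.n, i.succ = j.castSucc → M.cellLength j ≤ κ * M.cellLength i
  prev_le : ∀ i j : Fin M.n, i.succ = j.castSucc → M.cellLength i ≤ κ * M.cellLength j
  wrap : match k with
    | .closedCurve => ∀ i j : Fin M.n, i.succ = Fin.last _ → j.castSucc = 0 →
        M.cellLength i ≤ κ * M.cellLength j ∧ M.cellLength j ≤ κ * M.cellLength i
    | .openArc => True

theorem ratioBound_of_kappa (h : IsParam k γ a b) (M : Mesh a b) {κ : ℝ} (hκ : M.kappa γ ≤ κ) :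
    M.RatioBound k κ where
  one_le := by
    obtain ⟨j, -⟩ := M.exists_mem_Ico (left_mem_Ico.2 h.lt)
    have := M.cellLength_le_of_kappa hκ (i := j) (j := j)
      ⟨γ (M.z j.castSucc), M.left_mem_element γ j, M.left_mem_element γ j⟩
    exact le_of_mul_le_mul_right (by linarith) (M.cellLength_pos j)
  next_le i j hij := M.cellLength_le_of_kappa hκ
    ⟨_, M.left_mem_element γ j, by rw [← hij]; exact M.right_mem_element γ i⟩
  prev_le i j hij := M.cellLength_le_of_kappa hκ
    ⟨_, by rw [← hij]; exact M.right_mem_element γ i, M.left_mem_element γ j⟩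
  wrap := by
    cases k with
    | openArc => trivial
    | closedCurve =>
      intro i j hi hj
      have hper : Function.Periodic γ (b - a) := h.periodic
      have hab : γ b = γ a := by simpa using hper a
      have e : γ (M.z i.succ) = γ (M.z j.castSucc) := by
        rw [hi, hj, M.z_last, M.z_first, hab]
      have hne : γ (M.z i.succ) ∈ M.element γ i ∩ M.element γ j :=
        ⟨M.right_mem_element γ i, e ▸ M.left_mem_element γ j⟩
      exact ⟨M.cellLength_le_of_kappa hκ ⟨_, hne⟩, M.cellLength_le_of_kappa hκ ⟨_, hne.2, hne.1⟩⟩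

/-- The nodes, indexed by the natural numbers, constant from the last node on. -/
def zc (M : Mesh a b) (m : ℕ) : ℝ := M.z ⟨min m M.n, by omega⟩

theorem zc_castSucc (M : Mesh a b) (j : Fin M.n) : M.zc j = M.z j.castSucc := by
  unfold zc; congr 1; ext; simp

theorem zc_succ (M : Mesh a b) (j : Fin M.n) : M.zc (j + 1) = M.z j.succ := by
  unfold zc; congr 1; ext; simp

theorem zc_of_le (M : Mesh a b) {m : ℕ} (h : M.n ≤ m) : M.zc m = b := by
  refine Eq.trans ?_ M.z_last
  unfold zc
  congr 1; ext; simp [h]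

theorem zc_zero (M : Mesh a b) : M.zc 0 = a := by
  refine Eq.trans ?_ M.z_first
  unfold zc
  congr 1

theorem zc_lt_zc (M : Mesh a b) {m m' : ℕ} (h : m < m') (h' : m < M.n) : M.zc m < M.zc m' := by
  refine M.strictMono ?_
  rw [Fin.lt_def]; simp; omega

theorem zc_mono (M : Mesh a b) : Monotone M.zc := fun m m' h => by
  refine M.strictMono.monotone ?_
  rw [Fin.le_def]; simp; omega

end Mesh

/-- Growth of knot sequences along a chain of cells whose lengths grow at most by the factor `κ`
from each cell to the next. Here `R x h` says that `x` is the end point of a cell of length `h`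
of the chain; the chain may stop at a point `≥ B`. -/
theorem knot_sub_le_of_chain {t : ℤ → ℝ} (ht : Monotone t) {R : ℝ → ℝ → Prop} {κ B : ℝ}
    (hκ : 1 ≤ κ)
    (hR : ∀ x h, R x h → B ≤ x ∨ ∃ h', 0 < h' ∧ h' ≤ κ * h ∧ R (x + h') h' ∧ x + h' ∈ range t)
    {l : ℤ} {h0 : ℝ} (hh0 : 0 < h0) (h : R (t l) h0) (m : ℕ) (hm : t (l + m) ≤ B) :
    t (l + m) - t l ≤ m * κ ^ m * h0 := by
  have main : ∀ m : ℕ, t (l + m) ≤ B → ∃ x h, R x h ∧ 0 < h ∧ h ≤ κ ^ m * h0 ∧ t (l + m) ≤ x ∧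
      x - t l ≤ m * κ ^ m * h0 := by
    intro m
    induction m with
    | zero => exact fun _ => ⟨t l, h0, h, hh0, by simp, by simp, by simp⟩
    | succ m ih =>
      intro hB
      have hmono : t (l + m) ≤ t (l + (m + 1 : ℕ)) := ht (by push_cast; omega)
      obtain ⟨x, h, hx, hpos, hle, htx, hxl⟩ := ih (hmono.trans hB)
      have hκm : κ ^ m ≤ κ ^ (m + 1) := pow_le_pow_right₀ hκ (Nat.le_succ m)
      rcases hR x h hx with hBx | ⟨h', h'pos, h'le, hR', ⟨i, hi⟩⟩
      · refine ⟨x, h, hx, hpos, hle.trans (by gcongr), hB.trans hBx, hxl.trans ?_⟩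
        push_cast
        have : (m : ℝ) * κ ^ m ≤ (m + 1) * κ ^ (m + 1) := by
          have : (0 : ℝ) ≤ m := m.cast_nonneg
          gcongr; linarith
        gcongr
      · have h'le2 : h' ≤ κ ^ (m + 1) * h0 := by
          calc h' ≤ κ * h := h'le
            _ ≤ κ * (κ ^ m * h0) := by gcongr
            _ = _ := by ring
        refine ⟨x + h', h', hR', h'pos, h'le2, ?_, ?_⟩
        · rw [← hi]
          refine ht ?_
          by_contra! hlt
          have : t i ≤ t (l + m) := ht (by push_cast at hlt; omega)
          linarith
        · push_cast
          have : (m : ℝ) * κ ^ m * h0 ≤ m * κ ^ (m + 1) * h0 := by gcongr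
          nlinarith
  obtain ⟨x, h, -, -, -, h1, h2⟩ := main m hm
  linarith

namespace NurbsData

variable {k : BdryType} {p : ℕ} {a b : ℝ} {M : Mesh a b} (D : NurbsData k p M)

/-- For a closed curve the knots `t 0` and `t N` sit at the end points. -/
theorem closed_facts (D : NurbsData .closedCurve p M) (hab : a < b) :
    0 < D.N ∧ D.knots.t 0 = a ∧ D.knots.t D.N = b := by
  obtain ⟨h1, h2, -⟩ := D.compat
  have hn : 0 < M.n := by
    obtain ⟨j, -⟩ := M.exists_mem_Ico (left_mem_Ico.2 hab)
    exact j.pos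
  have hlast : M.z (Fin.last _) ∈ D.knots.t '' Icc 1 (D.N : ℤ) := by
    rw [h1]
    exact ⟨_, by simp only [mem_Ioi]; rw [Fin.lt_def]; simpa using hn, rfl⟩
  obtain ⟨i, hi, hib⟩ := hlast
  rw [M.z_last] at hib
  have hN : 0 < D.N := by have := hi.1; have := hi.2; omega
  have hNb : D.knots.t D.N = b := by
    refine le_antisymm ?_ (hib.ge.trans (D.knots.mono hi.2))
    obtain ⟨m, -, hm⟩ : D.knots.t D.N ∈ M.z '' Ioi 0 := by
      rw [← h1]; exact ⟨D.N, ⟨by omega, le_rfl⟩, rfl⟩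
    rw [← hm]; exact M.z_le m
  refine ⟨hN, ?_, hNb⟩
  have := h2 0
  rw [zero_add, hNb] at this
  linarith

/-- For an open arc the first and the last `p + 1` of the knots `t 0, …, t N` sit at the end
points. -/
theorem open_facts (D : NurbsData .openArc p M) (hab : a < b) :
    (∀ i : ℤ, i ≤ p → D.knots.t i ≤ a) ∧ (∀ i : ℤ, (D.N : ℤ) - p ≤ i → b ≤ D.knots.t i) ∧
      (∀ i : ℤ, a ≤ D.knots.t i → 0 ≤ i) ∧ (∀ i : ℤ, D.knots.t i ≤ b → i ≤ D.N) ∧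
      (∀ i : ℤ, 0 ≤ i → a ≤ D.knots.t i) ∧ (∀ i : ℤ, i ≤ D.N → D.knots.t i ≤ b) := by
  obtain ⟨h1, h2, h3, h4, h5⟩ := D.compat
  have lo : ∀ i : ℤ, a ≤ D.knots.t i → 0 ≤ i := fun i hi => by
    by_contra! hlt; exact absurd hi (not_le.2 (h2 i hlt))
  have hi' : ∀ i : ℤ, D.knots.t i ≤ b → i ≤ D.N := fun i hi => by
    by_contra! hlt; exact absurd hi (not_le.2 (h3 i hlt))
  have hmem : ∀ i : ℤ, 0 ≤ i → i ≤ D.N → a ≤ D.knots.t i ∧ D.knots.t i ≤ b := fun i h0 hN => by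
    obtain ⟨m, hm⟩ : D.knots.t i ∈ range M.z := by rw [← h1]; exact ⟨i, ⟨h0, hN⟩, rfl⟩
    rw [← hm]; exact ⟨M.le_z m, M.z_le m⟩
  have ge : ∀ i : ℤ, 0 ≤ i → a ≤ D.knots.t i := fun i h0 => by
    rcases le_or_gt i D.N with h | h
    · exact (hmem i h0 h).1
    · exact (hab.trans (h3 i h)).le
  have le : ∀ i : ℤ, i ≤ (D.N : ℤ) → D.knots.t i ≤ b := fun i hN => by
    rcases le_or_gt 0 i with h | h
    · exact (hmem i h hN).2
    · exact ((h2 i h).trans hab).le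
  refine ⟨fun i hi => ?_, fun i hi => ?_, lo, hi', ge, le⟩
  · by_contra! hlt
    have hsub : {i : ℤ | D.knots.t i = a} ⊆ Ico (0 : ℤ) i := fun j hj => by
      have hj' : D.knots.t j = a := hj
      exact ⟨lo j hj'.ge, D.knots.lt_of_t_lt (hj'.trans_lt hlt)⟩
    have := Set.ncard_le_ncard hsub (Set.finite_Ico _ _)
    have h6 : {i : ℤ | D.knots.t i = a}.ncard = p + 1 := h4
    rw [h6, ← Finset.coe_Ico, Set.ncard_coe_finset, Int.card_Ico] at this
    omega
  · by_contra! hlt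
    have hsub : {i : ℤ | D.knots.t i = b} ⊆ Ioc i (D.N : ℤ) := fun j hj => by
      have hj' : D.knots.t j = b := hj
      exact ⟨D.knots.lt_of_t_lt (hlt.trans_eq hj'.symm), hi' j hj'.le⟩
    have := Set.ncard_le_ncard hsub (Set.finite_Ioc _ _)
    have h6 : {i : ℤ | D.knots.t i = b}.ncard = p + 1 := h5
    rw [h6, ← Finset.coe_Ioc, Set.ncard_coe_finset, Int.card_Ioc] at this
    omega

theorem exists_knot_eq (hab : a < b) (m : Fin (M.n + 1)) : ∃ i, D.knots.t i = M.z m := by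
  cases k with
  | closedCurve =>
    obtain ⟨-, h0, -⟩ := D.closed_facts hab
    obtain ⟨h1, -⟩ := D.compat
    by_cases hm : m = 0
    · exact ⟨0, by rw [h0, hm, M.z_first]⟩
    · obtain ⟨i, -, hi⟩ : M.z m ∈ D.knots.t '' Icc 1 (D.N : ℤ) := by
        rw [h1]; exact ⟨m, Fin.pos_iff_ne_zero.2 hm, rfl⟩
      exact ⟨i, hi⟩
  | openArc =>
    obtain ⟨h1, -⟩ := D.compat
    obtain ⟨i, -, hi⟩ : M.z m ∈ D.knots.t '' Icc 0 (D.N : ℤ) := by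
      rw [h1]; exact ⟨m, rfl⟩
    exact ⟨i, hi⟩

theorem exists_node_eq (hab : a < b) {i : ℤ} (h1 : a < D.knots.t i) (h2 : D.knots.t i ≤ b) :
    ∃ m, D.knots.t i = M.z m := by
  cases k with
  | closedCurve =>
    obtain ⟨hN0, h0, hN⟩ := D.closed_facts hab
    obtain ⟨h3, h4, -⟩ := D.compat
    have hi1 : 1 ≤ i := by
      have := D.knots.lt_of_t_lt (h0.trans_lt h1); omega
    have hiN : i ≤ D.N := by
      by_contra! hlt
      have h5 : D.knots.t (1 + D.N) ≤ D.knots.t i := D.knots.mono (by omega)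
      have h6 : a < D.knots.t 1 := by
        obtain ⟨m, hm, hm'⟩ : D.knots.t 1 ∈ M.z '' Ioi 0 := by
          rw [← h3]; exact ⟨1, ⟨le_rfl, by omega⟩, rfl⟩
        rw [← hm']
        exact M.z_first.symm.trans_lt (M.strictMono hm)
      rw [h4] at h5
      linarith
    obtain ⟨m, -, hm⟩ : D.knots.t i ∈ M.z '' Ioi 0 := by
      rw [← h3]; exact ⟨i, ⟨hi1, hiN⟩, rfl⟩
    exact ⟨m, hm.symm⟩
  | openArc =>
    obtain ⟨-, -, lo, hi, -, -⟩ := D.open_facts hab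
    obtain ⟨h3, -⟩ := D.compat
    obtain ⟨m, hm⟩ : D.knots.t i ∈ range M.z := by
      rw [← h3]; exact ⟨i, ⟨lo i h1.le, hi i h2⟩, rfl⟩
    exact ⟨m, hm.symm⟩

/-- On `[a, b)` only B-splines with a given weight, or a periodic copy of one, are active. -/
theorem weights_of_active (hab : a < b) {wmin wmax : ℝ} (hw : D.WeightsIn wmin wmax) {x : ℝ}
    (hx : x ∈ Ico a b) {l : ℤ} (hl : bspline D.knots.t p l x ≠ 0) :
    wmin ≤ D.w l ∧ D.w l ≤ wmax := by
  obtain ⟨h1, h2⟩ := bspline_support D.knots.mono p l x hl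
  cases k with
  | closedCurve =>
    obtain ⟨hN, -⟩ := D.closed_facts hab
    obtain ⟨-, -, hper⟩ := D.compat
    have hp : Function.Periodic D.w (D.N : ℤ) := hper
    obtain ⟨y, hy, hy'⟩ := hp.exists_mem_Ioc (by exact_mod_cast hN) l 0
    rw [hy']
    have h3 := hy.1
    have h4 := hy.2
    exact hw y (by change y ∈ Icc _ _; constructor <;> omega)
  | openArc =>
    obtain ⟨e1, e2, -⟩ := D.open_facts hab
    refine hw l ?_
    change l ∈ Icc (1 : ℤ) (D.N - p)
    constructor
    · by_contra! hlt
      exact absurd (e1 (l + p) (by omega)) (not_le.2 (hx.1.trans_lt h2))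
    · by_contra! hlt
      exact absurd (e2 (l - 1) (by omega)) (not_le.2 (h1.trans_lt hx.2))

/-- Every parameter element is a knot span. -/
theorem exists_span_eq (hab : a < b) (j : Fin M.n) :
    ∃ l : ℤ, D.knots.t (l - 1) = M.z j.castSucc ∧ D.knots.t l = M.z j.succ := by
  have hj := M.z_castSucc_lt_succ j
  obtain ⟨l, h1, h2⟩ := D.knots.exists_span (M.z j.castSucc)
  obtain ⟨i0, hi0⟩ := D.exists_knot_eq hab j.castSucc
  obtain ⟨i1, hi1⟩ := D.exists_knot_eq hab j.succ
  have hle : D.knots.t l ≤ M.z j.succ := by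
    rw [← hi1]
    have := D.knots.lt_of_t_lt (i := l - 1) (j := i1) (h1.trans_lt (hi1 ▸ hj))
    exact D.knots.mono (by omega)
  refine ⟨l, le_antisymm h1 ?_, le_antisymm hle ?_⟩
  · rw [← hi0] at h2 ⊢
    have := D.knots.lt_of_t_lt h2
    exact D.knots.mono (by omega)
  · obtain ⟨m, hm⟩ := D.exists_node_eq hab ((M.le_z _).trans_lt h2) (hle.trans (M.z_le _))
    rw [hm] at h2 ⊢
    have h3 := M.strictMono.lt_iff_lt.1 h2
    refine M.strictMono.monotone ?_
    rw [Fin.lt_def] at h3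
    rw [Fin.le_def]
    simp at h3 ⊢
    omega

/-- Advancing by one knot advances by at most one node. -/
theorem min_knot_le (hab : a < b) {j : Fin M.n} {l : ℤ} (hl : D.knots.t l = M.z j.succ) (m : ℕ) :
    min (D.knots.t (l + m)) b ≤ M.zc (j + 1 + m) := by
  induction m with
  | zero => simp [M.zc_succ, hl]
  | succ m ih =>
    rcases lt_or_ge (j + 1 + m : ℕ) M.n with h | h
    · obtain ⟨i, hi⟩ := D.exists_knot_eq hab ⟨min (j + 1 + (m + 1)) M.n, by omega⟩
      change _ = M.zc _ at hi
      have h1 : M.zc (j + 1 + m) < M.zc (j + 1 + (m + 1)) := M.zc_lt_zc (by omega) h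
      have h2 : M.zc (j + 1 + (m + 1)) ≤ b := M.z_le _
      rw [min_le_iff] at ih
      rcases ih with ih | ih
      · refine (min_le_left _ _).trans ?_
        rw [← hi] at h1 ⊢
        have := D.knots.lt_of_t_lt (ih.trans_lt h1)
        exact D.knots.mono (by push_cast; omega)
      · linarith
    · rw [M.zc_of_le (m := j + 1 + (m + 1)) (by omega)]
      exact min_le_right _ _

/-- Going back by one knot goes back by at most one node. -/
theorem le_max_knot (hab : a < b) {j : Fin M.n} {l : ℤ} (hl : D.knots.t l = M.z j.castSucc)
    (m : ℕ) : M.zc (j - m) ≤ max (D.knots.t (l - m)) a := by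
  induction m with
  | zero => simp [M.zc_castSucc, hl]
  | succ m ih =>
    rcases Nat.lt_or_ge m j with h | h
    · obtain ⟨i, hi⟩ := D.exists_knot_eq hab ⟨min (j - (m + 1)) M.n, by omega⟩
      change _ = M.zc _ at hi
      have h1 : M.zc (j - (m + 1)) < M.zc (j - m) :=
        M.zc_lt_zc (by omega) (by omega)
      have h2 : a ≤ M.zc (j - (m + 1)) := M.le_z _
      rw [le_max_iff] at ih
      rcases ih with ih | ih
      · refine le_trans ?_ (le_max_left _ _)
        rw [← hi] at h1 ⊢
        have := D.knots.lt_of_t_lt (h1.trans_le ih)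
        exact D.knots.mono (by push_cast; omega)
      · linarith
    · rw [show (j : ℕ) - (m + 1) = 0 by omega, M.zc_zero]
      exact le_max_right _ _

theorem exists_shifted_knot_eq (D : NurbsData .closedCurve p M) (hab : a < b) (m : Fin (M.n + 1))
    (σ : ℤ) : ∃ i, D.knots.t i = M.z m + σ * (b - a) := by
  obtain ⟨i, hi⟩ := D.exists_knot_eq hab m
  obtain ⟨-, h4, -⟩ := D.compat
  have key : ∀ σ : ℕ, ∀ i, D.knots.t (i + σ * D.N) = D.knots.t i + σ * (b - a) := by
    intro σ
    induction σ with
    | zero => simp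
    | succ σ ih =>
      intro i
      rw [show i + ((σ + 1 : ℕ) : ℤ) * D.N = i + σ * D.N + D.N by push_cast; ring, h4, ih]
      push_cast; ring
  obtain ⟨s, rfl | rfl⟩ := σ.eq_nat_or_neg
  · exact ⟨i + s * D.N, by rw [key, hi]; simp⟩
  · refine ⟨i - s * D.N, ?_⟩
    have := key s (i - s * D.N)
    rw [sub_add_cancel, hi] at this
    push_cast; linarith

theorem knot_sub_le_right (hab : a < b) {κ : ℝ} (hκ : M.RatioBound k κ) {j : Fin M.n} {l : ℤ}
    (hl : D.knots.t l = M.z j.succ) (hl' : D.knots.t (l - 1) = M.z j.castSucc)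
    {m : ℕ} (hm : m ≤ p) :
    D.knots.t (l + m) - D.knots.t l ≤ m * κ ^ m * M.cellLength j := by
  cases k with
  | closedCurve =>
    refine knot_sub_le_of_chain D.knots.mono (B := D.knots.t (l + m))
      (R := fun x h => ∃ (r : Fin M.n) (σ : ℤ), x = M.z r.succ + σ * (b - a) ∧ h = M.cellLength r)
      hκ.one_le ?_ (M.cellLength_pos j) ⟨j, 0, by simp [hl], rfl⟩ m le_rfl
    rintro x h ⟨r, σ, rfl, rfl⟩
    right
    by_cases hr : r.succ = Fin.last M.n
    · have hn : 0 < M.n := r.pos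
      set r' : Fin M.n := ⟨0, hn⟩ with hr'
      have h0 : r'.castSucc = 0 := by ext; simp [hr']
      have e : M.z r.succ + σ * (b - a) + M.cellLength r' =
          M.z r'.succ + ((σ + 1 : ℤ) : ℝ) * (b - a) := by
        rw [Mesh.cellLength, h0, hr, M.z_first, M.z_last]; push_cast; ring
      refine ⟨M.cellLength r', M.cellLength_pos _, (hκ.wrap r r' hr h0).2, ?_, ?_⟩
      · exact ⟨r', σ + 1, e, rfl⟩
      · rw [e]; exact D.exists_shifted_knot_eq hab _ _
    · have hlt : (r : ℕ) + 1 < M.n := by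
        have : (r : ℕ) + 1 ≠ M.n := fun h => hr (by ext; simpa using h)
        omega
      set r' : Fin M.n := ⟨r + 1, hlt⟩ with hr'
      have h0 : r.succ = r'.castSucc := by ext; simp [hr']
      have e : M.z r.succ + σ * (b - a) + M.cellLength r' = M.z r'.succ + σ * (b - a) := by
        rw [Mesh.cellLength, h0]; ring
      refine ⟨M.cellLength r', M.cellLength_pos _, hκ.next_le r r' h0, ⟨r', σ, e, rfl⟩, ?_⟩
      rw [e]; exact D.exists_shifted_knot_eq hab _ _
  | openArc =>
    obtain ⟨-, e2, -, -, -, e6⟩ := D.open_facts hab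
    have hlN : l - 1 < (D.N : ℤ) - p := by
      by_contra! h
      have := e2 _ h
      rw [hl'] at this
      exact absurd this (not_le.2 ((M.z_castSucc_lt_succ j).trans_le (M.z_le _)))
    refine knot_sub_le_of_chain D.knots.mono (B := b)
      (R := fun x h => ∃ (r : Fin M.n), x = M.z r.succ ∧ h = M.cellLength r)
      hκ.one_le ?_ (M.cellLength_pos j) ⟨j, hl, rfl⟩ m (e6 _ (by omega))
    rintro x h ⟨r, rfl, rfl⟩
    by_cases hr : r.succ = Fin.last M.n
    · left; rw [hr, M.z_last]
    · right
      have hlt : (r : ℕ) + 1 < M.n := by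
        have : (r : ℕ) + 1 ≠ M.n := fun h => hr (by ext; simpa using h)
        omega
      set r' : Fin M.n := ⟨r + 1, hlt⟩ with hr'
      have h0 : r.succ = r'.castSucc := by ext; simp [hr']
      have e : M.z r.succ + M.cellLength r' = M.z r'.succ := by
        rw [Mesh.cellLength, h0]; ring
      refine ⟨M.cellLength r', M.cellLength_pos _, hκ.next_le r r' h0, ⟨r', e, rfl⟩, ?_⟩
      rw [e]; exact D.exists_knot_eq hab _

theorem knot_sub_le_left (hab : a < b) {κ : ℝ} (hκ : M.RatioBound k κ) {j : Fin M.n} {l : ℤ}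
    (hl : D.knots.t l = M.z j.succ) (hl' : D.knots.t (l - 1) = M.z j.castSucc)
    {m : ℕ} (hm : m ≤ p) :
    D.knots.t (l - 1) - D.knots.t (l - 1 - m) ≤ m * κ ^ m * M.cellLength j := by
  -- The reflected knot sequence reduces this to chains that run to the right.
  set t' : ℤ → ℝ := fun i => -D.knots.t (-i) with ht'
  have hmono : Monotone t' := fun i i' h => neg_le_neg (D.knots.mono (by omega))
  have hgoal : t' (-(l - 1) + m) - t' (-(l - 1)) =
      D.knots.t (l - 1) - D.knots.t (l - 1 - m) := by
    simp only [ht', neg_neg]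
    rw [show -(-(l - 1) + (m : ℤ)) = l - 1 - m by ring]; ring
  rw [← hgoal]
  cases k with
  | closedCurve =>
    refine knot_sub_le_of_chain hmono (B := t' (-(l - 1) + m))
      (R := fun x h => ∃ (r : Fin M.n) (σ : ℤ), x = -(M.z r.castSucc + σ * (b - a)) ∧
        h = M.cellLength r)
      hκ.one_le ?_ (M.cellLength_pos j) ⟨j, 0, by simp [ht', hl'], rfl⟩ m le_rfl
    rintro x h ⟨r, σ, rfl, rfl⟩
    right
    have hknot : ∀ (r : Fin (M.n + 1)) (σ : ℤ), -(M.z r + σ * (b - a)) ∈ range t' := by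
      intro r σ
      obtain ⟨i, hi⟩ := D.exists_shifted_knot_eq hab r σ
      exact ⟨-i, by simp [ht', hi]⟩
    by_cases hr : r.castSucc = 0
    · have hn : 0 < M.n := r.pos
      set r' : Fin M.n := ⟨M.n - 1, by omega⟩ with hr'
      have h0 : r'.succ = Fin.last M.n := by ext; simp [hr']; omega
      have e : -(M.z r.castSucc + σ * (b - a)) + M.cellLength r' =
          -(M.z r'.castSucc + ((σ - 1 : ℤ) : ℝ) * (b - a)) := by
        rw [Mesh.cellLength, h0, hr, M.z_first, M.z_last]; push_cast; ring
      refine ⟨M.cellLength r', M.cellLength_pos _, (hκ.wrap r' r h0 hr).1, ?_, ?_⟩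
      · exact ⟨r', σ - 1, e, rfl⟩
      · rw [e]; exact hknot _ _
    · have hlt : 0 < (r : ℕ) := by
        have : (r : ℕ) ≠ 0 := fun h => hr (by ext; simpa using h)
        omega
      set r' : Fin M.n := ⟨r - 1, by omega⟩ with hr'
      have h0 : r'.succ = r.castSucc := by ext; simp [hr']; omega
      have e : -(M.z r.castSucc + σ * (b - a)) + M.cellLength r' =
          -(M.z r'.castSucc + σ * (b - a)) := by
        rw [Mesh.cellLength, h0]; ring
      refine ⟨M.cellLength r', M.cellLength_pos _, hκ.prev_le r' r h0, ⟨r', σ, e, rfl⟩, ?_⟩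
      rw [e]; exact hknot _ _
  | openArc =>
    obtain ⟨e1, -, -, -, e5, -⟩ := D.open_facts hab
    have hlN : (p : ℤ) < l := by
      by_contra! h
      have := e1 _ h
      rw [hl] at this
      exact absurd this (not_le.2 ((M.le_z _).trans_lt (M.z_castSucc_lt_succ j)))
    refine knot_sub_le_of_chain hmono (B := -a)
      (R := fun x h => ∃ (r : Fin M.n), x = -M.z r.castSucc ∧ h = M.cellLength r)
      hκ.one_le ?_ (M.cellLength_pos j) ⟨j, by simp [ht', hl'], rfl⟩ m ?_
    · rintro x h ⟨r, rfl, rfl⟩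
      by_cases hr : r.castSucc = 0
      · left; rw [hr, M.z_first]
      · right
        have hlt : 0 < (r : ℕ) := by
          have : (r : ℕ) ≠ 0 := fun h => hr (by ext; simpa using h)
          omega
        set r' : Fin M.n := ⟨r - 1, by omega⟩ with hr'
        have h0 : r'.succ = r.castSucc := by ext; simp [hr']; omega
        have e : -M.z r.castSucc + M.cellLength r' = -M.z r'.castSucc := by
          rw [Mesh.cellLength, h0]; ring
        refine ⟨M.cellLength r', M.cellLength_pos _, hκ.prev_le r' r h0, ⟨r', e, rfl⟩, ?_⟩
        rw [e]
        obtain ⟨i, hi⟩ := D.exists_knot_eq hab r'.castSucc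
        exact ⟨-i, by simp [ht', hi]⟩
    · exact neg_le_neg (e5 _ (by omega))

end NurbsData

/-- What the localization argument needs to know about the function `R` of the parameter attached
to the `j`-th cell. The support `[α, β]` covers the cell and at most `m` further cells on either
side, its length is comparable to that of the cell, and `R` is bounded below in the middle of the
cell. -/
structure IsTestFunction {a b : ℝ} (M : Mesh a b) (j : Fin M.n) (m : ℕ) (c C : ℝ) (R : ℝ → ℝ)
    (α β : ℝ) : Prop where
  α_le : α ≤ M.z j.castSucc
  le_β : M.z j.succ ≤ β
  le_α : M.zc (j - m) ≤ α
  β_le : β ≤ M.zc (j + 1 + m)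
  length_le : β - α ≤ C * M.cellLength j
  nonneg : ∀ x, 0 ≤ R x
  le_one : ∀ x, R x ≤ 1
  support : ∀ x ∈ Icc a b, R x ≠ 0 → x ∈ Icc α β
  pos : ∃ s : Set ℝ, s.Countable ∧ ∀ x ∈ Ioo α β, x ∉ s → 0 < R x
  lower : ∀ x ∈ Icc (M.z j.castSucc + M.cellLength j / 3) (M.z j.succ - M.cellLength j / 3),
    c ≤ R x

theorem natCeil_half (p : ℕ) : ⌈(p : ℝ) / 2⌉₊ = (p + 1) / 2 := by
  refine le_antisymm (Nat.ceil_le.2 ?_) ?_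
  · have : p ≤ 2 * ((p + 1) / 2) := by omega
    have : (p : ℝ) ≤ 2 * ((p + 1) / 2 : ℕ) := by exact_mod_cast this
    linarith
  · have h := Nat.le_ceil ((p : ℝ) / 2)
    have : (p : ℝ) ≤ (2 * ⌈(p : ℝ) / 2⌉₊ : ℕ) := by push_cast; linarith
    have := Nat.cast_le.1 this
    omega

/-- Every cell has a test function among the NURBS: the one whose support has the cell in its
middle. -/
theorem NurbsData.exists_isTestFunction (p : ℕ) {κ wmin : ℝ} (wmax : ℝ) (hκ1 : 1 ≤ κ)
    (hwmin : 0 < wmin) :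
    ∃ c C : ℝ, 0 < c ∧ 0 < C ∧ ∀ (k : BdryType) (a b : ℝ) (M : Mesh a b) (D : NurbsData k p M),
      a < b → M.RatioBound k κ → D.WeightsIn wmin wmax →
      ∀ j : Fin M.n, ∃ (i : ℤ) (α β : ℝ),
        IsTestFunction M j ⌈(p : ℝ) / 2⌉₊ c C (nurbs D.knots.t D.w p i) α β := by
  set C : ℝ := 1 + 2 * (p * κ ^ p) with hC
  have hC1 : 1 ≤ C := by
    rw [hC]
    have : 0 ≤ (p : ℝ) * κ ^ p := by positivity
    linarith
  set Θ : ℝ := 1 / (3 * C) with hΘ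
  have hΘ0 : 0 < Θ := by positivity
  set W : ℝ := max wmax wmin with hW
  have hW0 : 0 < W := hwmin.trans_le (le_max_right _ _)
  refine ⟨wmin * Θ ^ p / ((p + 1) * 2 ^ p * W), C, by positivity, by positivity, ?_⟩
  intro k a b M D hab hκ hw j
  obtain ⟨l, hl', hl⟩ := D.exists_span_eq hab j
  have hh := M.cellLength_pos j
  have hhdef : M.cellLength j = M.z j.succ - M.z j.castSucc := rfl
  have hpk : ∀ q : ℕ, q ≤ p → (q : ℝ) * κ ^ q * M.cellLength j ≤ p * κ ^ p * M.cellLength j := by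
    intro q hq
    have : (q : ℝ) ≤ p := by exact_mod_cast hq
    gcongr
  set i : ℤ := l - (p / 2 : ℕ) with hi
  have hi1 : i - 1 = l - 1 - (p / 2 : ℕ) := by omega
  have hip : i + p = l + ((p + 1) / 2 : ℕ) := by omega
  have hlen : D.knots.t (i + p) - D.knots.t (i - 1) ≤ C * M.cellLength j := by
    have h1 := (D.knot_sub_le_right hab hκ hl hl' (m := (p + 1) / 2) (by omega)).trans
      (hpk _ (by omega))
    have h2 := (D.knot_sub_le_left hab hκ hl hl' (m := p / 2) (by omega)).trans
      (hpk _ (by omega))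
    rw [← hip] at h1
    rw [← hi1] at h2
    rw [hC]
    linarith
  have hile : i ≤ l := by omega
  have hlip : l ≤ i + p := by omega
  have eα : D.knots.t (i - 1) ≤ M.z j.castSucc := by rw [← hl']; exact D.knots.mono (by omega)
  have eβ : M.z j.succ ≤ D.knots.t (i + p) := by rw [← hl]; exact D.knots.mono (by omega)
  refine ⟨i, max (D.knots.t (i - 1)) a, min (D.knots.t (i + p)) b, ?_⟩
  constructor
  · exact max_le eα (M.le_z _)
  · exact le_min eβ (M.z_le _)
  · rw [natCeil_half, hi1]
    exact (M.zc_mono (by omega)).trans (D.le_max_knot hab hl' _)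
  · rw [natCeil_half, hip]
    exact D.min_knot_le hab hl _
  · refine le_trans ?_ hlen
    exact sub_le_sub (min_le_left _ _) (le_max_left _ _)
  · exact nurbs_nonneg _ D.w_pos _
  · exact nurbs_le_one _ D.w_pos _
  · intro x hx hR
    obtain ⟨h1, h2⟩ := bspline_support D.knots.mono p i x (bspline_ne_zero_of_nurbs _ hR)
    exact ⟨max_le h1 hx.1, le_min h2.le hx.2⟩
  · refine ⟨range D.knots.t, countable_range _, fun x hx hxk => nurbs_pos _ D.w_pos ?_⟩
    obtain ⟨l', h1, h2⟩ := D.knots.exists_span x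
    have h1' : D.knots.t (l' - 1) < x := lt_of_le_of_ne h1 fun h => hxk ⟨_, h⟩
    have h3 : D.knots.t (i - 1) < x := (le_max_left _ _).trans_lt hx.1
    have h4 : x < D.knots.t (i + p) := hx.2.trans_le (min_le_left _ _)
    have h5 := D.knots.lt_of_t_lt (h3.trans h2)
    have h6 := D.knots.lt_of_t_lt (h1'.trans h4)
    have h7 : 0 < D.knots.t (i + p) - D.knots.t (i - 1) := by linarith
    have h8 : 0 < min (x - D.knots.t (l' - 1)) (D.knots.t l' - x) :=
      lt_min (by linarith) (by linarith)
    refine lt_of_lt_of_le (b := (min (x - D.knots.t (l' - 1)) (D.knots.t l' - x) /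
      (D.knots.t (i + p) - D.knots.t (i - 1))) ^ p) (by positivity)
      (pow_le_bspline D.knots.mono (l := l') (by positivity) p i (by omega) (by omega) h1' h2 ?_ ?_)
    · rw [div_mul_cancel₀ _ h7.ne']; exact min_le_left _ _
    · rw [div_mul_cancel₀ _ h7.ne']; exact min_le_right _ _
  · intro x hx
    have hx1 := hx.1
    have hx2 := hx.2
    have hx' : x ∈ Ico a b :=
      ⟨(M.le_z j.castSucc).trans (by linarith),
        lt_of_lt_of_le (b := M.z j.succ) (by linarith) (M.z_le _)⟩
    have hΘC : Θ * (D.knots.t (i + p) - D.knots.t (i - 1)) ≤ M.cellLength j / 3 := by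
      calc _ ≤ Θ * (C * M.cellLength j) := by gcongr
        _ = _ := by rw [hΘ]; field_simp
    have hB : Θ ^ p ≤ bspline D.knots.t p i x := by
      refine pow_le_bspline D.knots.mono hΘ0.le p i hile hlip ?_ ?_ ?_ ?_ <;>
        first | rw [hl'] | rw [hl]
      all_goals linarith
    have hpos : 0 < Θ ^ p := by positivity
    refine le_nurbs _ D.w_pos (fun l hl => ?_) hW0 ?_ hpos hB
    · exact (D.weights_of_active hab hw hx' hl).2.trans (le_max_left _ _)
    · exact (D.weights_of_active hab hw hx' (hpos.trans_le hB).ne').1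

/-! ### Arclength in the parameter interval -/

/-- The arclength measure, pulled back to the parameter interval. -/
noncomputable def paramMeasure (γ : ℝ → Plane) (a b : ℝ) : Measure ℝ :=
  (volume.restrict (Icc a b)).withDensity fun t => ‖rightDeriv γ t‖ₑ

/-- The measure `ν` lives on `[a, b]` and is comparable to Lebesgue measure there. -/
structure ComparableMeasure (ν : Measure ℝ) (a b c C : ℝ) : Prop where
  c_pos : 0 < c
  C_pos : 0 < C
  lower : ENNReal.ofReal c • volume.restrict (Icc a b) ≤ ν
  upper : ν ≤ ENNReal.ofReal C • volume.restrict (Icc a b)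

namespace ComparableMeasure

variable {ν : Measure ℝ} {a b c C : ℝ}

theorem absolutelyContinuous (h : ComparableMeasure ν a b c C) :
    ν ≪ volume.restrict (Icc a b) :=
  (Measure.absolutelyContinuous_of_le h.upper).trans Measure.smul_absolutelyContinuous

theorem apply_le (h : ComparableMeasure ν a b c C) (s : Set ℝ) :
    ν s ≤ ENNReal.ofReal C * volume s := by
  calc ν s ≤ (ENNReal.ofReal C • volume.restrict (Icc a b)) s := h.upper s
    _ = ENNReal.ofReal C * volume.restrict (Icc a b) s := by simp
    _ ≤ _ := mul_le_mul_right (Measure.restrict_apply_le _ _) _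

theorem isFiniteMeasure (h : ComparableMeasure ν a b c C) : IsFiniteMeasure ν := by
  constructor
  refine (h.upper univ).trans_lt ?_
  simp [ENNReal.mul_lt_top_iff]

theorem nullSingletonClass (h : ComparableMeasure ν a b c C) : NullSingletonClass ν := by
  constructor
  intro x
  simpa using h.apply_le {x}

theorem real_Icc_le (h : ComparableMeasure ν a b c C) {x y : ℝ} (hxy : x ≤ y) :
    ν.real (Icc x y) ≤ C * (y - x) := by
  refine ENNReal.toReal_le_of_le_ofReal (mul_nonneg h.C_pos.le (by linarith)) ?_
  refine (h.apply_le _).trans (le_of_eq ?_)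
  rw [Real.volume_Icc, ENNReal.ofReal_mul h.C_pos.le]

theorem le_real_Icc (h : ComparableMeasure ν a b c C) {x y : ℝ} (hx : a ≤ x)
    (hy : y ≤ b) : c * (y - x) ≤ ν.real (Icc x y) := by
  have := h.isFiniteMeasure
  rw [Measure.real, ← ENNReal.ofReal_le_iff_le_toReal (measure_ne_top _ _)]
  refine le_trans (le_of_eq ?_) (h.lower _)
  rw [ENNReal.ofReal_mul h.c_pos.le, ← Real.volume_Icc]
  simp [Measure.restrict_apply measurableSet_Icc, Icc_inter_Icc, hx, hy]

theorem ae_mem_Ioo (h : ComparableMeasure ν a b c C) : ∀ᵐ t ∂ν, t ∈ Ioo a b := by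
  refine h.absolutelyContinuous.ae_le ?_
  rw [← restrict_Ioo_eq_restrict_Icc]
  exact ae_restrict_mem measurableSet_Ioo

end ComparableMeasure

theorem comparableMeasure_paramMeasure {γ : ℝ → Plane} {a b c C : ℝ} (hc : 0 < c) (hC : 0 < C)
    (h : ∀ t ∈ Ico a b, c ≤ ‖rightDeriv γ t‖ ∧ ‖rightDeriv γ t‖ ≤ C) :
    ComparableMeasure (paramMeasure γ a b) a b c C := by
  have hae : ∀ᵐ t ∂volume.restrict (Icc a b), t ∈ Ico a b := by
    rw [← restrict_Ico_eq_restrict_Icc]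
    exact ae_restrict_mem measurableSet_Ico
  refine ⟨hc, hC, ?_, ?_⟩
  · rw [← withDensity_const]
    refine withDensity_mono ?_
    filter_upwards [hae] with t ht
    rw [← ofReal_norm]
    exact ENNReal.ofReal_le_ofReal (h t ht).1
  · rw [← withDensity_const]
    refine withDensity_mono ?_
    filter_upwards [hae] with t ht
    rw [← ofReal_norm]
    exact ENNReal.ofReal_le_ofReal (h t ht).2

namespace IsParam

variable {k : BdryType} {γ : ℝ → Plane} {a b : ℝ}

/-- The parametrization may be replaced by a function that is continuous on the whole real line. -/
theorem exists_continuous_extension (h : IsParam k γ a b) :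
    ∃ g : ℝ → Plane, Continuous g ∧ EqOn g γ (Icc a b) := by
  refine ⟨IccExtend h.lt.le ((Icc a b).domRestrict γ),
    (continuousOn_iff_continuous_domRestrict.1 h.continuousOn).Icc_extend', fun t ht => ?_⟩
  rw [IccExtend_of_mem _ _ ht]; rfl

theorem measurePreserving {c C : ℝ}
    (hν : ComparableMeasure (paramMeasure γ a b) a b c C) {g : ℝ → Plane} (hg : Continuous g)
    (hgγ : EqOn g γ (Icc a b)) :
    MeasurePreserving g (paramMeasure γ a b) (arcMeasure γ a b) := by
  refine ⟨hg.measurable, ?_⟩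
  refine Measure.map_congr ?_
  filter_upwards [hν.ae_mem_Ioo] with t ht using hgγ (Ioo_subset_Icc_self ht)

theorem isFiniteMeasure_arcMeasure (h : IsParam k γ a b) : IsFiniteMeasure (arcMeasure γ a b) := by
  obtain ⟨c, C, hc, hC, hb⟩ := h.exists_speed_bounds
  have := (comparableMeasure_paramMeasure hc hC hb).isFiniteMeasure
  change IsFiniteMeasure ((paramMeasure γ a b).map γ)
  infer_instance

theorem eq_of_image_eq (h : IsParam k γ a b) {s t : ℝ} (hs : s ∈ Ioo a b) (ht : t ∈ Icc a b)
    (heq : γ s = γ t) : s = t := by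
  cases k with
  | openArc => exact h.injOn (Ioo_subset_Icc_self hs) ht heq
  | closedCurve =>
    rcases h.eq_or_of_image_eq_closed (Ioo_subset_Icc_self hs) ht heq with h1 | ⟨h1, -⟩ | ⟨h1, -⟩
    · exact h1
    · exact absurd h1 hs.1.ne'
    · exact absurd h1 hs.2.ne

theorem Ioo_subset_paramDomain (k : BdryType) (a b : ℝ) : Ioo a b ⊆ paramDomain k a b := by
  cases k
  · exact Ioo_subset_Ico_self
  · exact Ioo_subset_Icc_self

theorem paramDomain_subset (k : BdryType) (a b : ℝ) : paramDomain k a b ⊆ Icc a b := by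
  cases k
  · exact Ico_subset_Icc_self
  · exact subset_rfl

theorem preimage_image_ae_eq (h : IsParam k γ a b) {c C : ℝ}
    (hν : ComparableMeasure (paramMeasure γ a b) a b c C) {g : ℝ → Plane}
    (hgγ : EqOn g γ (Icc a b)) {A : Set ℝ} (hA : A ⊆ Icc a b) :
    g ⁻¹' (γ '' A) =ᵐ[paramMeasure γ a b] A := by
  filter_upwards [hν.ae_mem_Ioo] with t ht
  have : t ∈ g ⁻¹' (γ '' A) ↔ t ∈ A := by
    rw [mem_preimage, hgγ (Ioo_subset_Icc_self ht)]
    constructor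
    · rintro ⟨s, hs, hst⟩
      rwa [h.eq_of_image_eq ht (hA hs) hst.symm]
    · exact fun ht => ⟨t, ht, rfl⟩
  exact propext this

theorem setIntegral_image (h : IsParam k γ a b) {c C : ℝ}
    (hν : ComparableMeasure (paramMeasure γ a b) a b c C) {g : ℝ → Plane} (hg : Continuous g)
    (hgγ : EqOn g γ (Icc a b)) {A : Set ℝ} (hA : A ⊆ Icc a b) (hA' : IsClosed A) {F : Plane → ℝ}
    (hF : AEStronglyMeasurable F (arcMeasure γ a b)) :
    ∫ x in γ '' A, F x ∂(arcMeasure γ a b) = ∫ t in A, F (g t) ∂(paramMeasure γ a b) := by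
  have hmp := measurePreserving hν hg hgγ
  have hclosed : IsClosed (γ '' A) :=
    ((isCompact_Icc.of_isClosed_subset hA' hA).image_of_continuousOn
      (h.continuousOn.mono hA)).isClosed
  rw [← hmp.map_eq, setIntegral_map hclosed.measurableSet (by rwa [hmp.map_eq]) hg.aemeasurable]
  exact setIntegral_congr_set (h.preimage_image_ae_eq hν hgγ hA)

theorem real_image (h : IsParam k γ a b) {c C : ℝ}
    (hν : ComparableMeasure (paramMeasure γ a b) a b c C) {g : ℝ → Plane} (hg : Continuous g)
    (hgγ : EqOn g γ (Icc a b)) {A : Set ℝ} (hA : A ⊆ Icc a b) (hA' : IsClosed A) :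
    (arcMeasure γ a b).real (γ '' A) = (paramMeasure γ a b).real A := by
  have := h.setIntegral_image hν hg hgγ hA hA' (F := fun _ => 1) aestronglyMeasurable_const
  simpa using this

end IsParam

/-! ### Transported NURBS -/

section Transport

variable {k : BdryType} {γ : ℝ → Plane} {a b : ℝ}

theorem transport_apply (h : IsParam k γ a b) (f : ℝ → ℝ) {x : ℝ} (hx : x ∈ paramDomain k a b) :
    transport γ (paramDomain k a b) f (γ x) = f x := by
  have hmem : γ x ∈ γ '' paramDomain k a b := ⟨x, hx, rfl⟩
  change (γ '' paramDomain k a b).indicator _ _ = _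
  rw [indicator_of_mem hmem, Function.comp_apply, h.injOn.leftInvOn_invFunOn hx]

theorem transport_of_notMem {D : Set ℝ} (f : ℝ → ℝ) {y : Plane} (hy : y ∉ γ '' D) :
    transport γ D f y = 0 :=
  indicator_of_notMem hy _

theorem transport_mem {D : Set ℝ} {f : ℝ → ℝ} {s : Set ℝ} (hs : ∀ x ∈ D, f x ∈ s) (h0 : 0 ∈ s)
    (y : Plane) : transport γ D f y ∈ s := by
  by_cases hy : y ∈ γ '' D
  · change (γ '' D).indicator _ _ ∈ s
    rw [indicator_of_mem hy]
    exact hs _ (Function.invFunOn_mem hy)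
  · rw [transport_of_notMem f hy]; exact h0

theorem measurable_transport (h : IsParam k γ a b) {f f' : ℝ → ℝ} (hf' : Measurable f')
    (hff' : ∀ x ∈ Icc a b, f x = f' x) : Measurable (transport γ (paramDomain k a b) f) := by
  have hD : MeasurableSet (paramDomain k a b) := by
    cases k
    · exact measurableSet_Ico
    · exact measurableSet_Icc
  have hsub := IsParam.paramDomain_subset k a b
  have he : MeasurableEmbedding ((paramDomain k a b).domRestrict γ) :=
    (h.continuousOn.mono hsub).measurableEmbedding hD h.injOn
  have heq : transport γ (paramDomain k a b) f =
      Function.extend ((paramDomain k a b).domRestrict γ) (fun x => f' x) 0 := by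
    ext y
    by_cases hy : y ∈ γ '' paramDomain k a b
    · obtain ⟨x, hx, rfl⟩ := hy
      rw [transport_apply h f hx, hff' x (hsub hx)]
      exact (he.injective.extend_apply (fun x : paramDomain k a b => f' x) 0 ⟨x, hx⟩).symm
    · rw [transport_of_notMem f hy, Function.extend_apply' _ _ _ fun ⟨x, hx⟩ => hy ⟨x.1, x.2, hx⟩]
      rfl
  rw [heq]
  exact he.measurable_extend (hf'.comp measurable_subtype_coe) measurable_zero

namespace NurbsData

variable {p : ℕ} {M : Mesh a b}

theorem measurable_of_mem_space (h : IsParam k γ a b) (D : NurbsData k p M) {ψ : Plane → ℝ}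
    (hψ : ψ ∈ D.space γ) : Measurable ψ := by
  obtain ⟨g, hg, rfl⟩ := hψ
  obtain ⟨f, _, hf, H⟩ := exists_bounded_measurable_of_mem_nurbsSpace D.knots D.w_pos hg a b
  exact measurable_transport h hf fun x hx => (H x hx).1

theorem memLp_of_mem_space (h : IsParam k γ a b) (D : NurbsData k p M) {ψ : Plane → ℝ}
    (hψ : ψ ∈ D.space γ) : MemLp ψ 2 (arcMeasure γ a b) := by
  have := h.isFiniteMeasure_arcMeasure
  have hm := D.measurable_of_mem_space h hψ
  obtain ⟨g, hg, rfl⟩ := hψ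
  obtain ⟨f, C, -, H⟩ := exists_bounded_measurable_of_mem_nurbsSpace D.knots D.w_pos hg a b
  refine MemLp.of_bound hm.aestronglyMeasurable (max C 0) (ae_of_all _ fun y => ?_)
  refine transport_mem (γ := γ) (D := paramDomain k a b) (f := g) (s := {r | |r| ≤ max C 0})
    (fun x hx => ?_) (by simp) y
  obtain ⟨h1, h2⟩ := H x (IsParam.paramDomain_subset k a b hx)
  rw [mem_ofPred_eq, h1]
  exact h2.trans (le_max_left _ _)

/-- The transported NURBS. -/
noncomputable def basisFun (D : NurbsData k p M) (γ : ℝ → Plane) (i : ℤ) : Plane → ℝ :=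
  transport γ (paramDomain k a b) (nurbs D.knots.t D.w p i)

theorem basisFun_mem_space (D : NurbsData k p M) (γ : ℝ → Plane) (i : ℤ) :
    D.basisFun γ i ∈ D.space γ :=
  Submodule.mem_map_of_mem (nurbs_mem_nurbsSpace D.knots i)

theorem basisFun_mem_Icc (D : NurbsData k p M) (γ : ℝ → Plane) (i : ℤ) (y : Plane) :
    D.basisFun γ i y ∈ Icc (0 : ℝ) 1 :=
  transport_mem (s := Icc 0 1)
    (fun x _ => ⟨nurbs_nonneg _ D.w_pos i x, nurbs_le_one _ D.w_pos i x⟩) (by simp) y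

theorem basisFun_comp_ae_eq (h : IsParam k γ a b) (D : NurbsData k p M) {c C : ℝ}
    (hν : ComparableMeasure (paramMeasure γ a b) a b c C) {g : ℝ → Plane}
    (hgγ : EqOn g γ (Icc a b)) (i : ℤ) :
    (fun t => D.basisFun γ i (g t)) =ᵐ[paramMeasure γ a b] nurbs D.knots.t D.w p i := by
  filter_upwards [hν.ae_mem_Ioo] with t ht
  rw [hgγ (Ioo_subset_Icc_self ht)]
  exact transport_apply h _ (IsParam.Ioo_subset_paramDomain k a b ht)

end NurbsData

end Transport

namespace IsTestFunction

variable {a b : ℝ} {M : Mesh a b} {j : Fin M.n} {m : ℕ} {c C : ℝ} {R : ℝ → ℝ} {α β : ℝ}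

theorem Icc_subset (hR : IsTestFunction M j m c C R α β) : Icc α β ⊆ Icc a b :=
  Icc_subset_Icc ((M.le_z _).trans hR.le_α) (hR.β_le.trans (M.z_le _))

theorem lt (hR : IsTestFunction M j m c C R α β) : α < β :=
  hR.α_le.trans_lt ((M.z_castSucc_lt_succ j).trans_le hR.le_β)

theorem le_setIntegral (hR : IsTestFunction M j m c C R α β) (hc : 0 < c) {ν : Measure ℝ}
    {c₀ C₀ : ℝ} (hν : ComparableMeasure ν a b c₀ C₀) (hint : Integrable R ν) :
    c * c₀ / 3 * M.cellLength j ≤ ∫ t in Icc α β, R t ∂ν := by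
  have := hν.isFiniteMeasure
  have hh := M.cellLength_pos j
  have hhdef : M.cellLength j = M.z j.succ - M.z j.castSucc := rfl
  set J := Icc (M.z j.castSucc + M.cellLength j / 3) (M.z j.succ - M.cellLength j / 3) with hJ
  have hJsub : J ⊆ Icc α β := Icc_subset_Icc (by linarith [hR.α_le]) (by linarith [hR.le_β])
  calc c * c₀ / 3 * M.cellLength j
      = c * (c₀ * (M.z j.succ - M.cellLength j / 3 - (M.z j.castSucc + M.cellLength j / 3))) := by
        rw [hhdef]; ring
    _ ≤ c * ν.real J := by
        have := hν.le_real_Icc (x := M.z j.castSucc + M.cellLength j / 3)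
          (y := M.z j.succ - M.cellLength j / 3) (by linarith [M.le_z j.castSucc])
          (by linarith [M.z_le j.succ])
        exact mul_le_mul_of_nonneg_left this hc.le
    _ = ∫ _ in J, c ∂ν := by rw [setIntegral_const, smul_eq_mul, mul_comm]
    _ ≤ ∫ t in J, R t ∂ν :=
        setIntegral_mono_on (integrable_const _).integrableOn hint.integrableOn measurableSet_Icc
          hR.lower
    _ ≤ ∫ t in Icc α β, R t ∂ν :=
        setIntegral_mono_set hint.integrableOn (ae_of_all _ hR.nonneg) hJsub.eventuallyLE

theorem real_le (hR : IsTestFunction M j m c C R α β) {ν : Measure ℝ}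
    {c₀ C₀ : ℝ} (hν : ComparableMeasure ν a b c₀ C₀) :
    ν.real (Icc α β) ≤ C₀ * C * M.cellLength j := by
  refine (hν.real_Icc_le hR.lt.le).trans ?_
  rw [mul_assoc]
  exact mul_le_mul_of_nonneg_left hR.length_le hν.C_pos.le

end IsTestFunction

theorem Mesh.image_Icc_subset_patch {a b : ℝ} (M : Mesh a b) (γ : ℝ → Plane) (j : Fin M.n) (m : ℕ) :
    γ '' Icc (M.zc (j - m)) (M.zc (j + 1 + m)) ⊆ M.patch γ j m := by
  induction m with
  | zero => simp [Mesh.zc_castSucc, Mesh.zc_succ, Mesh.patch, Mesh.element, Mesh.cell]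
  | succ m ih =>
    rintro _ ⟨x, hx, rfl⟩
    have hmid : M.zc (j - m) ≤ M.zc (j + 1 + m) := M.zc_mono (by omega)
    have key : ∀ i : Fin M.n, x ∈ M.cell i →
        (M.element γ i ∩ M.patch γ j m).Nonempty → γ x ∈ M.patch γ j (m + 1) :=
      fun i hx hi => mem_biUnion (show i ∈ {i | _} from hi) ⟨x, hx, rfl⟩
    -- a point of the patch of order `m` lies in the patch of order `m + 1`
    have mono : ∀ y ∈ M.patch γ j m, y ∈ M.patch γ j (m + 1) := by
      intro y hy
      have : ∃ i : Fin M.n, y ∈ M.element γ i := by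
        cases m with
        | zero => exact ⟨j, hy⟩
        | succ m =>
          simp only [Mesh.patch, mem_iUnion] at hy
          obtain ⟨i, -, hi⟩ := hy
          exact ⟨i, hi⟩
      obtain ⟨i, hi⟩ := this
      exact mem_biUnion (show i ∈ {i | _} from ⟨y, hi, hy⟩) hi
    rcases lt_or_ge x (M.zc (j - m)) with h1 | h1
    · have hm : m < j := by
        by_contra! hle
        rw [show (j : ℕ) - m = 0 by omega, M.zc_zero] at h1
        exact absurd ((M.le_z _).trans hx.1) (not_le.2 h1)
      set i : Fin M.n := ⟨j - (m + 1), by omega⟩ with hi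
      have e1 : M.zc (j - (m + 1)) = M.z i.castSucc := by rw [← M.zc_castSucc]
      have e2 : M.zc (j - m) = M.z i.succ := by
        rw [← M.zc_succ]; congr 1; simp [hi]; omega
      refine key i ⟨e1 ▸ hx.1, e2 ▸ h1.le⟩ ⟨γ (M.z i.succ), M.right_mem_element γ i, ih ?_⟩
      exact ⟨_, e2 ▸ left_mem_Icc.2 hmid, rfl⟩
    · rcases le_or_gt x (M.zc (j + 1 + m)) with h2 | h2
      · exact mono _ (ih ⟨x, ⟨h1, h2⟩, rfl⟩)
      · have hm : j + 1 + m < M.n := by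
          by_contra! hle
          rw [M.zc_of_le hle] at h2
          exact absurd (hx.2.trans (M.z_le _)) (not_le.2 h2)
        set i : Fin M.n := ⟨j + 1 + m, hm⟩ with hi
        have e1 : M.zc (j + 1 + m) = M.z i.castSucc := by rw [← M.zc_castSucc]
        have e2 : M.zc (j + 1 + (m + 1)) = M.z i.succ := by rw [← M.zc_succ]; congr 1
        refine key i ⟨e1 ▸ h2.le, e2 ▸ hx.2⟩ ⟨γ (M.z i.castSucc), M.left_mem_element γ i, ih ?_⟩
        exact ⟨_, e1 ▸ right_mem_Icc.2 hmid, rfl⟩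

/-! ### Test functions on the curve -/

section TestFunctions

variable {k : BdryType} {γ : ℝ → Plane} {a b : ℝ} {p : ℕ} {M : Mesh a b}

theorem tsupport_basisFun (h : IsParam k γ a b) (D : NurbsData k p M) {j : Fin M.n} {m : ℕ}
    {c C α β : ℝ} {i : ℤ} (hR : IsTestFunction M j m c C (nurbs D.knots.t D.w p i) α β) :
    tsupport (D.basisFun γ i) = γ '' Icc α β := by
  have hsub := hR.Icc_subset
  obtain ⟨g, hg, hgγ⟩ := h.exists_continuous_extension
  apply Subset.antisymm
  · refine closure_minimal (fun y hy => ?_)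
      (isCompact_Icc.image_of_continuousOn (h.continuousOn.mono hsub)).isClosed
    by_cases hmem : y ∈ γ '' paramDomain k a b
    · obtain ⟨x, hx, rfl⟩ := hmem
      have hy' : transport γ (paramDomain k a b) (nurbs D.knots.t D.w p i) (γ x) ≠ 0 := hy
      rw [transport_apply h _ hx] at hy'
      exact ⟨x, hR.support x (IsParam.paramDomain_subset k a b hx) hy', rfl⟩
    · exact absurd (transport_of_notMem _ hmem) hy
  · obtain ⟨s, hs, hpos⟩ := hR.pos
    have h1 : Icc α β ⊆ closure (Ioo α β ∩ sᶜ) := by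
      rw [← closure_Ioo hR.lt.ne]
      exact closure_minimal ((hs.dense_compl ℝ).open_subset_closure_inter isOpen_Ioo)
        isClosed_closure
    rw [← (hgγ.mono hsub).image_eq]
    refine (image_mono h1).trans ((image_closure_subset_closure_image hg).trans
      (closure_mono ?_))
    rintro _ ⟨x, hx, rfl⟩
    have hxab : x ∈ Ioo a b :=
      Ioo_subset_Ioo (hsub (left_mem_Icc.2 hR.lt.le)).1 (hsub (right_mem_Icc.2 hR.lt.le)).2 hx.1
    rw [hgγ (Ioo_subset_Icc_self hxab)]
    change transport γ (paramDomain k a b) (nurbs D.knots.t D.w p i) (γ x) ≠ 0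
    rw [transport_apply h _ (IsParam.Ioo_subset_paramDomain k a b hxab)]
    exact (hpos x hx.1 hx.2).ne'

theorem integrable_nurbs (h : IsParam k γ a b) (D : NurbsData k p M) {c₀ C₀ : ℝ}
    (hν : ComparableMeasure (paramMeasure γ a b) a b c₀ C₀) (i : ℤ) :
    Integrable (nurbs D.knots.t D.w p i) (paramMeasure γ a b) := by
  obtain ⟨g, hg, hgγ⟩ := h.exists_continuous_extension
  have := h.isFiniteMeasure_arcMeasure
  have h1 := (D.memLp_of_mem_space h (D.basisFun_mem_space γ i)).integrable (by norm_num)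
  have h2 := (IsParam.measurePreserving hν hg hgγ).integrable_comp_of_integrable h1
  exact h2.congr (D.basisFun_comp_ae_eq h hν hgγ i)

theorem satisfiesA1A2_of_isTestFunction (h : IsParam k γ a b) (D : NurbsData k p M) {m : ℕ}
    {c C c₀ C₀ q : ℝ} (hc : 0 < c)
    (hν : ComparableMeasure (paramMeasure γ a b) a b c₀ C₀) (hq : 0 < q)
    (hqc : q * (C₀ * C) ≤ c * c₀ / 3)
    (hR : ∀ j : Fin M.n, ∃ (i : ℤ) (α β : ℝ),
      IsTestFunction M j m c C (nurbs D.knots.t D.w p i) α β) :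
    SatisfiesA1A2 M γ (D.space γ) m q := by
  choose i α β hR using hR
  refine ⟨fun j => D.basisFun γ (i j), fun j => ?_⟩
  have hsub := (hR j).Icc_subset
  have hfin := h.isFiniteMeasure_arcMeasure
  obtain ⟨g, hg, hgγ⟩ := h.exists_continuous_extension
  rw [tsupport_basisFun h D (hR j)]
  refine ⟨D.basisFun_mem_space γ _, ?_, ?_, ?_, ?_⟩
  · exact (isConnected_Icc (hR j).lt.le).image _ (h.continuousOn.mono hsub)
  · exact image_mono (Icc_subset_Icc (hR j).α_le (hR j).le_β)
  · exact (image_mono (Icc_subset_Icc (hR j).le_α (hR j).β_le)).trans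
      (M.image_Icc_subset_patch γ j m)
  · set ψ := D.basisFun γ (i j) with hψ
    have hψm : Measurable ψ := D.measurable_of_mem_space h (D.basisFun_mem_space γ _)
    have hψint : Integrable ψ (arcMeasure γ a b) :=
      (D.memLp_of_mem_space h (D.basisFun_mem_space γ _)).integrable (by norm_num)
    have h01 : ∀ y, ψ y ∈ Icc (0 : ℝ) 1 := D.basisFun_mem_Icc γ _
    have hint1 : Integrable (fun y => 1 - ψ y) (arcMeasure γ a b) :=
      (integrable_const _).sub hψint
    have hle : ∀ y, (1 - ψ y) ^ 2 ≤ 1 - ψ y := fun y => by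
      have := (h01 y).1; have := (h01 y).2; nlinarith
    calc ∫ x in γ '' Icc (α j) (β j), (1 - ψ x) ^ 2 ∂(arcMeasure γ a b)
        ≤ ∫ x in γ '' Icc (α j) (β j), (1 - ψ x) ∂(arcMeasure γ a b) := by
          refine integral_mono_of_nonneg (ae_of_all _ fun y => sq_nonneg _) hint1.integrableOn
            (ae_of_all _ hle)
      _ = (arcMeasure γ a b).real (γ '' Icc (α j) (β j)) -
            ∫ x in γ '' Icc (α j) (β j), ψ x ∂(arcMeasure γ a b) := by
          rw [integral_sub (integrable_const _) hψint.integrableOn]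
          simp
      _ ≤ _ := by
          have e1 := h.setIntegral_image hν hg hgγ hsub isClosed_Icc hψm.aestronglyMeasurable
          have e2 : ∫ t in Icc (α j) (β j), ψ (g t) ∂(paramMeasure γ a b) =
              ∫ t in Icc (α j) (β j), nurbs D.knots.t D.w p (i j) t ∂(paramMeasure γ a b) :=
            integral_congr_ae (ae_restrict_of_ae (D.basisFun_comp_ae_eq h hν hgγ (i j)))
          have e3 := (hR j).le_setIntegral hc hν (integrable_nurbs h D hν _)
          have e4 := (hR j).real_le hν
          rw [e1, e2, h.real_image hν hg hgγ hsub isClosed_Icc]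
          have h5 : q * (paramMeasure γ a b).real (Icc (α j) (β j)) ≤
              c * c₀ / 3 * M.cellLength j := by
            calc _ ≤ q * (C₀ * C * M.cellLength j) := by gcongr
              _ = q * (C₀ * C) * M.cellLength j := by ring
              _ ≤ _ := by gcongr; exact (M.cellLength_pos j).le
          linarith

end TestFunctions

/-- The first part: the constant `q` depends on the curve through its speed only. -/
theorem exists_constant_A1A2 (k : BdryType) (a b : ℝ) (p : ℕ) (κ wmin wmax : ℝ) (φ : ℝ → ℝ)
    (hwmin : 0 < wmin) :
    ∃ q : ℝ, 0 < q ∧ q ≤ 1 ∧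
      ∀ γ : ℝ → Plane, IsParam k γ a b → (∀ t ∈ Set.Ico a b, ‖rightDeriv γ t‖ = φ t) →
        ∀ (M : Mesh a b) (D : NurbsData k p M), M.kappa γ ≤ κ → D.WeightsIn wmin wmax →
          (∀ ψ ∈ D.space γ, MeasureTheory.MemLp ψ 2 (arcMeasure γ a b)) ∧
          SatisfiesA1A2 M γ (D.space γ) ⌈(p : ℝ) / 2⌉₊ q := by
  by_cases hφ : ∃ c₀ C₀ : ℝ, 0 < c₀ ∧ 0 < C₀ ∧ ∀ t ∈ Ico a b, c₀ ≤ φ t ∧ φ t ≤ C₀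
  · obtain ⟨c₀, C₀, hc₀, hC₀, hφ⟩ := hφ
    obtain ⟨c, C, hc, hC, H⟩ := NurbsData.exists_isTestFunction p (κ := max κ 1) wmax
      (le_max_right _ _) hwmin
    refine ⟨min 1 (c * c₀ / 3 / (C₀ * C)), by positivity, min_le_left _ _, ?_⟩
    intro γ h hγ M D hκ hw
    refine ⟨fun ψ hψ => D.memLp_of_mem_space h hψ, ?_⟩
    have hν := comparableMeasure_paramMeasure (γ := γ) hc₀ hC₀ fun t ht => by
      rw [hγ t ht]; exact hφ t ht
    refine satisfiesA1A2_of_isTestFunction h D hc hν (by positivity) ?_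
      (H k a b M D h.lt (M.ratioBound_of_kappa h (hκ.trans (le_max_left _ _))) hw)
    rw [← le_div_iff₀ (by positivity)]
    exact min_le_right _ _
  · -- no admissible curve has the speed `φ`
    refine ⟨1, one_pos, le_rfl, fun γ h hγ => absurd ?_ hφ⟩
    obtain ⟨c, C, hc, hC, hb⟩ := h.exists_speed_bounds
    exact ⟨c, C, hc, hC, fun t ht => hγ t ht ▸ hb t ht⟩

/-! ### Cell averages and the local Poincaré estimate -/

namespace Mesh

variable {k : BdryType} {a b κ : ℝ}

/-- The cell lengths, indexed by the natural numbers. -/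
noncomputable def len (M : Mesh a b) (i : ℕ) : ℝ := M.zc (i + 1) - M.zc i

theorem len_eq (M : Mesh a b) (j : Fin M.n) : M.len j = M.cellLength j := by
  rw [len, M.zc_succ, M.zc_castSucc]; rfl

theorem len_pos (M : Mesh a b) {i : ℕ} (hi : i < M.n) : 0 < M.len i :=
  sub_pos.2 (M.zc_lt_zc (Nat.lt_succ_self i) hi)

theorem RatioBound.len_succ_le {M : Mesh a b} (h : M.RatioBound k κ) {i : ℕ} (hi : i + 1 < M.n) :
    M.len (i + 1) ≤ κ * M.len i := by
  have := h.next_le ⟨i, by omega⟩ ⟨i + 1, hi⟩ rfl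
  rwa [← len_eq, ← len_eq] at this

theorem RatioBound.len_le_succ {M : Mesh a b} (h : M.RatioBound k κ) {i : ℕ} (hi : i + 1 < M.n) :
    M.len i ≤ κ * M.len (i + 1) := by
  have := h.prev_le ⟨i, by omega⟩ ⟨i + 1, hi⟩ rfl
  rwa [← len_eq, ← len_eq] at this

theorem RatioBound.len_add_le {M : Mesh a b} (h : M.RatioBound k κ) {i : ℕ} (d : ℕ)
    (hi : i + d < M.n) : M.len (i + d) ≤ κ ^ d * M.len i ∧ M.len i ≤ κ ^ d * M.len (i + d) := by
  have hκ : 0 ≤ κ := zero_le_one.trans h.one_le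
  induction d with
  | zero => simp
  | succ d ih =>
    obtain ⟨h1, h2⟩ := ih (by omega)
    constructor
    · calc M.len (i + (d + 1)) ≤ κ * M.len (i + d) := h.len_succ_le (by omega)
        _ ≤ κ * (κ ^ d * M.len i) := by gcongr
        _ = _ := by ring
    · calc M.len i ≤ κ ^ d * M.len (i + d) := h2
        _ ≤ κ ^ d * (κ * M.len (i + (d + 1))) := by gcongr; exact h.len_le_succ (by omega)
        _ = _ := by ring

theorem RatioBound.len_le_of_near {M : Mesh a b} (h : M.RatioBound k κ) {i j m : ℕ}
    (hi : i < M.n) (hj : j < M.n) (h1 : i ≤ j + m) (h2 : j ≤ i + m) :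
    M.len i ≤ κ ^ m * M.len j := by
  have key : ∀ d, d ≤ m → κ ^ d * M.len j ≤ κ ^ m * M.len j := fun d hd =>
    mul_le_mul_of_nonneg_right (pow_le_pow_right₀ h.one_le hd) (M.len_pos hj).le
  rcases le_total i j with hij | hij
  · obtain ⟨d, rfl⟩ := Nat.exists_eq_add_of_le hij
    exact (h.len_add_le d hj).2.trans (key d (by omega))
  · obtain ⟨d, rfl⟩ := Nat.exists_eq_add_of_le hij
    exact (h.len_add_le d hi).1.trans (key d (by omega))

/-- The half-open cells, indexed by the natural numbers (empty from `M.n` on). -/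
noncomputable def hcell (M : Mesh a b) (i : ℕ) : Set ℝ := Ioc (M.zc i) (M.zc (i + 1))

theorem measurableSet_hcell (M : Mesh a b) (i : ℕ) : MeasurableSet (M.hcell i) := measurableSet_Ioc

/-- The indices of the cells at distance at most `m` from the cell `j`. -/
def window (M : Mesh a b) (j m : ℕ) : Finset ℕ := Finset.Ico (j - m) (min (j + 1 + m) M.n)

theorem mem_window {M : Mesh a b} {i j m : ℕ} :
    i ∈ M.window j m ↔ j ≤ i + m ∧ i ≤ j + m ∧ i < M.n := by
  simp only [window, Finset.mem_Ico]; omega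

theorem card_window_le (M : Mesh a b) (j m : ℕ) : (M.window j m).card ≤ 2 * m + 1 := by
  simp only [window, Nat.card_Ico]; omega

theorem sum_setIntegral_hcell (M : Mesh a b) {ν : Measure ℝ} {f : ℝ → ℝ} (hf : Integrable f ν)
    {i i' : ℕ} (h : i ≤ i') :
    ∑ k ∈ Finset.Ico i i', ∫ t in M.hcell k, f t ∂ν = ∫ t in Ioc (M.zc i) (M.zc i'), f t ∂ν := by
  rw [← intervalIntegral.integral_of_le (M.zc_mono h),
    ← intervalIntegral.sum_integral_adjacent_intervals_Ico h fun k _ => hf.intervalIntegrable]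
  exact Finset.sum_congr rfl fun k _ =>
    (intervalIntegral.integral_of_le (M.zc_mono (Nat.le_succ k))).symm

theorem sum_setIntegral_window (M : Mesh a b) {ν : Measure ℝ} {f : ℝ → ℝ} (hf : Integrable f ν)
    {j m : ℕ} (hj : j < M.n) :
    ∑ k ∈ M.window j m, ∫ t in M.hcell k, f t ∂ν =
      ∫ t in Ioc (M.zc (j - m)) (M.zc (j + 1 + m)), f t ∂ν := by
  rw [window, M.sum_setIntegral_hcell hf (by omega)]
  rcases le_total (j + 1 + m) M.n with h | h
  · rw [min_eq_left h]
  · rw [min_eq_right h, M.zc_of_le h, M.zc_of_le le_rfl]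

end Mesh

theorem ComparableMeasure.real_hcell {ν : Measure ℝ} {a b c C : ℝ} {M : Mesh a b}
    (h : ComparableMeasure ν a b c C) (i : ℕ) :
    c * M.len i ≤ ν.real (M.hcell i) ∧ ν.real (M.hcell i) ≤ C * M.len i := by
  have := h.nullSingletonClass
  have e : ν.real (M.hcell i) = ν.real (Icc (M.zc i) (M.zc (i + 1))) :=
    measureReal_congr Ioc_ae_eq_Icc
  rw [e]
  exact ⟨h.le_real_Icc (M.le_z _) (M.z_le _),
    h.real_Icc_le (M.zc_mono (Nat.le_succ i))⟩

theorem sq_sub_le_of_chain {f E : ℕ → ℝ} {A : ℝ} {i i' : ℕ} (hii' : i ≤ i')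
    (h : ∀ k ∈ Finset.Ico i i', (f (k + 1) - f k) ^ 2 ≤ A * E k) :
    (f i' - f i) ^ 2 ≤ (i' - i : ℕ) * (A * ∑ k ∈ Finset.Ico i i', E k) := by
  have e : f i' - f i = ∑ k ∈ Finset.Ico i i', (f (k + 1) - f k) := by
    rw [Finset.sum_Ico_eq_sub _ hii', Finset.sum_range_sub, Finset.sum_range_sub]; ring
  rw [e]
  refine (sq_sum_le_card_mul_sum_sq).trans ?_
  rw [Nat.card_Ico]
  refine mul_le_mul_of_nonneg_left ?_ (Nat.cast_nonneg _)
  rw [Finset.mul_sum]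
  exact Finset.sum_le_sum h

section Averages

variable {ν : Measure ℝ} [IsFiniteMeasure ν] {u : ℝ → ℝ}

theorem setIntegral_prod_sq_sub (hu : MemLp u 2 ν) (A B : Set ℝ) :
    ∫ P in A ×ˢ B, (u P.1 - u P.2) ^ 2 ∂(ν.prod ν) =
      ν.real B * ∫ t in A, u t ^ 2 ∂ν - 2 * (∫ t in A, u t ∂ν) * (∫ t in B, u t ∂ν) +
        ν.real A * ∫ t in B, u t ^ 2 ∂ν := by
  have h1 : Integrable u ν := hu.integrable (by norm_num)
  have h2 : Integrable (fun t => u t ^ 2) ν := hu.integrable_sq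
  have hc : Integrable (fun _ : ℝ => (1 : ℝ)) ν := integrable_const _
  have e : ∀ P : ℝ × ℝ, (u P.1 - u P.2) ^ 2 =
      u P.1 ^ 2 * 1 - 2 * (u P.1 * u P.2) + 1 * u P.2 ^ 2 := fun P => by ring
  have i1 := (h2.mul_prod hc).integrableOn (s := A ×ˢ B)
  have i2 := ((h1.mul_prod h1).const_mul 2).integrableOn (s := A ×ˢ B)
  have i3 := (hc.mul_prod h2).integrableOn (s := A ×ˢ B)
  have i12 : IntegrableOn (fun P : ℝ × ℝ => u P.1 ^ 2 * 1 - 2 * (u P.1 * u P.2)) (A ×ˢ B)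
    (ν.prod ν) := i1.sub i2
  simp only [e]
  rw [integral_add i12 i3, integral_sub i1 i2, integral_const_mul,
    setIntegral_prod_mul (fun t => u t ^ 2) (fun _ => (1 : ℝ)), setIntegral_prod_mul u u,
    setIntegral_prod_mul (fun _ => (1 : ℝ)) (fun t => u t ^ 2)]
  simp only [setIntegral_const, smul_eq_mul, mul_one]
  ring

theorem setIntegral_sq_sub_const (hu : MemLp u 2 ν) (A : Set ℝ) (c : ℝ) :
    ∫ t in A, (u t - c) ^ 2 ∂ν =
      ∫ t in A, u t ^ 2 ∂ν - 2 * c * ∫ t in A, u t ∂ν + c ^ 2 * ν.real A := by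
  have h1 : Integrable u ν := hu.integrable (by norm_num)
  have h2 : Integrable (fun t => u t ^ 2) ν := hu.integrable_sq
  have e : ∀ t, (u t - c) ^ 2 = u t ^ 2 - 2 * c * u t + c ^ 2 := fun t => by ring
  have h12 : IntegrableOn (fun t => u t ^ 2 - 2 * c * u t) A ν :=
    (h2.sub (h1.const_mul (2 * c))).integrableOn
  simp only [e]
  rw [integral_add h12 (integrable_const _),
    integral_sub h2.integrableOn (h1.const_mul _).integrableOn, integral_const_mul]
  simp only [setIntegral_const, smul_eq_mul]
  ring

/-- The variance `∫_A (u - ⨍ u)²`, written without the average. -/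
noncomputable def variance (ν : Measure ℝ) (u : ℝ → ℝ) (A : Set ℝ) : ℝ :=
  ∫ t in A, u t ^ 2 ∂ν - (∫ t in A, u t ∂ν) ^ 2 / ν.real A

/-- The average of `u` over `A`. -/
noncomputable def avg (ν : Measure ℝ) (u : ℝ → ℝ) (A : Set ℝ) : ℝ := (∫ t in A, u t ∂ν) / ν.real A

theorem setIntegral_sq_sub_const_eq (hu : MemLp u 2 ν) {A : Set ℝ} (hA : 0 < ν.real A) (c : ℝ) :
    ∫ t in A, (u t - c) ^ 2 ∂ν = variance ν u A + ν.real A * (avg ν u A - c) ^ 2 := by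
  rw [setIntegral_sq_sub_const hu, variance, avg]
  field_simp
  ring

theorem variance_nonneg (hu : MemLp u 2 ν) {A : Set ℝ} (hA : 0 < ν.real A) :
    0 ≤ variance ν u A := by
  have := setIntegral_sq_sub_const_eq hu hA (avg ν u A)
  rw [sub_self] at this
  have h0 : 0 ≤ ∫ t in A, (u t - avg ν u A) ^ 2 ∂ν := integral_nonneg fun t => sq_nonneg _
  linarith

theorem setIntegral_prod_sq_sub_eq (hu : MemLp u 2 ν) {A B : Set ℝ} (hA : 0 < ν.real A)
    (hB : 0 < ν.real B) :
    ∫ P in A ×ˢ B, (u P.1 - u P.2) ^ 2 ∂(ν.prod ν) =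
      ν.real B * variance ν u A + ν.real A * variance ν u B +
        ν.real A * ν.real B * (avg ν u B - avg ν u A) ^ 2 := by
  rw [setIntegral_prod_sq_sub hu, variance, variance, avg, avg]
  field_simp
  ring

end Averages

/-- The local estimate behind reliability: if `u` is orthogonal to a test function of the cell `j`,
then `∫ u²` over this cell is bounded by the cell length times the energies `E` of the cells in
the window. Orthogonality bounds the average of `u` on the cell by the deviation of `u` from this
average on the window, since `s² ∫ R ≤ ∫ R (u - s)²` for every constant `s`; the averages on
consecutive cells differ by at most the energy of the pair. -/
theorem exists_local_estimate {c₀ C₀ κ c C L : ℝ} (hc₀ : 0 < c₀) (hC₀ : 0 < C₀) (hκ1 : 1 ≤ κ)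
    (hc : 0 < c) (m : ℕ) :
    ∃ K : ℝ, 0 < K ∧ ∀ (k : BdryType) (a b : ℝ) (ν : Measure ℝ) (u : ℝ → ℝ) (M : Mesh a b)
      (R : ℝ → ℝ) (α β : ℝ) (j : Fin M.n) (E : ℕ → ℝ),
      ComparableMeasure ν a b c₀ C₀ → MemLp u 2 ν → M.RatioBound k κ →
      IsTestFunction M j m c C R α β → Integrable R ν → ∫ t, R t * u t ∂ν = 0 →
      (∀ i, 0 ≤ E i) →
      (∀ i < M.n, ∫ P in M.hcell i ×ˢ M.hcell i, (u P.1 - u P.2) ^ 2 ∂(ν.prod ν) ≤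
        L ^ 2 * M.len i ^ 2 * E i) →
      (∀ i, i + 1 < M.n →
        ∫ P in M.hcell i ×ˢ M.hcell (i + 1), (u P.1 - u P.2) ^ 2 ∂(ν.prod ν) ≤
        L ^ 2 * (M.len i + M.len (i + 1)) ^ 2 * E i) →
      ∫ t in M.hcell j, u t ^ 2 ∂ν ≤ K * M.len j * ∑ i ∈ M.window j m, E i := by
  set A1 : ℝ := L ^ 2 / (2 * c₀) with hA1
  set A2 : ℝ := L ^ 2 * (1 + κ) ^ 2 * κ / c₀ ^ 2 with hA2
  have hκ0 : 0 < κ := zero_lt_one.trans_le hκ1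
  have hA1' : 0 ≤ A1 := by positivity
  have hA2' : 0 ≤ A2 := by positivity
  set ρ : ℝ := c * c₀ / 3 with hρ
  have hρ' : 0 < ρ := by positivity
  set B : ℝ := A1 * κ ^ m + (2 * m + 1) * (C₀ * κ ^ m * (m * A2)) with hB
  refine ⟨A1 + C₀ * (B / ρ) + 1, by positivity, ?_⟩
  intro k a b ν u M R α β j E hν hu hκ hR hRint horth hE hE1 hE2
  have := hν.isFiniteMeasure
  have hlen : ∀ i, i < M.n → 0 < M.len i := fun i hi => M.len_pos hi
  have hνpos : ∀ i, i < M.n → 0 < ν.real (M.hcell i) := fun i hi =>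
    (mul_pos hc₀ (hlen i hi)).trans_le (hν.real_hcell i).1
  set S : ℝ := ∑ i ∈ M.window j m, E i with hS
  have hSnn : 0 ≤ S := Finset.sum_nonneg fun i _ => hE i
  have hES : ∀ i ∈ M.window j m, E i ≤ S := fun i hi =>
    Finset.single_le_sum (f := E) (fun i _ => hE i) hi
  have hjW : (j : ℕ) ∈ M.window j m := Mesh.mem_window.2 ⟨by omega, by omega, j.2⟩
  -- the variance on a cell
  have hv : ∀ i, i < M.n → variance ν u (M.hcell i) ≤ A1 * M.len i * E i := by
    intro i hi
    have h1 := hE1 i hi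
    rw [setIntegral_prod_sq_sub_eq hu (hνpos i hi) (hνpos i hi)] at h1
    simp only [sub_self, zero_pow two_ne_zero, mul_zero, add_zero] at h1
    have h2 := mul_le_mul_of_nonneg_right (hν.real_hcell (M := M) i).1
      (variance_nonneg hu (hνpos i hi))
    have h3 : (2 * c₀ * M.len i) * variance ν u (M.hcell i) ≤
        (2 * c₀ * M.len i) * (A1 * M.len i * E i) := by
      have : (2 * c₀ * M.len i) * (A1 * M.len i * E i) = L ^ 2 * M.len i ^ 2 * E i := by
        rw [hA1]; field_simp
      rw [this]; linarith
    exact le_of_mul_le_mul_left h3 (by have := hlen i hi; positivity)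
  -- averages on consecutive cells
  have hM : ∀ i, i + 1 < M.n →
      (avg ν u (M.hcell (i + 1)) - avg ν u (M.hcell i)) ^ 2 ≤ A2 * E i := by
    intro i hi
    have hi' : i < M.n := by omega
    have h1 := hE2 i hi
    rw [setIntegral_prod_sq_sub_eq hu (hνpos i hi') (hνpos _ hi)] at h1
    have n1 := mul_nonneg (hνpos _ hi).le (variance_nonneg hu (hνpos i hi'))
    have n2 := mul_nonneg (hνpos _ hi').le (variance_nonneg hu (hνpos _ hi))
    have l1 := hlen i hi'
    have l2 := hlen _ hi
    have h2 : c₀ * M.len i * (c₀ * M.len (i + 1)) ≤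
        ν.real (M.hcell i) * ν.real (M.hcell (i + 1)) :=
      mul_le_mul (hν.real_hcell i).1 (hν.real_hcell _).1 (by positivity) (hνpos i hi').le
    have h3 := mul_le_mul_of_nonneg_right h2
      (sq_nonneg (avg ν u (M.hcell (i + 1)) - avg ν u (M.hcell i)))
    have h4 : (M.len i + M.len (i + 1)) ^ 2 ≤ (1 + κ) ^ 2 * κ * (M.len i * M.len (i + 1)) := by
      calc (M.len i + M.len (i + 1)) ^ 2 ≤ ((1 + κ) * M.len i) ^ 2 := by
            gcongr; linarith [hκ.len_succ_le hi]
        _ = (1 + κ) ^ 2 * (M.len i * M.len i) := by ring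
        _ ≤ (1 + κ) ^ 2 * (M.len i * (κ * M.len (i + 1))) := by
            gcongr; exact hκ.len_le_succ hi
        _ = _ := by ring
    have h5 : c₀ * M.len i * (c₀ * M.len (i + 1)) *
          (avg ν u (M.hcell (i + 1)) - avg ν u (M.hcell i)) ^ 2 ≤
        c₀ * M.len i * (c₀ * M.len (i + 1)) * (A2 * E i) := by
      have e1 : c₀ * M.len i * (c₀ * M.len (i + 1)) * (A2 * E i) =
          L ^ 2 * ((1 + κ) ^ 2 * κ * (M.len i * M.len (i + 1))) * E i := by
        rw [hA2]; field_simp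
      have e2 : L ^ 2 * (M.len i + M.len (i + 1)) ^ 2 * E i ≤
          L ^ 2 * ((1 + κ) ^ 2 * κ * (M.len i * M.len (i + 1))) * E i :=
        mul_le_mul_of_nonneg_right (mul_le_mul_of_nonneg_left h4 (sq_nonneg L)) (hE i)
      linarith
    exact le_of_mul_le_mul_left h5 (by positivity)
  -- averages on the window
  have hMj : ∀ i ∈ M.window j m,
      (avg ν u (M.hcell i) - avg ν u (M.hcell j)) ^ 2 ≤ m * (A2 * S) := by
    intro i hi
    obtain ⟨w1, w2, w3⟩ := Mesh.mem_window.1 hi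
    have key : ∀ x y : ℕ, x ∈ M.window j m → y ∈ M.window j m → x ≤ y → y - x ≤ m →
        (avg ν u (M.hcell y) - avg ν u (M.hcell x)) ^ 2 ≤ m * (A2 * S) := by
      intro x y hx hy hxy hd
      rw [Mesh.mem_window] at hx hy
      refine (sq_sub_le_of_chain (f := fun i => avg ν u (M.hcell i)) (E := E) (A := A2) hxy
        fun i hi => hM i ?_).trans ?_
      · rw [Finset.mem_Ico] at hi; omega
      · have h1 : ((y - x : ℕ) : ℝ) ≤ m := by exact_mod_cast hd
        have h2 : ∑ i ∈ Finset.Ico x y, E i ≤ S := by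
          refine Finset.sum_le_sum_of_subset_of_nonneg (fun i hi => ?_) fun i _ _ => hE i
          rw [Finset.mem_Ico] at hi
          exact Mesh.mem_window.2 ⟨by omega, by omega, by omega⟩
        have h3 : 0 ≤ ∑ i ∈ Finset.Ico x y, E i := Finset.sum_nonneg fun i _ => hE i
        gcongr
    rcases le_total (j : ℕ) i with hji | hji
    · exact key j i hjW hi hji (by omega)
    · rw [← neg_sq, neg_sub]
      exact key i j hi hjW hji (by omega)
  -- the deviation from the average on the cell `j`
  have hdev : ∀ i ∈ M.window j m, ∫ t in M.hcell i, (u t - avg ν u (M.hcell j)) ^ 2 ∂ν ≤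
      (A1 * κ ^ m * E i + C₀ * κ ^ m * (m * A2) * S) * M.len j := by
    intro i hi
    obtain ⟨w1, w2, w3⟩ := Mesh.mem_window.1 hi
    rw [setIntegral_sq_sub_const_eq hu (hνpos i w3)]
    have h1 := hκ.len_le_of_near w3 j.2 w2 w1
    have h2 : variance ν u (M.hcell i) ≤ A1 * (κ ^ m * M.len j) * E i :=
      (hv i w3).trans (mul_le_mul_of_nonneg_right (mul_le_mul_of_nonneg_left h1 hA1') (hE i))
    have h3 : ν.real (M.hcell i) * (avg ν u (M.hcell i) - avg ν u (M.hcell j)) ^ 2 ≤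
        C₀ * (κ ^ m * M.len j) * (m * (A2 * S)) := by
      refine mul_le_mul ((hν.real_hcell i).2.trans ?_) (hMj i hi) (sq_nonneg _) ?_
      · exact mul_le_mul_of_nonneg_left h1 hC₀.le
      · have := hlen j j.2; positivity
    linarith
  have hint : Integrable (fun t => (u t - avg ν u (M.hcell j)) ^ 2) ν :=
    (hu.sub (memLp_const _)).integrable_sq
  have hwin : ∫ t in Ioc (M.zc (j - m)) (M.zc (j + 1 + m)),
      (u t - avg ν u (M.hcell j)) ^ 2 ∂ν ≤ B * S * M.len j := by
    rw [← M.sum_setIntegral_window hint j.2]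
    calc _ ≤ ∑ i ∈ M.window j m, (A1 * κ ^ m * E i + C₀ * κ ^ m * (m * A2) * S) * M.len j :=
          Finset.sum_le_sum hdev
      _ = (A1 * κ ^ m * S + (M.window j m).card * (C₀ * κ ^ m * (m * A2) * S)) * M.len j := by
          rw [← Finset.sum_mul, Finset.sum_add_distrib, ← Finset.mul_sum, Finset.sum_const,
            nsmul_eq_mul]
      _ ≤ (A1 * κ ^ m * S + (2 * m + 1) * (C₀ * κ ^ m * (m * A2) * S)) * M.len j := by
          have h1 : ((M.window j m).card : ℝ) ≤ 2 * m + 1 := by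
            exact_mod_cast M.card_window_le j m
          have h2 := (hlen j j.2).le
          gcongr
      _ = _ := by rw [hB]; ring
  -- orthogonality
  have hRm := hRint.aestronglyMeasurable
  have hRb : ∀ᵐ t ∂ν, ‖R t‖ ≤ 1 := ae_of_all _ fun t => by
    rw [Real.norm_eq_abs, abs_of_nonneg (hR.nonneg t)]; exact hR.le_one t
  have hu1 : Integrable u ν := hu.integrable (by norm_num)
  have hRu : Integrable (fun t => R t * u t) ν := hu1.bdd_mul hRm hRb
  have hRu2 : Integrable (fun t => R t * u t ^ 2) ν := hu.integrable_sq.bdd_mul hRm hRb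
  have hRdev : Integrable (fun t => R t * (u t - avg ν u (M.hcell j)) ^ 2) ν :=
    hint.bdd_mul hRm hRb
  have h1 : avg ν u (M.hcell j) ^ 2 * ∫ t, R t ∂ν ≤
      ∫ t, R t * (u t - avg ν u (M.hcell j)) ^ 2 ∂ν := by
    set μ := avg ν u (M.hcell j)
    have e : ∀ t, R t * (u t - μ) ^ 2 = R t * u t ^ 2 - 2 * μ * (R t * u t) + μ ^ 2 * R t :=
      fun t => by ring
    have h12 : Integrable (fun t => R t * u t ^ 2 - 2 * μ * (R t * u t)) ν :=
      hRu2.sub (hRu.const_mul _)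
    simp only [e]
    rw [integral_add h12 (hRint.const_mul _), integral_sub hRu2 (hRu.const_mul _),
      integral_const_mul, integral_const_mul, horth]
    have : 0 ≤ ∫ t, R t * u t ^ 2 ∂ν :=
      integral_nonneg fun t => mul_nonneg (hR.nonneg t) (sq_nonneg _)
    linarith
  have h2 : ∫ t, R t * (u t - avg ν u (M.hcell j)) ^ 2 ∂ν ≤
      ∫ t in Ioc (M.zc (j - m)) (M.zc (j + 1 + m)), (u t - avg ν u (M.hcell j)) ^ 2 ∂ν := by
    have := hν.nullSingletonClass
    rw [setIntegral_congr_set Ioc_ae_eq_Icc, ← integral_indicator measurableSet_Icc]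
    refine integral_mono_ae hRdev (hint.indicator measurableSet_Icc) ?_
    filter_upwards [hν.ae_mem_Ioo] with t ht
    by_cases ht' : t ∈ Icc (M.zc (j - m)) (M.zc (j + 1 + m))
    · rw [indicator_of_mem ht']
      exact mul_le_of_le_one_left (sq_nonneg _) (hR.le_one t)
    · rw [indicator_of_notMem ht']
      have : R t = 0 := by
        by_contra h0
        have h3 := hR.support t (Ioo_subset_Icc_self ht) h0
        exact ht' ⟨hR.le_α.trans h3.1, h3.2.trans hR.β_le⟩
      simp [this]
  have h3 : ρ * M.len j ≤ ∫ t, R t ∂ν := by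
    rw [M.len_eq]
    refine (hR.le_setIntegral hc hν hRint).trans ?_
    exact setIntegral_le_integral hRint (ae_of_all _ hR.nonneg)
  have hlj := hlen j j.2
  have h4 : avg ν u (M.hcell j) ^ 2 ≤ B / ρ * S := by
    have h5 : (ρ * M.len j) * avg ν u (M.hcell j) ^ 2 ≤ (ρ * M.len j) * (B / ρ * S) := by
      have e : (ρ * M.len j) * (B / ρ * S) = B * S * M.len j := by field_simp
      rw [e, mul_comm]
      exact (mul_le_mul_of_nonneg_left h3 (sq_nonneg _)).trans (h1.trans (h2.trans hwin))
    exact le_of_mul_le_mul_left h5 (by positivity)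
  have h6 := setIntegral_sq_sub_const_eq hu (hνpos j j.2) 0
  simp only [sub_zero] at h6
  rw [h6]
  have h7 : ν.real (M.hcell j) * avg ν u (M.hcell j) ^ 2 ≤ C₀ * M.len j * (B / ρ * S) :=
    mul_le_mul (hν.real_hcell _).2 h4 (sq_nonneg _) (by positivity)
  have h8 : variance ν u (M.hcell j) ≤ A1 * M.len j * S :=
    (hv j j.2).trans (mul_le_mul_of_nonneg_left (hES j hjW) (by positivity))
  have h9 : 0 ≤ M.len j * S := by positivity
  linarith

/-! ### The far field -/

/-- A multiple of the Cauchy kernel that dominates `x⁻²` for `|x| ≥ δ`. -/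
noncomputable def cauchyKernel (δ x : ℝ) : ℝ := 2 / δ ^ 2 * (1 + (x / δ) ^ 2)⁻¹

theorem cauchyKernel_nonneg (δ x : ℝ) : 0 ≤ cauchyKernel δ x := by
  unfold cauchyKernel; positivity

theorem cauchyKernel_le (δ x : ℝ) : cauchyKernel δ x ≤ 2 / δ ^ 2 := by
  unfold cauchyKernel
  refine mul_le_of_le_one_right (by positivity) (inv_le_one_of_one_le₀ ?_)
  have := sq_nonneg (x / δ)
  linarith

theorem one_div_sq_le_cauchyKernel {δ x : ℝ} (hδ : 0 < δ) (hx : δ ≤ |x|) :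
    1 / x ^ 2 ≤ cauchyKernel δ x := by
  have h1 : δ ^ 2 ≤ x ^ 2 := by rw [← sq_abs x]; gcongr
  have h2 : 0 < x ^ 2 := lt_of_lt_of_le (by positivity) h1
  have e : cauchyKernel δ x = 2 / (δ ^ 2 + x ^ 2) := by
    unfold cauchyKernel
    field_simp
  rw [e, div_le_div_iff₀ h2 (by positivity)]
  linarith

theorem continuous_cauchyKernel (δ : ℝ) : Continuous (cauchyKernel δ) := by
  unfold cauchyKernel
  refine continuous_const.mul (Continuous.inv₀ (by fun_prop) fun x => ?_)
  positivity

theorem integrable_cauchyKernel {δ : ℝ} (hδ : 0 < δ) : Integrable (cauchyKernel δ) := by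
  unfold cauchyKernel
  exact (integrable_inv_one_add_sq.comp_div hδ.ne').const_mul _

theorem integral_cauchyKernel {δ : ℝ} (hδ : 0 < δ) :
    ∫ x, cauchyKernel δ x = 2 * Real.pi / δ := by
  unfold cauchyKernel
  rw [integral_const_mul, Measure.integral_comp_div (fun x => (1 + x ^ 2)⁻¹) δ,
    integral_univ_inv_one_add_sq, abs_of_pos hδ, smul_eq_mul]
  field_simp

/-- The Cauchy kernel with its translates by one period `P`. -/
noncomputable def periodicKernel (δ P s t : ℝ) : ℝ :=
  cauchyKernel δ (t - s) + cauchyKernel δ (t - s - P) + cauchyKernel δ (t - s + P)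

theorem periodicKernel_nonneg (δ P s t : ℝ) : 0 ≤ periodicKernel δ P s t :=
  add_nonneg (add_nonneg (cauchyKernel_nonneg _ _) (cauchyKernel_nonneg _ _))
    (cauchyKernel_nonneg _ _)

theorem periodicKernel_le (δ P s t : ℝ) : periodicKernel δ P s t ≤ 3 * (2 / δ ^ 2) := by
  unfold periodicKernel
  linarith [cauchyKernel_le δ (t - s), cauchyKernel_le δ (t - s - P), cauchyKernel_le δ (t - s + P)]

theorem continuous_periodicKernel (δ P : ℝ) :
    Continuous fun x : ℝ × ℝ => periodicKernel δ P x.1 x.2 := by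
  have := continuous_cauchyKernel δ
  unfold periodicKernel
  fun_prop

theorem integral_periodicKernel_le {ν : Measure ℝ} {a b c C δ : ℝ}
    (hν : ComparableMeasure ν a b c C) (hδ : 0 < δ) (P s : ℝ) :
    ∫ t, periodicKernel δ P s t ∂ν ≤ C * (6 * Real.pi / δ) := by
  have hle : ν ≤ ENNReal.ofReal C • volume :=
    hν.upper.trans (by
      intro A
      simp only [Measure.smul_apply, smul_eq_mul]
      exact mul_le_mul_right (Measure.restrict_apply_le _ _) _)
  have i0 := integrable_cauchyKernel hδ
  have i1 : Integrable fun t => cauchyKernel δ (t - s) := i0.comp_sub_right s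
  have i2 : Integrable fun t => cauchyKernel δ (t - s - P) := by
    simpa only [sub_sub] using i0.comp_sub_right (s + P)
  have i3 : Integrable fun t => cauchyKernel δ (t - s + P) := by
    simpa only [sub_add] using i0.comp_sub_right (s - P)
  have i12 : Integrable fun t => cauchyKernel δ (t - s) + cauchyKernel δ (t - s - P) := i1.add i2
  have hint : Integrable (fun t => periodicKernel δ P s t) := i12.add i3
  have hval : ∫ t, periodicKernel δ P s t = 6 * Real.pi / δ := by
    unfold periodicKernel
    rw [integral_add i12 i3, integral_add i1 i2]
    have e1 : ∫ t, cauchyKernel δ (t - s) = 2 * Real.pi / δ := by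
      rw [integral_sub_right_eq_self (cauchyKernel δ) s, integral_cauchyKernel hδ]
    have e2 : ∫ t, cauchyKernel δ (t - s - P) = 2 * Real.pi / δ := by
      simp only [sub_sub]
      rw [integral_sub_right_eq_self (cauchyKernel δ) (s + P), integral_cauchyKernel hδ]
    have e3 : ∫ t, cauchyKernel δ (t - s + P) = 2 * Real.pi / δ := by
      simp only [sub_add]
      rw [integral_sub_right_eq_self (cauchyKernel δ) (s - P), integral_cauchyKernel hδ]
    rw [e1, e2, e3]; ring
  calc ∫ t, periodicKernel δ P s t ∂ν
      ≤ ∫ t, periodicKernel δ P s t ∂(ENNReal.ofReal C • volume) :=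
        integral_mono_measure hle (ae_of_all _ fun t => periodicKernel_nonneg _ _ _ _)
          (hint.smul_measure ENNReal.ofReal_ne_top)
    _ = _ := by
        rw [integral_smul_measure, hval, ENNReal.toReal_ofReal hν.C_pos.le, smul_eq_mul]

section

variable {ν : Measure ℝ} {a b c C : ℝ} {u : ℝ → ℝ}

theorem integrable_sq_mul_periodicKernel (hν : ComparableMeasure ν a b c C) (hu : MemLp u 2 ν)
    (δ P : ℝ) :
    Integrable (fun x : ℝ × ℝ => u x.1 ^ 2 * periodicKernel δ P x.1 x.2) (ν.prod ν) := by
  have := hν.isFiniteMeasure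
  have h1 : Integrable (fun x : ℝ × ℝ => u x.1 ^ 2 * 1) (ν.prod ν) :=
    hu.integrable_sq.mul_prod (g := fun _ => (1 : ℝ)) (integrable_const _)
  simp only [mul_one] at h1
  refine h1.mul_bdd (c := 3 * (2 / δ ^ 2))
    (continuous_periodicKernel δ P).aestronglyMeasurable (ae_of_all _ fun x => ?_)
  rw [Real.norm_eq_abs, abs_of_nonneg (periodicKernel_nonneg _ _ _ _)]
  exact periodicKernel_le _ _ _ _

theorem setIntegral_sq_mul_periodicKernel_le (hν : ComparableMeasure ν a b c C) (hu : MemLp u 2 ν)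
    {δ : ℝ} (hδ : 0 < δ) (P : ℝ) (A : Set ℝ) :
    ∫ x in A ×ˢ univ, u x.1 ^ 2 * periodicKernel δ P x.1 x.2 ∂(ν.prod ν) ≤
      C * (6 * Real.pi / δ) * ∫ s in A, u s ^ 2 ∂ν := by
  have := hν.isFiniteMeasure
  have hint := integrable_sq_mul_periodicKernel hν hu δ P
  have hintA := hint.integrableOn (s := A ×ˢ univ)
  rw [setIntegral_prod _ hintA, ← integral_const_mul]
  rw [IntegrableOn, ← Measure.prod_restrict] at hintA
  refine integral_mono hintA.integral_prod_left
    (hu.integrable_sq.integrableOn.const_mul _) fun s => ?_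
  simp only [Measure.restrict_univ]
  rw [integral_const_mul, mul_comm]
  exact mul_le_mul_of_nonneg_right (integral_periodicKernel_le hν hδ P s) (sq_nonneg _)

end

/-! ### Separation of elements that do not meet -/

section Separation

variable {k : BdryType} {γ : ℝ → Plane} {a b : ℝ}

namespace Mesh

theorem elements_meet_of_succ (M : Mesh a b) (γ : ℝ → Plane) {i j : Fin M.n}
    (hij : (j : ℕ) = i + 1) : (M.element γ i ∩ M.element γ j).Nonempty := by
  have e : i.succ = j.castSucc := by ext; simp [hij]
  exact ⟨γ (M.z j.castSucc), by rw [← e]; exact M.right_mem_element γ i, M.left_mem_element γ j⟩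

theorem elements_meet_of_wrap (h : IsParam .closedCurve γ a b) (M : Mesh a b) {i j : Fin M.n}
    (hi : (i : ℕ) + 1 = M.n) (hj : (j : ℕ) = 0) : (M.element γ i ∩ M.element γ j).Nonempty := by
  have hper : Function.Periodic γ (b - a) := h.periodic
  have hab : γ b = γ a := by simpa using hper a
  have e1 : i.succ = Fin.last _ := by ext; simpa using hi
  have e2 : j.castSucc = 0 := by ext; simpa using hj
  have e : γ (M.z i.succ) = γ (M.z j.castSucc) := by
    rw [e1, e2, M.z_last, M.z_first, hab]
  exact ⟨γ (M.z i.succ), M.right_mem_element γ i, e ▸ M.left_mem_element γ j⟩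

theorem mem_cell_iff (M : Mesh a b) (j : Fin M.n) (t : ℝ) :
    t ∈ M.cell j ↔ M.zc j ≤ t ∧ t ≤ M.zc (j + 1) := by
  rw [M.zc_castSucc, M.zc_succ]; rfl

/-- Parameters in elements that do not meet are separated by a multiple of the cell length. -/
theorem RatioBound.separation {M : Mesh a b} {κ : ℝ} (hκ : M.RatioBound k κ) {i j : Fin M.n}
    (hij : ¬(M.element γ i ∩ M.element γ j).Nonempty) (hlt : (i : ℕ) < j) {s t : ℝ}
    (hs : s ∈ M.cell i) (ht : t ∈ M.cell j) :
    M.len i / κ ≤ t - s ∧ M.len j / κ ≤ t - s := by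
  have hκ0 : 0 < κ := zero_lt_one.trans_le hκ.one_le
  rw [M.mem_cell_iff] at hs ht
  have hne : (j : ℕ) ≠ i + 1 := fun h => hij (M.elements_meet_of_succ γ h)
  have hj := j.2
  constructor
  · rw [div_le_iff₀ hκ0]
    have h1 : M.zc (i + 1 + 1) ≤ M.zc j := M.zc_mono (by omega)
    have h2 := hκ.len_le_succ (i := i) (by omega)
    have h3 : M.len (i + 1) = M.zc (i + 1 + 1) - M.zc (i + 1) := rfl
    nlinarith
  · rw [div_le_iff₀ hκ0]
    obtain ⟨j', hj'⟩ := Nat.exists_eq_add_of_lt (show 0 < (j : ℕ) by omega)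
    rw [zero_add] at hj'
    have h1 : M.zc (i + 1) ≤ M.zc j' := M.zc_mono (by omega)
    have h2 := hκ.len_succ_le (i := j') (by omega)
    rw [← hj'] at h2
    have h3 : M.len j' = M.zc (j' + 1) - M.zc j' := rfl
    rw [← hj'] at h3
    nlinarith

/-- The same for the way round the closed curve through the end points of the interval. -/
theorem RatioBound.separation_wrap (h : IsParam .closedCurve γ a b) {M : Mesh a b} {κ : ℝ}
    (hκ : M.RatioBound .closedCurve κ) {i j : Fin M.n}
    (hij : ¬(M.element γ i ∩ M.element γ j).Nonempty) {s t : ℝ}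
    (hs : s ∈ M.cell i) (ht : t ∈ M.cell j) :
    M.len i / κ ≤ b - a - (t - s) ∧ M.len j / κ ≤ b - a - (t - s) := by
  have hκ0 : 0 < κ := zero_lt_one.trans_le hκ.one_le
  have hsI := M.cell_subset i hs
  have htI := M.cell_subset j ht
  rw [M.mem_cell_iff] at hs ht
  have hj := j.2
  have wrap : ∀ i j : Fin M.n, (i : ℕ) + 1 = M.n → (j : ℕ) = 0 →
      M.len i ≤ κ * M.len j ∧ M.len j ≤ κ * M.len i := by
    intro i j hi hj
    rw [M.len_eq, M.len_eq]
    exact hκ.wrap i j (by ext; simpa using hi) (by ext; simpa using hj)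
  have hne : ¬((i : ℕ) = 0 ∧ (j : ℕ) + 1 = M.n) := fun h' => by
    obtain ⟨x, hx⟩ := elements_meet_of_wrap h M h'.2 h'.1
    exact hij ⟨x, hx.2, hx.1⟩
  constructor
  · rw [div_le_iff₀ hκ0]
    rcases Nat.eq_zero_or_pos (i : ℕ) with h0 | h0
    · -- the first cell: compare with the last one, which lies to the right of `t`
      set l : Fin M.n := ⟨M.n - 1, by omega⟩ with hl
      have h1 : M.zc (j + 1) ≤ M.zc l := M.zc_mono (by simp only [hl]; omega)
      have h2 : M.zc (l + 1) = b := M.zc_of_le (by simp only [hl]; omega)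
      have h3 := (wrap l i (by simp only [hl]; omega) h0).2
      have h4 : M.len l = M.zc (l + 1) - M.zc l := rfl
      nlinarith [hsI.1]
    · obtain ⟨i', hi'⟩ := Nat.exists_eq_add_of_lt h0
      rw [zero_add] at hi'
      have h2 := hκ.len_succ_le (i := i') (by omega)
      rw [← hi'] at h2
      have h3 : M.len i' = M.zc (i' + 1) - M.zc i' := rfl
      rw [← hi'] at h3
      have h4 : a ≤ M.zc i' := M.le_z _
      nlinarith [htI.2]
  · rw [div_le_iff₀ hκ0]
    by_cases h0 : (j : ℕ) + 1 = M.n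
    · set l : Fin M.n := ⟨0, by omega⟩ with hl
      have h1 : M.zc (l + 1) ≤ M.zc i := M.zc_mono (by simp only [hl]; omega)
      have h2 : M.zc l = a := M.zc_zero
      have h3 := (wrap j l h0 rfl).1
      have h4 : M.len l = M.zc (l + 1) - M.zc l := rfl
      nlinarith [htI.2]
    · have h2 := hκ.len_le_succ (i := j) (by omega)
      have h3 : M.len (j + 1) = M.zc (j + 1 + 1) - M.zc (j + 1) := rfl
      have h4 : M.zc (j + 1 + 1) ≤ b := M.z_le _
      nlinarith [hsI.1]

end Mesh

/-- For elements that do not meet, the singular kernel is bounded by the periodic Cauchy kernel. -/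
theorem exists_far_bound (h : IsParam k γ a b) :
    ∃ C > 0, ∀ (κ : ℝ) (M : Mesh a b), M.RatioBound k κ → ∀ i j : Fin M.n,
      ¬(M.element γ i ∩ M.element γ j).Nonempty → ∀ s ∈ M.cell i, ∀ t ∈ M.cell j,
        1 / ‖γ s - γ t‖ ^ 2 ≤ C * periodicKernel (M.len i / κ) (b - a) s t := by
  have aux : ∀ {c δ x d : ℝ}, 0 < c → 0 < δ → δ ≤ |x| → c * |x| ≤ d →
      1 / d ^ 2 ≤ 1 / c ^ 2 * cauchyKernel δ x := by
    intro c δ x d hc hδ hx hd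
    have hx0 : 0 < |x| := hδ.trans_le hx
    calc 1 / d ^ 2 ≤ 1 / (c * |x|) ^ 2 := by gcongr
      _ = 1 / c ^ 2 * (1 / x ^ 2) := by rw [mul_pow, sq_abs]; field_simp
      _ ≤ _ := by gcongr; exact one_div_sq_le_cauchyKernel hδ hx
  have hsep : ∀ (κ : ℝ) (M : Mesh a b), M.RatioBound k κ → ∀ i j : Fin M.n,
      ¬(M.element γ i ∩ M.element γ j).Nonempty → ∀ s ∈ M.cell i, ∀ t ∈ M.cell j,
      M.len i / κ ≤ |t - s| := by
    intro κ M hκ i j hij s hs t ht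
    rcases lt_trichotomy (i : ℕ) j with hlt | heq | hgt
    · exact (hκ.separation hij hlt hs ht).1.trans (le_abs_self _)
    · obtain rfl := Fin.ext heq
      exact absurd ⟨_, M.left_mem_element γ i, M.left_mem_element γ i⟩ hij
    · have hji : ¬(M.element γ j ∩ M.element γ i).Nonempty := by rwa [inter_comm]
      rw [abs_sub_comm]
      exact (hκ.separation hji hgt ht hs).2.trans (le_abs_self _)
  cases k with
  | openArc =>
    obtain ⟨c, hc, H⟩ := h.chord_arc_open
    refine ⟨1 / c ^ 2, by positivity, fun κ M hκ i j hij s hs t ht => ?_⟩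
    have hδ : 0 < M.len i / κ := div_pos (M.len_pos i.2) (zero_lt_one.trans_le hκ.one_le)
    have h1 := H s (M.cell_subset i hs) t (M.cell_subset j ht)
    rw [abs_sub_comm] at h1
    refine (aux hc hδ (hsep κ M hκ i j hij s hs t ht) h1).trans ?_
    gcongr
    unfold periodicKernel
    linarith [cauchyKernel_nonneg (M.len i / κ) (t - s - (b - a)),
      cauchyKernel_nonneg (M.len i / κ) (t - s + (b - a))]
  | closedCurve =>
    obtain ⟨c, hc, H⟩ := h.chord_arc_closed
    refine ⟨1 / c ^ 2, by positivity, fun κ M hκ i j hij s hs t ht => ?_⟩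
    have hδ : 0 < M.len i / κ := div_pos (M.len_pos i.2) (zero_lt_one.trans_le hκ.one_le)
    have h1 := H s (M.cell_subset i hs) t (M.cell_subset j ht)
    rw [abs_sub_comm] at h1
    have hd := hsep κ M hκ i j hij s hs t ht
    have n0 := cauchyKernel_nonneg (M.len i / κ) (t - s)
    have n1 := cauchyKernel_nonneg (M.len i / κ) (t - s - (b - a))
    have n2 := cauchyKernel_nonneg (M.len i / κ) (t - s + (b - a))
    rcases le_total |t - s| (b - a - |t - s|) with hle | hle
    · rw [min_eq_left hle] at h1
      refine (aux hc hδ hd h1).trans ?_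
      gcongr
      unfold periodicKernel; linarith
    · rw [min_eq_right hle] at h1
      rcases lt_trichotomy (i : ℕ) j with hlt | heq | hgt
      · have h2 := (hκ.separation_wrap h hij hs ht).1
        have h3 := (hκ.separation hij hlt hs ht).1
        rw [abs_of_nonneg (by linarith)] at h1
        have e : |t - s - (b - a)| = b - a - (t - s) := by
          rw [abs_of_nonpos (by linarith)]; ring
        refine (aux hc hδ (x := t - s - (b - a)) (by rw [e]; exact h2)
          (by rw [e]; exact h1)).trans ?_
        gcongr
        unfold periodicKernel; linarith
      · obtain rfl := Fin.ext heq
        exact absurd ⟨_, M.left_mem_element γ i, M.left_mem_element γ i⟩ hij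
      · have hji : ¬(M.element γ j ∩ M.element γ i).Nonempty := by rwa [inter_comm]
        have h2 := (hκ.separation_wrap h hji ht hs).2
        have h3 := (hκ.separation hji hgt ht hs).2
        rw [abs_of_nonpos (by linarith)] at h1
        have e : |t - s + (b - a)| = b - a - (s - t) := by
          rw [abs_of_nonneg (by linarith)]; ring
        refine (aux hc hδ (x := t - s + (b - a)) (by rw [e]; exact h2)
          (by rw [e]; convert h1 using 2; ring)).trans ?_
        gcongr
        unfold periodicKernel; linarith

end Separation

/-! ### Nodes and elements -/

section Nodes

variable {k : BdryType} {γ : ℝ → Plane} {a b : ℝ}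

theorem Mesh.eq_castSucc_or_succ_of_z_mem_cell (M : Mesh a b) {i : Fin (M.n + 1)} {j : Fin M.n}
    (h : M.z i ∈ M.cell j) : i = j.castSucc ∨ i = j.succ := by
  have h1 := M.strictMono.le_iff_le.1 h.1
  have h2 := M.strictMono.le_iff_le.1 h.2
  rw [Fin.le_def] at h1 h2
  simp only [Fin.val_castSucc, Fin.val_succ] at h1 h2
  rcases (show (i : ℕ) = j ∨ (i : ℕ) = j + 1 by omega) with h | h
  · left; ext; simpa using h
  · right; ext; simpa using h

theorem Mesh.succ_mem_nodeIdx (k : BdryType) (M : Mesh a b) (j : Fin M.n) :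
    j.succ ∈ M.nodeIdx k := by
  cases k <;> simp [Mesh.nodeIdx, Fin.succ_ne_zero]

/-- Elements that meet share a node. -/
theorem Mesh.exists_common_node (h : IsParam k γ a b) (M : Mesh a b) {i j : Fin M.n}
    (hij : (M.element γ i ∩ M.element γ j).Nonempty) :
    ∃ l ∈ M.nodeIdx k, γ (M.z l) ∈ M.element γ i ∧ γ (M.z l) ∈ M.element γ j := by
  obtain ⟨x, ⟨s, hs, rfl⟩, t, ht, hst⟩ := hij
  by_cases heq : i = j
  · subst heq
    exact ⟨_, M.succ_mem_nodeIdx k i, M.right_mem_element γ i, M.right_mem_element γ i⟩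
  have same : s = t → ∃ l ∈ M.nodeIdx k, γ (M.z l) ∈ M.element γ i ∧ γ (M.z l) ∈ M.element γ j := by
    rintro rfl
    have key : ∀ i j : Fin M.n, i < j → s ∈ M.cell i → s ∈ M.cell j → s = M.z i.succ := by
      intro i j hlt hsi hsj
      refine le_antisymm hsi.2 (le_trans (M.strictMono.monotone ?_) hsj.1)
      rw [Fin.le_def]; simpa using hlt
    rcases lt_or_gt_of_ne heq with hlt | hgt
    · refine ⟨i.succ, M.succ_mem_nodeIdx k i, ?_⟩
      rw [← key i j hlt hs ht]
      exact ⟨⟨s, hs, rfl⟩, ⟨s, ht, rfl⟩⟩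
    · refine ⟨j.succ, M.succ_mem_nodeIdx k j, ?_⟩
      rw [← key j i hgt ht hs]
      exact ⟨⟨s, hs, rfl⟩, ⟨s, ht, rfl⟩⟩
  cases k with
  | openArc => exact same (h.injOn (M.cell_subset i hs) (M.cell_subset j ht) hst.symm)
  | closedCurve =>
    have hper : Function.Periodic γ (b - a) := h.periodic
    have hab : γ b = γ a := by simpa using hper a
    have hlast : Fin.last M.n ∈ M.nodeIdx .closedCurve := by
      have : Fin.last M.n ≠ 0 := by
        intro h0
        have := i.pos
        rw [Fin.ext_iff] at h0
        simp at h0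
        omega
      simp [Mesh.nodeIdx, this]
    rcases h.eq_or_of_image_eq_closed (M.cell_subset i hs) (M.cell_subset j ht) hst.symm with
      h1 | ⟨h1, h2⟩ | ⟨h1, h2⟩
    · exact same h1
    · refine ⟨Fin.last _, hlast, ?_⟩
      rw [M.z_last]
      exact ⟨⟨s, hs, by rw [h1, hab]⟩, ⟨t, ht, by rw [h2]⟩⟩
    · refine ⟨Fin.last _, hlast, ?_⟩
      rw [M.z_last]
      exact ⟨⟨s, hs, by rw [h1]⟩, ⟨t, ht, by rw [h2, hab]⟩⟩

open Classical in
/-- An element contains at most two nodes. -/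
theorem Mesh.card_nodes_le_two (h : IsParam k γ a b) (M : Mesh a b) (j : Fin M.n) :
    ((M.nodeIdx k).filter fun i => γ (M.z i) ∈ M.element γ j).card ≤ 2 := by
  have key : ∃ i₀, ((M.nodeIdx k).filter fun i => γ (M.z i) ∈ M.element γ j) ⊆ {i₀, j.succ} := by
    cases k with
    | openArc =>
      refine ⟨j.castSucc, fun i hi => ?_⟩
      obtain ⟨-, t, ht, hti⟩ := Finset.mem_filter.1 hi
      have : t = M.z i := h.injOn (M.cell_subset j ht) ⟨M.le_z i, M.z_le i⟩ hti
      rw [this] at ht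
      simpa using M.eq_castSucc_or_succ_of_z_mem_cell ht
    | closedCurve =>
      -- The parameter `a` belongs to the same node as `b`.
      refine ⟨if j.castSucc = 0 then Fin.last _ else j.castSucc, fun i hi => ?_⟩
      obtain ⟨hi0, t, ht, hti⟩ := Finset.mem_filter.1 hi
      have hi0 : i ≠ 0 := by simpa [Mesh.nodeIdx] using hi0
      rw [Finset.mem_insert, Finset.mem_singleton]
      rcases h.eq_or_of_image_eq_closed (M.cell_subset j ht) ⟨M.le_z i, M.z_le i⟩ hti with
        h1 | ⟨h1, h2⟩ | ⟨h1, h2⟩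
      · rw [h1] at ht
        rcases M.eq_castSucc_or_succ_of_z_mem_cell ht with h2 | h2
        · left; rw [if_neg (h2 ▸ hi0)]; exact h2
        · right; exact h2
      · left
        have hi' : i = Fin.last _ := M.strictMono.injective (h2.trans M.z_last.symm)
        have hj' : j.castSucc = 0 := by
          have h3 : M.z j.castSucc ≤ M.z 0 := ht.1.trans (h1.trans M.z_first.symm).le
          exact Fin.le_zero_iff.1 (M.strictMono.le_iff_le.1 h3)
        rw [if_pos hj', hi']
      · exact absurd (M.strictMono.injective (h2.trans M.z_first.symm)) hi0
  obtain ⟨i₀, hi₀⟩ := key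
  exact (Finset.card_le_card hi₀).trans Finset.card_le_two

end Nodes

/-! ### Functions of `H^{1/2}` in the parameter interval -/

theorem setIntegral_comp_of_measurePreserving {α β : Type*} [MeasurableSpace α]
    [MeasurableSpace β] {μ : Measure α} {ν : Measure β} {T : α → β} (h : MeasurePreserving T μ ν)
    {F : β → ℝ} (hF : AEStronglyMeasurable F ν) {s : Set β} (hs : MeasurableSet s) :
    ∫ y in s, F y ∂ν = ∫ x in T ⁻¹' s, F (T x) ∂μ := by
  obtain rfl := h.map_eq
  exact setIntegral_map hs hF h.measurable.aemeasurable

theorem integral_comp_of_measurePreserving {α β : Type*} [MeasurableSpace α]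
    [MeasurableSpace β] {μ : Measure α} {ν : Measure β} {T : α → β} (h : MeasurePreserving T μ ν)
    {F : β → ℝ} (hF : AEStronglyMeasurable F ν) : ∫ y, F y ∂ν = ∫ x, F (T x) ∂μ := by
  obtain rfl := h.map_eq
  exact integral_map h.measurable.aemeasurable hF

section Pullback

variable {k : BdryType} {γ g : ℝ → Plane} {a b c₀ C₀ : ℝ}

/-- A function of `H^{1/2}`, pulled back to the parameter interval along `g`. -/
noncomputable def pullback (g : ℝ → Plane) (r : HHalf (arcMeasure γ a b)) (t : ℝ) : ℝ :=
  HHalf.toL2 (arcMeasure γ a b) r (g t)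

/-- The energy density of the Sobolev-Slobodeckij seminorm, pulled back to the parameter square. -/
noncomputable def energy (g : ℝ → Plane) (r : HHalf (arcMeasure γ a b)) (P : ℝ × ℝ) : ℝ :=
  (WithLp.snd (r : WithLp 2 (Lp ℝ 2 (arcMeasure γ a b) ×
    Lp ℝ 2 ((arcMeasure γ a b).prod (arcMeasure γ a b)))) (g P.1, g P.2)) ^ 2

theorem energy_nonneg (r : HHalf (arcMeasure γ a b)) (P : ℝ × ℝ) : 0 ≤ energy g r P := sq_nonneg _

section

variable (hν : ComparableMeasure (paramMeasure γ a b) a b c₀ C₀) (hg : Continuous g)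
  (hgγ : EqOn g γ (Icc a b)) (r : HHalf (arcMeasure γ a b))

theorem measurePreserving_prodMap (hν : ComparableMeasure (paramMeasure γ a b) a b c₀ C₀)
    (hg : Continuous g) (hgγ : EqOn g γ (Icc a b)) :
    MeasurePreserving (Prod.map g g) ((paramMeasure γ a b).prod (paramMeasure γ a b))
      ((arcMeasure γ a b).prod (arcMeasure γ a b)) := by
  have := hν.isFiniteMeasure
  have h := IsParam.measurePreserving hν hg hgγ
  exact h.prod h

include hν hg hgγ

theorem memLp_pullback : MemLp (pullback g r) 2 (paramMeasure γ a b) :=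
  (Lp.memLp (HHalf.toL2 (arcMeasure γ a b) r)).comp_measurePreserving
    (IsParam.measurePreserving hν hg hgγ)

theorem integrable_energy :
    Integrable (energy g r) ((paramMeasure γ a b).prod (paramMeasure γ a b)) :=
  ((Lp.memLp (WithLp.snd (r : WithLp 2 (Lp ℝ 2 (arcMeasure γ a b) ×
    Lp ℝ 2 ((arcMeasure γ a b).prod (arcMeasure γ a b)))))).comp_measurePreserving
      (measurePreserving_prodMap hν hg hgγ)).integrable_sq

theorem energy_ae_eq :
    ∀ᵐ P ∂((paramMeasure γ a b).prod (paramMeasure γ a b)),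
      energy g r P = (pullback g r P.1 - pullback g r P.2) ^ 2 / ‖g P.1 - g P.2‖ ^ 2 := by
  have hr := r.2
  have h := (measurePreserving_prodMap hν hg hgγ).quasiMeasurePreserving.ae hr
  filter_upwards [h] with P hP
  have e : energy g r P = ((pullback g r P.1 - pullback g r P.2) / ‖g P.1 - g P.2‖) ^ 2 :=
    congrArg (· ^ 2) hP
  rw [e, div_pow]

theorem seminormSq_eq {ω : Set Plane} (hω : MeasurableSet ω) :
    seminormSq (arcMeasure γ a b) ω (HHalf.toL2 (arcMeasure γ a b) r) =
      ∫ P in (g ⁻¹' ω) ×ˢ (g ⁻¹' ω), energy g r P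
        ∂((paramMeasure γ a b).prod (paramMeasure γ a b)) := by
  have hmp := measurePreserving_prodMap hν hg hgγ
  set G := WithLp.snd (r : WithLp 2 (Lp ℝ 2 (arcMeasure γ a b) ×
    Lp ℝ 2 ((arcMeasure γ a b).prod (arcMeasure γ a b)))) with hG
  have e1 : seminormSq (arcMeasure γ a b) ω (HHalf.toL2 (arcMeasure γ a b) r) =
      ∫ P in ω ×ˢ ω, G P ^ 2 ∂((arcMeasure γ a b).prod (arcMeasure γ a b)) := by
    refine integral_congr_ae (ae_restrict_of_ae ?_)
    have hr := r.2
    filter_upwards [hr] with P hP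
    have e : G P = ((HHalf.toL2 (arcMeasure γ a b) r) P.1 -
        (HHalf.toL2 (arcMeasure γ a b) r) P.2) / ‖P.1 - P.2‖ := hP
    rw [e, div_pow]
  rw [e1]
  exact setIntegral_comp_of_measurePreserving hmp (F := fun P => G P ^ 2)
    ((Lp.aestronglyMeasurable G).pow 2) (hω.prod hω)

theorem norm_sq_eq :
    ‖r‖ ^ 2 = ∫ t, pullback g r t ^ 2 ∂(paramMeasure γ a b) +
      ∫ P, energy g r P ∂((paramMeasure γ a b).prod (paramMeasure γ a b)) := by
  have hmp1 := IsParam.measurePreserving hν hg hgγ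
  have hmp := measurePreserving_prodMap hν hg hgγ
  have key : ∀ {α : Type} [MeasurableSpace α] (μ : Measure α) (f : Lp ℝ 2 μ),
      ‖f‖ ^ 2 = ∫ x, f x ^ 2 ∂μ := by
    intro α _ μ f
    rw [← real_inner_self_eq_norm_sq, L2.inner_def]
    refine integral_congr_ae (ae_of_all _ fun x => ?_)
    simp [sq]
  set U := (r : WithLp 2 (Lp ℝ 2 (arcMeasure γ a b) ×
    Lp ℝ 2 ((arcMeasure γ a b).prod (arcMeasure γ a b)))) with hU
  have e : ‖r‖ ^ 2 = ‖U.fst‖ ^ 2 + ‖U.snd‖ ^ 2 := WithLp.prod_norm_sq_eq_of_L2 U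
  rw [e, key, key]
  congr 1
  · exact integral_comp_of_measurePreserving hmp1 (F := fun x => U.fst x ^ 2)
      ((Lp.aestronglyMeasurable _).pow 2)
  · exact integral_comp_of_measurePreserving hmp (F := fun P => U.snd P ^ 2)
      ((Lp.aestronglyMeasurable _).pow 2)

theorem sq_sub_ae_eq (h : IsParam k γ a b) :
    ∀ᵐ P ∂((paramMeasure γ a b).prod (paramMeasure γ a b)),
      (pullback g r P.1 - pullback g r P.2) ^ 2 = energy g r P * ‖g P.1 - g P.2‖ ^ 2 := by
  have := hν.isFiniteMeasure
  have h1 := Measure.quasiMeasurePreserving_fst (μ := paramMeasure γ a b)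
    (ν := paramMeasure γ a b) |>.ae hν.ae_mem_Ioo
  have h2 := Measure.quasiMeasurePreserving_snd (μ := paramMeasure γ a b)
    (ν := paramMeasure γ a b) |>.ae hν.ae_mem_Ioo
  filter_upwards [energy_ae_eq hν hg hgγ r, h1, h2] with P hP h1 h2
  rw [hP]
  by_cases hd : ‖g P.1 - g P.2‖ = 0
  · -- the curve is injective, so that this happens on the diagonal only
    have e : g P.1 = g P.2 := by simpa [sub_eq_zero] using hd
    rw [hgγ (Ioo_subset_Icc_self h1), hgγ (Ioo_subset_Icc_self h2)] at e
    rw [h.eq_of_image_eq h1 (Ioo_subset_Icc_self h2) e]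
    simp
  · field_simp

/-- Squared differences are bounded by the energy, as the distance on the curve is at most `L ℓ`. -/
theorem setIntegral_sq_sub_le (h : IsParam k γ a b) {L ℓ : ℝ}
    (hL : ∀ s ∈ Icc a b, ∀ t ∈ Icc a b, ‖γ s - γ t‖ ≤ L * |s - t|) {A B : Set ℝ}
    (hAm : MeasurableSet A) (hBm : MeasurableSet B)
    (hA : A ⊆ Icc a b) (hB : B ⊆ Icc a b) (hAB : ∀ s ∈ A, ∀ t ∈ B, |s - t| ≤ ℓ) (hL0 : 0 ≤ L) :
    ∫ P in A ×ˢ B, (pullback g r P.1 - pullback g r P.2) ^ 2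
        ∂((paramMeasure γ a b).prod (paramMeasure γ a b)) ≤
      L ^ 2 * ℓ ^ 2 *
        ∫ P in A ×ˢ B, energy g r P ∂((paramMeasure γ a b).prod (paramMeasure γ a b)) := by
  rw [← integral_const_mul]
  refine integral_mono_of_nonneg (ae_of_all _ fun P => sq_nonneg _)
    ((integrable_energy hν hg hgγ r).integrableOn.const_mul _) ?_
  filter_upwards [ae_restrict_of_ae (sq_sub_ae_eq hν hg hgγ r h),
    ae_restrict_mem (hAm.prod hBm)] with P hP hPm
  rw [hP, mul_comm, ← mul_pow]
  refine mul_le_mul_of_nonneg_right ?_ (energy_nonneg r P)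
  have h1 := hL _ (hA hPm.1) _ (hB hPm.2)
  rw [← hgγ (hA hPm.1), ← hgγ (hB hPm.2)] at h1
  have h2 := hAB _ hPm.1 _ hPm.2
  gcongr
  exact h1.trans (mul_le_mul_of_nonneg_left h2 hL0)

end

end Pullback

/-! ### Decomposition into pairs of cells -/

section Pairs

variable {k : BdryType} {γ g : ℝ → Plane} {a b c₀ C₀ : ℝ} {M : Mesh a b} {ν : Measure ℝ}

theorem Mesh.pairwise_disjoint_hcell (M : Mesh a b) {i j : ℕ} (hij : i ≠ j) :
    Disjoint (M.hcell i) (M.hcell j) := by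
  rw [Set.disjoint_left]
  intro t hi hj
  rcases lt_or_gt_of_ne hij with h | h
  · exact absurd (hi.2.trans (M.zc_mono h)) (not_le.2 hj.1)
  · exact absurd (hj.2.trans (M.zc_mono h)) (not_le.2 hi.1)

theorem Mesh.hcell_subset_cell (M : Mesh a b) (j : Fin M.n) : M.hcell j ⊆ M.cell j := fun t ht =>
  (M.mem_cell_iff j t).2 ⟨ht.1.le, ht.2⟩

theorem Mesh.hcell_subset (M : Mesh a b) (i : ℕ) : M.hcell i ⊆ Icc a b := fun _ ht =>
  ⟨(M.le_z _).trans ht.1.le, ht.2.trans (M.z_le _)⟩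

theorem ComparableMeasure.ae_generic (hν : ComparableMeasure ν a b c₀ C₀) (M : Mesh a b) :
    ∀ᵐ t ∂ν, t ∈ Ioo a b ∧ ∀ i, t ≠ M.z i := by
  have := hν.nullSingletonClass
  refine hν.ae_mem_Ioo.and (ae_all_iff.2 fun i => ?_)
  rw [ae_iff]
  simp

theorem Mesh.mem_cell_iff_mem_hcell (M : Mesh a b) {t : ℝ} (ht : ∀ i, t ≠ M.z i) (j : Fin M.n) :
    t ∈ M.cell j ↔ t ∈ M.hcell j := by
  refine ⟨fun h => ?_, fun h => M.hcell_subset_cell j h⟩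
  rw [M.mem_cell_iff] at h
  exact ⟨lt_of_le_of_ne h.1 (by rw [M.zc_castSucc]; exact (ht _).symm), h.2⟩

/-- Integrals over unions of products of cells. -/
theorem setIntegral_biUnion_pairs {f : ℝ × ℝ → ℝ} (hf : Integrable f (ν.prod ν))
    (T : Finset (Fin M.n × Fin M.n)) :
    ∫ P in ⋃ x ∈ T, M.hcell x.1 ×ˢ M.hcell x.2, f P ∂(ν.prod ν) =
      ∑ x ∈ T, ∫ P in M.hcell x.1 ×ˢ M.hcell x.2, f P ∂(ν.prod ν) := by
  refine integral_biUnion_finset T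
    (fun x _ => (M.measurableSet_hcell _).prod (M.measurableSet_hcell _)) ?_
    fun x _ => hf.integrableOn
  rintro ⟨x1, x2⟩ - ⟨y1, y2⟩ - hxy
  refine Set.disjoint_prod.2 ?_
  by_cases h1 : x1 = y1
  · right
    refine M.pairwise_disjoint_hcell fun h2 => hxy ?_
    exact Prod.ext h1 (Fin.ext h2)
  · left
    exact M.pairwise_disjoint_hcell fun h2 => h1 (Fin.ext h2)

theorem biUnion_hcell_prod (M : Mesh a b) (S : Finset (Fin M.n)) :
    (⋃ j ∈ S, M.hcell j) ×ˢ (⋃ j ∈ S, M.hcell j) =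
      ⋃ x ∈ S ×ˢ S, M.hcell x.1 ×ˢ M.hcell x.2 := by
  ext ⟨s, t⟩
  simp only [mem_prod, mem_iUnion, Finset.mem_product, exists_prop, Prod.exists]
  constructor
  · rintro ⟨⟨i, hi, hs⟩, j, hj, ht⟩
    exact ⟨i, j, ⟨hi, hj⟩, hs, ht⟩
  · rintro ⟨i, j, ⟨hi, hj⟩, hs, ht⟩
    exact ⟨⟨i, hi, hs⟩, j, hj, ht⟩

theorem biUnion_hcell_ae_eq_univ (hν : ComparableMeasure ν a b c₀ C₀) (M : Mesh a b) :
    (⋃ j ∈ (Finset.univ : Finset (Fin M.n)), M.hcell j : Set ℝ) =ᵐ[ν] univ := by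
  filter_upwards [hν.ae_generic M] with t ht
  obtain ⟨j, hj⟩ := M.exists_mem_Ico (Ioo_subset_Ico_self ht.1)
  have : t ∈ M.hcell j := (M.mem_cell_iff_mem_hcell ht.2 j).1 (Ico_subset_Icc_self hj)
  refine propext ⟨fun _ => trivial, fun _ => ?_⟩
  exact mem_biUnion (Finset.mem_univ j) this

theorem integral_eq_sum_pairs (hν : ComparableMeasure ν a b c₀ C₀) (M : Mesh a b)
    {f : ℝ × ℝ → ℝ} (hf : Integrable f (ν.prod ν)) :
    ∫ P, f P ∂(ν.prod ν) =
      ∑ x : Fin M.n × Fin M.n, ∫ P in M.hcell x.1 ×ˢ M.hcell x.2, f P ∂(ν.prod ν) := by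
  have := hν.isFiniteMeasure
  have h := biUnion_hcell_ae_eq_univ hν M
  have h2 := Measure.set_prod_ae_eq h h
  rw [biUnion_hcell_prod, univ_prod_univ] at h2
  rw [← setIntegral_univ, ← setIntegral_congr_set h2, setIntegral_biUnion_pairs hf,
    Finset.univ_product_univ]

open Classical in
/-- The cells whose elements contain a given node. -/
noncomputable def Mesh.nodeCells (M : Mesh a b) (γ : ℝ → Plane) (i : Fin (M.n + 1)) :
    Finset (Fin M.n) :=
  Finset.univ.filter fun j => γ (M.z i) ∈ M.element γ j

theorem Mesh.mem_nodeCells {i : Fin (M.n + 1)} {j : Fin M.n} :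
    j ∈ M.nodeCells γ i ↔ γ (M.z i) ∈ M.element γ j := by
  simp [Mesh.nodeCells]

theorem preimage_nodePatch_ae_eq (h : IsParam k γ a b)
    (hν : ComparableMeasure ν a b c₀ C₀) (hgγ : EqOn g γ (Icc a b)) (i : Fin (M.n + 1)) :
    g ⁻¹' M.nodePatch γ i =ᵐ[ν] (⋃ j ∈ M.nodeCells γ i, M.hcell j : Set ℝ) := by
  filter_upwards [hν.ae_generic M] with t ht
  refine propext ?_
  change g t ∈ M.nodePatch γ i ↔ t ∈ (⋃ j ∈ M.nodeCells γ i, M.hcell j : Set ℝ)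
  rw [hgγ (Ioo_subset_Icc_self ht.1)]
  simp only [Mesh.nodePatch, mem_iUnion, exists_prop, Mesh.mem_nodeCells]
  refine exists_congr fun j => and_congr_right fun _ => ?_
  rw [← M.mem_cell_iff_mem_hcell ht.2]
  constructor
  · rintro ⟨s, hs, hst⟩
    rwa [h.eq_of_image_eq ht.1 (M.cell_subset j hs) hst.symm]
  · exact fun h => ⟨t, h, rfl⟩

theorem measurableSet_nodePatch (h : IsParam k γ a b) (M : Mesh a b) (i : Fin (M.n + 1)) :
    MeasurableSet (M.nodePatch γ i) := by
  refine MeasurableSet.biUnion (Set.to_countable _) fun j _ => ?_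
  exact (isCompact_Icc.image_of_continuousOn
    (h.continuousOn.mono (M.cell_subset j))).isClosed.measurableSet

theorem seminormSq_nodePatch (h : IsParam k γ a b)
    (hν : ComparableMeasure (paramMeasure γ a b) a b c₀ C₀) (hg : Continuous g)
    (hgγ : EqOn g γ (Icc a b)) (r : HHalf (arcMeasure γ a b)) (i : Fin (M.n + 1)) :
    seminormSq (arcMeasure γ a b) (M.nodePatch γ i) (HHalf.toL2 (arcMeasure γ a b) r) =
      ∑ x ∈ M.nodeCells γ i ×ˢ M.nodeCells γ i, ∫ P in M.hcell x.1 ×ˢ M.hcell x.2, energy g r P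
        ∂((paramMeasure γ a b).prod (paramMeasure γ a b)) := by
  have := hν.isFiniteMeasure
  have h1 := preimage_nodePatch_ae_eq h hν hgγ i
  rw [seminormSq_eq hν hg hgγ r (measurableSet_nodePatch h M i),
    setIntegral_congr_set (Measure.set_prod_ae_eq h1 h1), biUnion_hcell_prod,
    setIntegral_biUnion_pairs (integrable_energy hν hg hgγ r)]

open Classical in
/-- In the sum over all nodes, each pair of cells is counted as often as it shares a node. -/
theorem sum_seminormSq_nodePatch (h : IsParam k γ a b)
    (hν : ComparableMeasure (paramMeasure γ a b) a b c₀ C₀) (hg : Continuous g)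
    (hgγ : EqOn g γ (Icc a b)) (r : HHalf (arcMeasure γ a b)) (M : Mesh a b) :
    ∑ i ∈ M.nodeIdx k,
        seminormSq (arcMeasure γ a b) (M.nodePatch γ i) (HHalf.toL2 (arcMeasure γ a b) r) =
      ∑ x : Fin M.n × Fin M.n,
        (((M.nodeIdx k).filter fun i => x.1 ∈ M.nodeCells γ i ∧ x.2 ∈ M.nodeCells γ i).card : ℝ) *
          ∫ P in M.hcell x.1 ×ˢ M.hcell x.2, energy g r P
            ∂((paramMeasure γ a b).prod (paramMeasure γ a b)) := by
  have e : ∀ i, seminormSq (arcMeasure γ a b) (M.nodePatch γ i)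
      (HHalf.toL2 (arcMeasure γ a b) r) =
      ∑ x : Fin M.n × Fin M.n, if x.1 ∈ M.nodeCells γ i ∧ x.2 ∈ M.nodeCells γ i then
        ∫ P in M.hcell x.1 ×ˢ M.hcell x.2, energy g r P
          ∂((paramMeasure γ a b).prod (paramMeasure γ a b)) else 0 := by
    intro i
    rw [seminormSq_nodePatch h hν hg hgγ, ← Finset.sum_filter]
    refine Finset.sum_congr ?_ fun _ _ => rfl
    ext x; simp
  simp only [e]
  rw [Finset.sum_comm]
  refine Finset.sum_congr rfl fun x _ => ?_
  rw [← Finset.sum_filter, Finset.sum_const, nsmul_eq_mul]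

theorem setIntegral_energy_nonneg (r : HHalf (arcMeasure γ a b)) (A : Set (ℝ × ℝ)) :
    0 ≤ ∫ P in A, energy g r P ∂((paramMeasure γ a b).prod (paramMeasure γ a b)) :=
  integral_nonneg fun P => energy_nonneg r P

/-- The estimator is bounded by the norm, since every element contains at most two nodes. -/
theorem sum_seminormSq_le_norm (h : IsParam k γ a b)
    (M : Mesh a b) (r : HHalf (arcMeasure γ a b)) :
    ∑ i ∈ M.nodeIdx k,
        seminormSq (arcMeasure γ a b) (M.nodePatch γ i) (HHalf.toL2 (arcMeasure γ a b) r) ≤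
      2 * ‖r‖ ^ 2 := by
  classical
  obtain ⟨c₀, C₀, hc₀, hC₀, hb⟩ := h.exists_speed_bounds
  have hν := comparableMeasure_paramMeasure hc₀ hC₀ hb
  obtain ⟨g, hg, hgγ⟩ := h.exists_continuous_extension
  rw [sum_seminormSq_nodePatch h hν hg hgγ, norm_sq_eq hν hg hgγ,
    integral_eq_sum_pairs hν M (integrable_energy hν hg hgγ r)]
  have h1 : 0 ≤ ∫ t, pullback g r t ^ 2 ∂(paramMeasure γ a b) :=
    integral_nonneg fun t => sq_nonneg _
  refine le_trans ?_ (mul_le_mul_of_nonneg_left (le_add_of_nonneg_left h1) zero_le_two)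
  rw [Finset.mul_sum]
  refine Finset.sum_le_sum fun x _ => ?_
  refine mul_le_mul_of_nonneg_right ?_ (setIntegral_energy_nonneg r _)
  have h2 : ((M.nodeIdx k).filter fun i => x.1 ∈ M.nodeCells γ i ∧ x.2 ∈ M.nodeCells γ i).card ≤
      2 := by
    refine (Finset.card_le_card fun i hi => ?_).trans (M.card_nodes_le_two h x.1)
    rw [Finset.mem_filter] at hi ⊢
    exact ⟨hi.1, Mesh.mem_nodeCells.1 hi.2.1⟩
  exact_mod_cast h2

end Pairs

/-! ### Reliability -/

section Reliability

variable {k : BdryType} {γ g : ℝ → Plane} {a b c₀ C₀ : ℝ} {M : Mesh a b} {ν : Measure ℝ}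

/-- The total energy is bounded by the sum over the node patches, which contains all pairs of cells
whose elements meet, and by weighted `L²`-norms on the cells, which bound the remaining pairs. -/
theorem exists_energy_bound (h : IsParam k γ a b)
    (hν : ComparableMeasure (paramMeasure γ a b) a b c₀ C₀) (hg : Continuous g)
    (hgγ : EqOn g γ (Icc a b)) {κ : ℝ} (hκ1 : 1 ≤ κ) :
    ∃ K : ℝ, 0 < K ∧ ∀ (M : Mesh a b), M.RatioBound k κ → ∀ r : HHalf (arcMeasure γ a b),
      ∫ P, energy g r P ∂((paramMeasure γ a b).prod (paramMeasure γ a b)) ≤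
        ∑ i ∈ M.nodeIdx k,
          seminormSq (arcMeasure γ a b) (M.nodePatch γ i) (HHalf.toL2 (arcMeasure γ a b) r) +
        K * ∑ j : Fin M.n, (∫ t in M.hcell j, pullback g r t ^ 2 ∂(paramMeasure γ a b)) /
          M.len j := by
  classical
  obtain ⟨C, hC, hfar⟩ := exists_far_bound h
  have hκ0 : 0 < κ := zero_lt_one.trans_le hκ1
  have hpi := Real.pi_pos
  have hC₀ := hν.C_pos
  refine ⟨4 * C * (C₀ * (6 * Real.pi * κ)), by positivity, fun M hκ r => ?_⟩
  have := hν.isFiniteMeasure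
  set ν := paramMeasure γ a b with hνdef
  set u := pullback g r with hudef
  have hu : MemLp u 2 ν := memLp_pullback hν hg hgγ r
  set δ : Fin M.n → ℝ := fun j => M.len j / κ with hδ
  have hδ0 : ∀ j, 0 < δ j := fun j => div_pos (M.len_pos j.2) hκ0
  set Q : Fin M.n × Fin M.n → ℝ := fun x =>
    ∫ P in M.hcell x.1 ×ˢ M.hcell x.2, energy g r P ∂(ν.prod ν) with hQ
  have hQ0 : ∀ x, 0 ≤ Q x := fun x => setIntegral_energy_nonneg r _
  set X : Fin M.n × Fin M.n → ℝ := fun x =>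
    ∫ P in M.hcell x.1 ×ˢ M.hcell x.2, u P.1 ^ 2 * periodicKernel (δ x.1) (b - a) P.1 P.2
      ∂(ν.prod ν) with hX
  have hX0 : ∀ x, 0 ≤ X x := fun x => integral_nonneg fun P =>
    mul_nonneg (sq_nonneg _) (periodicKernel_nonneg _ _ _ _)
  -- pairs of cells whose elements do not meet
  have hQX : ∀ x : Fin M.n × Fin M.n, ¬(M.element γ x.1 ∩ M.element γ x.2).Nonempty →
      Q x ≤ 2 * C * X x + 2 * C * X x.swap := by
    intro x hx
    have hx' : ¬(M.element γ x.2 ∩ M.element γ x.1).Nonempty := by rwa [inter_comm]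
    have e2 : X x.swap = ∫ P in M.hcell x.1 ×ˢ M.hcell x.2,
        u P.2 ^ 2 * periodicKernel (δ x.2) (b - a) P.2 P.1 ∂(ν.prod ν) :=
      setIntegral_prod_swap (M.hcell x.1) (M.hcell x.2) (fun P : ℝ × ℝ =>
        u P.2 ^ 2 * periodicKernel (δ x.2) (b - a) P.2 P.1)
    have i1 := integrable_sq_mul_periodicKernel hν hu (δ x.1) (b - a)
    have i2 : Integrable (fun P : ℝ × ℝ =>
        u P.2 ^ 2 * periodicKernel (δ x.2) (b - a) P.2 P.1) (ν.prod ν) :=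
      (integrable_sq_mul_periodicKernel hν hu (δ x.2) (b - a)).swap
    rw [e2]
    simp only [hX]
    rw [← integral_const_mul, ← integral_const_mul,
      ← integral_add (i1.integrableOn.const_mul _) (i2.integrableOn.const_mul _)]
    refine integral_mono_ae (integrable_energy hν hg hgγ r).integrableOn
      ((i1.integrableOn.const_mul _).add (i2.integrableOn.const_mul _)) ?_
    filter_upwards [ae_restrict_of_ae (energy_ae_eq hν hg hgγ r), ae_restrict_mem
      ((M.measurableSet_hcell x.1).prod (M.measurableSet_hcell x.2))] with P hP hPm
    have hs := M.hcell_subset_cell _ hPm.1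
    have ht := M.hcell_subset_cell _ hPm.2
    have f1 := hfar κ M hκ x.1 x.2 hx P.1 hs P.2 ht
    have f2 := hfar κ M hκ x.2 x.1 hx' P.2 ht P.1 hs
    rw [norm_sub_rev] at f2
    rw [hP, hgγ (M.cell_subset _ hs), hgγ (M.cell_subset _ ht)]
    have hsq : (u P.1 - u P.2) ^ 2 ≤ 2 * u P.1 ^ 2 + 2 * u P.2 ^ 2 := by
      nlinarith [sq_nonneg (u P.1 + u P.2)]
    have hn : 0 ≤ 1 / ‖γ P.1 - γ P.2‖ ^ 2 := by positivity
    calc (u P.1 - u P.2) ^ 2 / ‖γ P.1 - γ P.2‖ ^ 2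
        = (u P.1 - u P.2) ^ 2 * (1 / ‖γ P.1 - γ P.2‖ ^ 2) := by rw [mul_one_div]
      _ ≤ (2 * u P.1 ^ 2 + 2 * u P.2 ^ 2) * (1 / ‖γ P.1 - γ P.2‖ ^ 2) := by gcongr
      _ = 2 * u P.1 ^ 2 * (1 / ‖γ P.1 - γ P.2‖ ^ 2) +
            2 * u P.2 ^ 2 * (1 / ‖γ P.1 - γ P.2‖ ^ 2) := by ring
      _ ≤ 2 * u P.1 ^ 2 * (C * periodicKernel (δ x.1) (b - a) P.1 P.2) +
            2 * u P.2 ^ 2 * (C * periodicKernel (δ x.2) (b - a) P.2 P.1) := by gcongr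
      _ = _ := by ring
  -- the kernel sums
  have hXsum : ∀ j : Fin M.n, ∑ l : Fin M.n, X (j, l) ≤
      C₀ * (6 * Real.pi * κ) * ((∫ t in M.hcell j, u t ^ 2 ∂ν) / M.len j) := by
    intro j
    have i1 := integrable_sq_mul_periodicKernel hν hu (δ j) (b - a)
    have e : ∑ l : Fin M.n, X (j, l) =
        ∫ P in ⋃ x ∈ ({j} : Finset (Fin M.n)) ×ˢ (Finset.univ : Finset (Fin M.n)),
        M.hcell x.1 ×ˢ M.hcell x.2, u P.1 ^ 2 * periodicKernel (δ j) (b - a) P.1 P.2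
          ∂(ν.prod ν) := by
      rw [setIntegral_biUnion_pairs i1, Finset.sum_product, Finset.sum_singleton]
    rw [e]
    have hsub : (⋃ x ∈ ({j} : Finset (Fin M.n)) ×ˢ (Finset.univ : Finset (Fin M.n)),
        M.hcell x.1 ×ˢ M.hcell x.2) ⊆ M.hcell j ×ˢ (univ : Set ℝ) := by
      refine iUnion₂_subset fun x hx P hP => ⟨?_, trivial⟩
      have hx1 : x.1 = j := Finset.mem_singleton.1 (Finset.mem_product.1 hx).1
      rw [← hx1]; exact hP.1
    refine (setIntegral_mono_set i1.integrableOn (ae_of_all _ fun P =>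
      mul_nonneg (sq_nonneg _) (periodicKernel_nonneg _ _ _ _)) hsub.eventuallyLE).trans ?_
    refine (setIntegral_sq_mul_periodicKernel_le hν hu (hδ0 j) (b - a) (M.hcell j)).trans
      (le_of_eq ?_)
    have := (M.len_pos j.2).ne'
    simp only [hδ]
    field_simp
  have hXtot : ∑ x : Fin M.n × Fin M.n, X x ≤
      C₀ * (6 * Real.pi * κ) * ∑ j : Fin M.n, (∫ t in M.hcell j, u t ^ 2 ∂ν) / M.len j := by
    rw [Fintype.sum_prod_type, Finset.mul_sum]
    exact Finset.sum_le_sum fun j _ => hXsum j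
  have hXswap : ∑ x : Fin M.n × Fin M.n, X x.swap = ∑ x : Fin M.n × Fin M.n, X x :=
    Fintype.sum_equiv (Equiv.prodComm _ _) _ _ fun x => rfl
  -- all pairs
  rw [integral_eq_sum_pairs hν M (integrable_energy hν hg hgγ r),
    sum_seminormSq_nodePatch h hν hg hgγ]
  have hall : ∀ x : Fin M.n × Fin M.n, Q x ≤
      (((M.nodeIdx k).filter fun i => x.1 ∈ M.nodeCells γ i ∧ x.2 ∈ M.nodeCells γ i).card : ℝ) *
        Q x + (2 * C * X x + 2 * C * X x.swap) := by
    intro x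
    by_cases hx : (M.element γ x.1 ∩ M.element γ x.2).Nonempty
    · obtain ⟨i, hi, h1, h2⟩ := M.exists_common_node h hx
      have hcard : 1 ≤ ((M.nodeIdx k).filter fun i =>
          x.1 ∈ M.nodeCells γ i ∧ x.2 ∈ M.nodeCells γ i).card :=
        Finset.card_pos.2 ⟨i, Finset.mem_filter.2
          ⟨hi, Mesh.mem_nodeCells.2 h1, Mesh.mem_nodeCells.2 h2⟩⟩
      have hcard' : (1 : ℝ) ≤ (((M.nodeIdx k).filter fun i =>
          x.1 ∈ M.nodeCells γ i ∧ x.2 ∈ M.nodeCells γ i).card : ℝ) := by exact_mod_cast hcard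
      have := mul_le_mul_of_nonneg_right hcard' (hQ0 x)
      have n1 := mul_nonneg hC.le (hX0 x)
      have n2 := mul_nonneg hC.le (hX0 x.swap)
      linarith
    · have n1 : 0 ≤ (((M.nodeIdx k).filter fun i =>
          x.1 ∈ M.nodeCells γ i ∧ x.2 ∈ M.nodeCells γ i).card : ℝ) * Q x :=
        mul_nonneg (Nat.cast_nonneg _) (hQ0 x)
      linarith [hQX x hx]
  refine (Finset.sum_le_sum fun x _ => hall x).trans ?_
  rw [Finset.sum_add_distrib, Finset.sum_add_distrib, ← Finset.mul_sum, ← Finset.mul_sum, hXswap]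
  refine add_le_add le_rfl ?_
  have := mul_le_mul_of_nonneg_left hXtot (show 0 ≤ 4 * C by positivity)
  linarith

theorem seminormSq_nonneg (μ : Measure Plane) (ω : Set Plane) (u : Plane → ℝ) :
    0 ≤ seminormSq μ ω u :=
  integral_nonneg fun _ => div_nonneg (sq_nonneg _) (sq_nonneg _)

theorem setIntegral_energy_le_seminormSq (h : IsParam k γ a b)
    (hν : ComparableMeasure (paramMeasure γ a b) a b c₀ C₀) (hg : Continuous g)
    (hgγ : EqOn g γ (Icc a b)) (r : HHalf (arcMeasure γ a b)) {i : Fin (M.n + 1)} {j l : Fin M.n}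
    (hj : j ∈ M.nodeCells γ i) (hl : l ∈ M.nodeCells γ i) :
    ∫ P in M.hcell j ×ˢ M.hcell l, energy g r P
        ∂((paramMeasure γ a b).prod (paramMeasure γ a b)) ≤
      seminormSq (arcMeasure γ a b) (M.nodePatch γ i) (HHalf.toL2 (arcMeasure γ a b) r) := by
  rw [seminormSq_nodePatch h hν hg hgγ]
  exact Finset.single_le_sum (f := fun x : Fin M.n × Fin M.n =>
    ∫ P in M.hcell x.1 ×ˢ M.hcell x.2, energy g r P
      ∂((paramMeasure γ a b).prod (paramMeasure γ a b)))
    (fun x _ => setIntegral_energy_nonneg r _)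
    (Finset.mem_product.2 ⟨hj, hl⟩ : (j, l) ∈ M.nodeCells γ i ×ˢ M.nodeCells γ i)

theorem integral_nurbs_mul_pullback_eq_zero {p : ℕ} (h : IsParam k γ a b) (D : NurbsData k p M)
    (hν : ComparableMeasure (paramMeasure γ a b) a b c₀ C₀) (hg : Continuous g)
    (hgγ : EqOn g γ (Icc a b)) (r : HHalf (arcMeasure γ a b)) (i : ℤ)
    (horth : ∀ ψ ∈ D.space γ,
      ∫ x, ψ x * HHalf.toL2 (arcMeasure γ a b) r x ∂(arcMeasure γ a b) = 0) :
    ∫ t, nurbs D.knots.t D.w p i t * pullback g r t ∂(paramMeasure γ a b) = 0 := by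
  have h1 := horth _ (D.basisFun_mem_space γ i)
  have h2 := (D.measurable_of_mem_space h (D.basisFun_mem_space γ i)).aestronglyMeasurable
    (μ := arcMeasure γ a b)
  rw [integral_comp_of_measurePreserving (IsParam.measurePreserving hν hg hgγ)
    (F := fun x => D.basisFun γ i x * HHalf.toL2 (arcMeasure γ a b) r x)
    (h2.mul (Lp.aestronglyMeasurable _))] at h1
  rw [← h1]
  refine integral_congr_ae ?_
  filter_upwards [D.basisFun_comp_ae_eq h hν hgγ i] with t ht
  rw [← ht]; rfl

theorem Mesh.sum_window_le (M : Mesh a b) (m : ℕ) {E : ℕ → ℝ} (hE : ∀ i, 0 ≤ E i) :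
    ∑ j : Fin M.n, ∑ i ∈ M.window j m, E i ≤ (2 * m + 1) * ∑ i ∈ Finset.range M.n, E i := by
  rw [← Finset.sum_range fun j => ∑ i ∈ M.window j m, E i,
    Finset.sum_comm' (t' := Finset.range M.n) (s' := fun i => M.window i m)
      (fun x y => by simp only [Finset.mem_range, Mesh.mem_window]; omega), Finset.mul_sum]
  refine Finset.sum_le_sum fun i _ => ?_
  rw [Finset.sum_const, nsmul_eq_mul]
  have : ((M.window i m).card : ℝ) ≤ 2 * m + 1 := by exact_mod_cast M.card_window_le i m
  exact mul_le_mul_of_nonneg_right this (hE i)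

theorem integral_sq_le_sum_div_len (hν : ComparableMeasure ν a b c₀ C₀) (M : Mesh a b)
    {u : ℝ → ℝ} (hu : MemLp u 2 ν) :
    ∫ t, u t ^ 2 ∂ν ≤
      (b - a) * ∑ j : Fin M.n, (∫ t in M.hcell j, u t ^ 2 ∂ν) / M.len j := by
  have e : ∫ t, u t ^ 2 ∂ν = ∑ j : Fin M.n, ∫ t in M.hcell j, u t ^ 2 ∂ν := by
    rw [← Finset.sum_range fun j => ∫ t in M.hcell j, u t ^ 2 ∂ν, Finset.range_eq_Ico,
      M.sum_setIntegral_hcell hu.integrable_sq (Nat.zero_le _), M.zc_zero, M.zc_of_le le_rfl]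
    refine (setIntegral_eq_integral_of_ae_compl_eq_zero ?_).symm
    filter_upwards [hν.ae_mem_Ioo] with t ht hn
    exact absurd (Ioo_subset_Ioc_self ht) hn
  rw [e, Finset.mul_sum]
  refine Finset.sum_le_sum fun j _ => ?_
  have hlen : M.len j ≤ b - a := by
    have h1 : M.zc (j + 1) ≤ b := M.z_le _
    have h2 : a ≤ M.zc j := M.le_z _
    rw [Mesh.len]; linarith
  have hlj := M.len_pos j.2
  have h0 : 0 ≤ (∫ t in M.hcell j, u t ^ 2 ∂ν) / M.len j :=
    div_nonneg (integral_nonneg fun t => sq_nonneg _) hlj.le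
  calc ∫ t in M.hcell j, u t ^ 2 ∂ν
      = M.len j * ((∫ t in M.hcell j, u t ^ 2 ∂ν) / M.len j) := by field_simp
    _ ≤ _ := mul_le_mul_of_nonneg_right hlen h0

/-- The squared seminorm on the patch of the right node of the `i`-th cell. -/
noncomputable def Mesh.rightPatchSeminormSq (M : Mesh a b) (γ : ℝ → Plane) (u : Plane → ℝ)
    (i : ℕ) : ℝ :=
  if hi : i < M.n then
    seminormSq (arcMeasure γ a b) (M.nodePatch γ (⟨i, hi⟩ : Fin M.n).succ) u else 0

theorem Mesh.rightPatchSeminormSq_of_lt (M : Mesh a b) (u : Plane → ℝ) {i : ℕ} (hi : i < M.n) :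
    M.rightPatchSeminormSq γ u i =
      seminormSq (arcMeasure γ a b) (M.nodePatch γ (⟨i, hi⟩ : Fin M.n).succ) u := dif_pos hi

theorem Mesh.rightPatchSeminormSq_nonneg (M : Mesh a b) (γ : ℝ → Plane) (u : Plane → ℝ) (i : ℕ) :
    0 ≤ M.rightPatchSeminormSq γ u i := by
  unfold Mesh.rightPatchSeminormSq
  split_ifs
  · exact seminormSq_nonneg _ _ _
  · exact le_rfl

theorem Mesh.sum_rightPatchSeminormSq_le (M : Mesh a b) (k : BdryType) (u : Plane → ℝ) :
    ∑ i ∈ Finset.range M.n, M.rightPatchSeminormSq γ u i ≤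
      ∑ i ∈ M.nodeIdx k, seminormSq (arcMeasure γ a b) (M.nodePatch γ i) u := by
  rw [Finset.sum_range]
  simp only [M.rightPatchSeminormSq_of_lt u (Fin.is_lt _), Fin.eta]
  refine (Finset.sum_map Finset.univ (Fin.succEmb M.n)
    fun i => seminormSq (arcMeasure γ a b) (M.nodePatch γ i) u).ge.trans ?_
  refine Finset.sum_le_sum_of_subset_of_nonneg (fun i hi => ?_)
    fun i _ _ => seminormSq_nonneg _ _ _
  obtain ⟨j, -, rfl⟩ := Finset.mem_map.1 hi
  exact M.succ_mem_nodeIdx k j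

theorem setIntegral_hcell_sq_sub_le (h : IsParam k γ a b)
    (hν : ComparableMeasure (paramMeasure γ a b) a b c₀ C₀) (hg : Continuous g)
    (hgγ : EqOn g γ (Icc a b)) (r : HHalf (arcMeasure γ a b)) (hC₀ : 0 ≤ C₀)
    (hL : ∀ s ∈ Icc a b, ∀ t ∈ Icc a b, ‖γ s - γ t‖ ≤ C₀ * |s - t|) {i l : ℕ} {ℓ : ℝ}
    (hi : i < M.n) (hl : l < M.n)
    (hil : (⟨l, hl⟩ : Fin M.n) ∈ M.nodeCells γ (⟨i, hi⟩ : Fin M.n).succ)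
    (hℓ : ∀ s ∈ M.hcell i, ∀ t ∈ M.hcell l, |s - t| ≤ ℓ) :
    ∫ P in M.hcell i ×ˢ M.hcell l, (pullback g r P.1 - pullback g r P.2) ^ 2
        ∂((paramMeasure γ a b).prod (paramMeasure γ a b)) ≤
      C₀ ^ 2 * ℓ ^ 2 * M.rightPatchSeminormSq γ (HHalf.toL2 (arcMeasure γ a b) r) i := by
  refine (setIntegral_sq_sub_le hν hg hgγ r h hL (M.measurableSet_hcell i)
    (M.measurableSet_hcell l) (M.hcell_subset i) (M.hcell_subset l) hℓ hC₀).trans ?_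
  have hmem : (⟨i, hi⟩ : Fin M.n) ∈ M.nodeCells γ (⟨i, hi⟩ : Fin M.n).succ :=
    Mesh.mem_nodeCells.2 (M.right_mem_element γ _)
  have := setIntegral_energy_le_seminormSq h hν hg hgγ r hmem hil
  rw [M.rightPatchSeminormSq_of_lt _ hi]
  exact mul_le_mul_of_nonneg_left this (by positivity)

/-- Orthogonality to the NURBS space gives a Poincaré inequality with the local mesh size. -/
theorem exists_weighted_estimate (h : IsParam k γ a b)
    (hν : ComparableMeasure (paramMeasure γ a b) a b c₀ C₀) (hg : Continuous g)
    (hgγ : EqOn g γ (Icc a b)) (hc₀ : 0 < c₀) (hC₀ : 0 < C₀)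
    (hL : ∀ s ∈ Icc a b, ∀ t ∈ Icc a b, ‖γ s - γ t‖ ≤ C₀ * |s - t|)
    (p : ℕ) {κ wmin : ℝ} (wmax : ℝ) (hκ1 : 1 ≤ κ) (hwmin : 0 < wmin) :
    ∃ K : ℝ, 0 < K ∧ ∀ (M : Mesh a b) (D : NurbsData k p M), M.RatioBound k κ →
      D.WeightsIn wmin wmax → ∀ r : HHalf (arcMeasure γ a b),
      (∀ ψ ∈ D.space γ, ∫ x, ψ x * HHalf.toL2 (arcMeasure γ a b) r x ∂(arcMeasure γ a b) = 0) →
      ∑ j : Fin M.n, (∫ t in M.hcell j, pullback g r t ^ 2 ∂(paramMeasure γ a b)) / M.len j ≤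
        K * ∑ i ∈ M.nodeIdx k,
          seminormSq (arcMeasure γ a b) (M.nodePatch γ i) (HHalf.toL2 (arcMeasure γ a b) r) := by
  obtain ⟨c, C, hc, hC, htest⟩ := NurbsData.exists_isTestFunction p (κ := κ) wmax hκ1 hwmin
  obtain ⟨K₁, hK₁, hloc⟩ := exists_local_estimate (c₀ := c₀) (C₀ := C₀) (κ := κ) (c := c)
    (C := C) (L := C₀) hc₀ hC₀ hκ1 hc ⌈(p : ℝ) / 2⌉₊
  generalize ⌈(p : ℝ) / 2⌉₊ = m at htest hloc
  refine ⟨K₁ * (2 * m + 1), by positivity, fun M D hRB hw r horth => ?_⟩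
  have hE := M.rightPatchSeminormSq_nonneg γ (HHalf.toL2 (arcMeasure γ a b) r)
  have hlocal : ∀ j : Fin M.n,
      (∫ t in M.hcell j, pullback g r t ^ 2 ∂(paramMeasure γ a b)) / M.len j ≤
      K₁ * ∑ i ∈ M.window j m,
        M.rightPatchSeminormSq γ (HHalf.toL2 (arcMeasure γ a b) r) i := by
    intro j
    obtain ⟨i, α, β, hR⟩ := htest k a b M D h.lt hRB hw j
    have := hloc k a b (paramMeasure γ a b) (pullback g r) M _ α β j _ hν
      (memLp_pullback hν hg hgγ r) hRB hR (integrable_nurbs h D hν i)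
      (integral_nurbs_mul_pullback_eq_zero h D hν hg hgγ r i horth) hE
      (fun i hi => setIntegral_hcell_sq_sub_le h hν hg hgγ r hC₀.le hL hi hi
        (Mesh.mem_nodeCells.2 (M.right_mem_element γ _)) fun s hs t ht => by
          simp only [Mesh.hcell, mem_Ioc] at hs ht
          rw [Mesh.len, abs_le]; constructor <;> linarith)
      (fun i hi => setIntegral_hcell_sq_sub_le h hν hg hgγ r hC₀.le hL (by omega) hi
        (Mesh.mem_nodeCells.2 (M.left_mem_element γ ⟨i + 1, hi⟩)) fun s hs t ht => by
          simp only [Mesh.hcell, mem_Ioc] at hs ht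
          rw [Mesh.len, Mesh.len, abs_le]; constructor <;> linarith)
    rw [div_le_iff₀ (M.len_pos j.2)]
    linarith
  refine (Finset.sum_le_sum fun j _ => hlocal j).trans ?_
  rw [← Finset.mul_sum, mul_assoc]
  exact mul_le_mul_of_nonneg_left ((M.sum_window_le m hE).trans
    (mul_le_mul_of_nonneg_left (M.sum_rightPatchSeminormSq_le k _) (by positivity))) hK₁.le

/-- Functions of `H^{1/2}` that are orthogonal to the NURBS space are controlled by their
seminorms on the node patches. -/
theorem exists_localization (h : IsParam k γ a b) (p : ℕ) (κ wmin wmax : ℝ) (hwmin : 0 < wmin) :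
    ∃ K : ℝ, 0 < K ∧ ∀ (M : Mesh a b) (D : NurbsData k p M), M.kappa γ ≤ κ →
      D.WeightsIn wmin wmax → ∀ r : HHalf (arcMeasure γ a b),
      (∀ ψ ∈ D.space γ, ∫ x, ψ x * HHalf.toL2 (arcMeasure γ a b) r x ∂(arcMeasure γ a b) = 0) →
      ‖r‖ ^ 2 ≤ K * ∑ i ∈ M.nodeIdx k,
        seminormSq (arcMeasure γ a b) (M.nodePatch γ i) (HHalf.toL2 (arcMeasure γ a b) r) := by
  obtain ⟨c₀, C₀, hc₀, hC₀, hb⟩ := h.exists_speed_bounds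
  have hν := comparableMeasure_paramMeasure hc₀ hC₀ hb
  have hL := h.lipschitz fun t ht => (hb t ht).2
  obtain ⟨g, hg, hgγ⟩ := h.exists_continuous_extension
  have hκ1 : 1 ≤ max κ 1 := le_max_right _ _
  obtain ⟨K₁, hK₁, hweight⟩ :=
    exists_weighted_estimate h hν hg hgγ hc₀ hC₀ hL p wmax hκ1 hwmin
  obtain ⟨K₂, hK₂, hen⟩ := exists_energy_bound h hν hg hgγ hκ1
  have hab := sub_pos.2 h.lt
  refine ⟨((b - a) + K₂) * K₁ + 1, by positivity, fun M D hκ hw r horth => ?_⟩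
  have hRB : M.RatioBound k (max κ 1) := M.ratioBound_of_kappa h (hκ.trans (le_max_left _ _))
  have hU := hweight M D hRB hw r horth
  have hL2 := integral_sq_le_sum_div_len hν M (memLp_pullback hν hg hgγ r)
  have hmain := hen M hRB r
  rw [norm_sq_eq hν hg hgγ]
  have h1 := mul_le_mul_of_nonneg_left hU (show 0 ≤ (b - a) + K₂ by positivity)
  linarith

end Reliability

/-! ### A posteriori error estimate -/

section Estimator

variable {k : BdryType} {γ : ℝ → Plane} {a b : ℝ} {p : ℕ} {M : Mesh a b}

/-- This is stated for general normed spaces since the topologies in the type of `V` below are not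
syntactically those of the norms. -/
theorem exists_norm_bounds {E F : Type*} [NormedAddCommGroup E] [NormedSpace ℝ E]
    [NormedAddCommGroup F] [NormedSpace ℝ F] (V : E ≃L[ℝ] F) :
    ∃ C : ℝ, 0 < C ∧ (∀ x, ‖V x‖ ≤ C * ‖x‖) ∧ ∀ x, ‖x‖ ≤ C * ‖V x‖ := by
  refine ⟨‖(V : E →L[ℝ] F)‖ + ‖(V.symm : F →L[ℝ] E)‖ + 1, by positivity, fun x => ?_, fun x => ?_⟩
  · refine ((V : E →L[ℝ] F).le_opNorm x).trans ?_
    gcongr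
    linarith [norm_nonneg (V.symm : F →L[ℝ] E)]
  · have h := (V.symm : F →L[ℝ] E).le_opNorm (V x)
    rw [ContinuousLinearEquiv.coe_coe, V.symm_apply_apply] at h
    refine h.trans ?_
    gcongr
    linarith [norm_nonneg (V : E →L[ℝ] F)]

theorem embedL2_apply {μ : Measure Plane} [SFinite μ] (χ : Lp ℝ 2 μ) (r : HHalf μ) :
    embedL2 μ χ r = ∫ x, χ x * HHalf.toL2 μ r x ∂μ := by
  change inner ℝ χ (HHalf.toL2 μ r) = _
  rw [L2.inner_def]
  refine integral_congr_ae (ae_of_all _ fun x => ?_)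
  simp [mul_comm]

theorem integral_mul_eq_zero_of_galerkin (h : IsParam k γ a b) (D : NurbsData k p M)
    {r : HHalf (arcMeasure γ a b)}
    (hr : ∀ χ ∈ D.spaceL2 γ, embedL2 (arcMeasure γ a b) χ r = 0) {ψ : Plane → ℝ}
    (hψ : ψ ∈ D.space γ) :
    ∫ x, ψ x * HHalf.toL2 (arcMeasure γ a b) r x ∂(arcMeasure γ a b) = 0 := by
  have hmem := D.memLp_of_mem_space h hψ
  rw [← hr (hmem.toLp ψ) ⟨ψ, hψ, hmem.coeFn_toLp⟩, embedL2_apply]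
  refine integral_congr_ae ?_
  filter_upwards [hmem.coeFn_toLp] with x hx
  rw [hx]

theorem embedL2_residual_eq_zero {μ : Measure Plane} [SFinite μ]
    {V : HMinusHalf μ ≃L[ℝ] HHalf μ} {f : HHalf μ} {X : Submodule ℝ (Lp ℝ 2 μ)} {φh : Lp ℝ 2 μ}
    (hφh : IsGalerkinSolution V f X φh) {χ : Lp ℝ 2 μ} (hχ : χ ∈ X) :
    embedL2 μ χ (f - V (embedL2 μ φh)) = 0 := by
  have h := hφh.2 χ hχ
  exact (map_sub (embedL2 μ χ) f _).trans (sub_eq_zero.2 h.symm)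

theorem residual_eq {μ : Measure Plane} [SFinite μ] {V : HMinusHalf μ ≃L[ℝ] HHalf μ}
    {f : HHalf μ} {φ : HMinusHalf μ} (hφ : IsWeakSolution V f φ) (φ' : HMinusHalf μ) :
    f - V φ' = V (φ - φ') := by
  have h : V φ = f := (SeparatingDual.eq_iff_forall_dual_eq (R := ℝ)).2 hφ
  rw [← h]
  exact (map_sub V φ φ').symm

/-- Reliability and efficiency, for fixed discrete data. -/
theorem estimator_bounds {V : HMinusHalf (arcMeasure γ a b) ≃L[ℝ] HHalf (arcMeasure γ a b)}
    {C K : ℝ} (hC : 0 < C) (hK : 0 < K) (hV : ∀ x, ‖V x‖ ≤ C * ‖x‖) (hV' : ∀ x, ‖x‖ ≤ C * ‖V x‖)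
    (h : IsParam k γ a b) {e : HMinusHalf (arcMeasure γ a b)}
    (hloc : ‖V e‖ ^ 2 ≤ K * ∑ i ∈ M.nodeIdx k,
      seminormSq (arcMeasure γ a b) (M.nodePatch γ i) (HHalf.toL2 (arcMeasure γ a b) (V e))) :
    (C * √K)⁻¹ * ‖e‖ ≤ estimator k γ M (V e) ∧ estimator k γ M (V e) ≤ √2 * C * ‖e‖ := by
  constructor
  · have h2 : ‖V e‖ ≤ √K * estimator k γ M (V e) := by
      rw [estimator, ← Real.sqrt_mul hK.le]
      exact Real.le_sqrt_of_sq_le hloc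
    rw [inv_mul_le_iff₀ (by positivity), mul_assoc]
    exact (hV' e).trans (mul_le_mul_of_nonneg_left h2 hC.le)
  · have h1 : estimator k γ M (V e) ≤ √2 * ‖V e‖ := by
      rw [estimator, ← Real.sqrt_sq (norm_nonneg (V e)), ← Real.sqrt_mul zero_le_two]
      exact Real.sqrt_le_sqrt (sum_seminormSq_le_norm h M (V e))
    rw [mul_assoc]
    exact h1.trans (mul_le_mul_of_nonneg_left (hV e) (Real.sqrt_nonneg 2))

end Estimator

end IGABEM

open IGABEM
theorem theorem4p4 (k : BdryType) (a b : ℝ) :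
    (∀ (p : ℕ) (κ wmin wmax : ℝ) (φ : ℝ → ℝ), 0 < wmin →
      ∃ q : ℝ, 0 < q ∧ q ≤ 1 ∧
        ∀ γ : ℝ → Plane, IsParam k γ a b → (∀ t ∈ Set.Ico a b, ‖rightDeriv γ t‖ = φ t) →
          ∀ (M : Mesh a b) (D : NurbsData k p M), M.kappa γ ≤ κ → D.WeightsIn wmin wmax →
            (∀ ψ ∈ D.space γ, MeasureTheory.MemLp ψ 2 (arcMeasure γ a b)) ∧
            SatisfiesA1A2 M γ (D.space γ) ⌈(p : ℝ) / 2⌉₊ q) ∧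
    (∀ γ : ℝ → Plane, IsParam k γ a b →
      ∀ V : HMinusHalf (arcMeasure γ a b) ≃L[ℝ] HHalf (arcMeasure γ a b), IsElliptic V →
        ∃ Ceff : ℝ, 0 < Ceff ∧
          ∀ (p : ℕ) (κ wmin wmax : ℝ), 0 < wmin →
            ∃ Crel : ℝ, 0 < Crel ∧
              ∀ (M : Mesh a b) (D : NurbsData k p M),
                FineMesh k γ M → M.kappa γ ≤ κ → D.WeightsIn wmin wmax →
                ∀ (f : HHalf (arcMeasure γ a b)) (φ : HMinusHalf (arcMeasure γ a b))
                  (φh : MeasureTheory.Lp ℝ 2 (arcMeasure γ a b)),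
                  IsWeakSolution V f φ → IsGalerkinSolution V f (D.spaceL2 γ) φh →
                  Crel⁻¹ * ‖φ - embedL2 (arcMeasure γ a b) φh‖ ≤
                      estimator k γ M (f - V (embedL2 (arcMeasure γ a b) φh)) ∧
                    estimator k γ M (f - V (embedL2 (arcMeasure γ a b) φh)) ≤
                      Ceff * ‖φ - embedL2 (arcMeasure γ a b) φh‖) := by
  refine ⟨fun p κ wmin wmax φ hwmin => exists_constant_A1A2 k a b p κ wmin wmax φ hwmin,
    fun γ h V _ => ?_⟩
  obtain ⟨C, hC, hV, hV'⟩ := exists_norm_bounds (E := HMinusHalf (arcMeasure γ a b))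
    (F := HHalf (arcMeasure γ a b)) V
  refine ⟨√2 * C, by positivity, fun p κ wmin wmax hwmin => ?_⟩
  obtain ⟨K, hK, hloc⟩ := exists_localization h p κ wmin wmax hwmin
  refine ⟨C * √K, by positivity, fun M D _ hκ hw f φ φh hφ hφh => ?_⟩
  have horth := hloc M D hκ hw _ fun ψ hψ =>
    integral_mul_eq_zero_of_galerkin h D (fun χ hχ => embedL2_residual_eq_zero hφh hχ) hψ
  have hre := residual_eq hφ (embedL2 (arcMeasure γ a b) φh)
  rw [hre] at horth ⊢
  exact estimator_bounds hC hK hV hV' h horth
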